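/- Let $\Omega=\{x\in\mathbb R^3 : x_3<0\}$, with outward unit normal $n=(0,0,1)$, let $p_+,p_-\in\partial\Omega$, and let $\Phi(x,y)=\frac{1}{4\pi|x-y|}$. Let $z_\pm\in\mathbb C$ be constants (contact impedances) with $\operatorname{Re} z_\pm\ge 0$. For $h>0$ let $\mathcal E^h_\pm=\{y\in\partial\Omega : |y-p_\pm|<h\}$ be the disk electrodes, and for $R>0$ put $$\Xi_R=\{x\in\Omega : |x-p_+|>R,\ |x-p_-|>R\},\qquad v(x)=2\bigl(\Phi(x,p_+)-\Phi(x,p_-)\bigr).$$ For every $R>0$ there is a constant $C$, which does not depend on $h$, such that the following holds for all $h>0$ with $2h<R$ for which $\mathcal E^h_+$ and $\mathcal E^h_-$ are disjoint. If $\widetilde P^h_\pm\in\mathbb C$ are constants and the complex-valued function $\widetilde u^h$, belonging to $H^1(\Omega\cap B)$ for every ball $B$, satisfies $$\Delta\widetilde u^h=0\ \text{ in }\Omega,\qquad \widetilde u^h+z_\pm\frac{\partial\widetilde u^h}{\partial n}=\widetilde P^h_\pm\ \text{ on }\mathcal E^h_\pm,\qquad \int_{\mathcal E^h_+}\frac{\partial\widetilde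 u^h}{\partial n}\,ds=1=-\int_{\mathcal E^h_-}\frac{\partial\widetilde u^h}{\partial n}\,ds,$$ $$\frac{\partial\widetilde u^h}{\partial n}=0\ \text{ on }\partial\Omega\setminus(\mathcal E^h_+\cup\mathcal E^h_-),\qquad \lim_{|x|\to\infty}\widetilde u^h(x)=0,$$ then $$\|\widetilde u^h-v\|_{H^1(\Xi_R)}\le C\,h .$$ Here the equation and the boundary conditions are meant in the weak sense: the boundary values of $\widetilde u^h$ are its trace, and $\partial\widetilde u^h/\partial n$ is a locally integrable function on $\partial\Omega$ defined by Green's formula $\int_\Omega\nabla\widetilde u^h\cdot\nabla\varphi\,dx=\int_{\partial\Omega}\frac{\partial\widetilde u^h}{\partial n}\varphi\,ds$ for all $\varphi\in C_c^\infty(\mathbb R^3)$. -/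

import Mathlib

open MeasureTheory Filter Topology Set
open scoped ContDiff ENNReal

noncomputable section

/-- Three-dimensional Euclidean space. -/
abbrev E3 : Type := EuclideanSpace ℝ (Fin 3)

/-- The lower half-space `{x₃ < 0}`. -/
def lowerHalfSpace : Set E3 := {x | x 2 < 0}

/-- The outward unit normal `(0, 0, 1)` of the lower half-space. -/
def outwardNormal : E3 := EuclideanSpace.single 2 1

/-- The parametrization `(a, b) ↦ (a, b, 0)` of the boundary plane. -/
def boundaryEmb (y : EuclideanSpace ℝ (Fin 2)) : E3 := !₂[y 0, y 1, 0]

/-- Surface measure `ds` on the boundary plane `{x₃ = 0}`: the image of two-dimensional Lebesgue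
measure under the isometric parametrization of the plane. -/
def surfaceMeasure : Measure E3 := Measure.map boundaryEmb volume

/-- The circular electrode of radius `h` centred at `p`: a disk in the boundary plane. -/
def electrode (p : E3) (h : ℝ) : Set E3 := {y | y 2 = 0 ∧ ‖y - p‖ < h}

/-- `Ξ_R`: the points of the half-space at distance more than `R` from both centres. -/
def farRegion (pPlus pMinus : E3) (R : ℝ) : Set E3 :=
  {x | x ∈ lowerHalfSpace ∧ R < ‖x - pPlus‖ ∧ R < ‖x - pMinus‖}

/-- The fundamental solution `Φ(x, y) = 1 / (4π|x - y|)`. -/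
def fundamentalSolution (x y : E3) : ℝ := 1 / (4 * Real.pi * ‖x - y‖)

/-- The point electrode potential of the half-space for unit current between `pPlus` and `pMinus`:
its Neumann data are `δ_{pPlus} - δ_{pMinus}`. On the boundary plane each `Φ(·, p)` carries the flux
`1 / 2`, since half of a small sphere around `p` lies in the half-space; hence the factor `2`. -/
def dipole (pPlus pMinus x : E3) : ℝ :=
  2 * (fundamentalSolution x pPlus - fundamentalSolution x pMinus)

/-- The partial derivative `∂φ/∂xᵢ` of a (smooth) function. -/
def partialDeriv (i : Fin 3) (φ : E3 → ℝ) (x : E3) : ℝ :=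
  fderiv ℝ φ x (EuclideanSpace.single i 1)

/-- Test functions of class `C_c^∞(U)`. -/
structure IsTestFunction (U : Set E3) (φ : E3 → ℝ) : Prop where
  smooth : ContDiff ℝ ∞ φ
  compact : HasCompactSupport φ
  support_subset : tsupport φ ⊆ U

/-- `G` is the weak gradient of `u` on the open set `U`. -/
structure HasWeakGradient (U : Set E3) (u : E3 → ℂ) (G : E3 → EuclideanSpace ℂ (Fin 3)) :
    Prop where
  locInt : LocallyIntegrableOn u U
  locInt_grad : LocallyIntegrableOn G U
  integral_eq : ∀ φ : E3 → ℝ, IsTestFunction U φ → ∀ i : Fin 3,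
    (∫ x in U, partialDeriv i φ x • u x) = -(∫ x in U, φ x • G x i)

/-- The `H¹(U)` norm `(‖u‖²_{L²(U)} + ‖∇u‖²_{L²(U)})^{1/2}`, with value `∞` if `u ∉ H¹(U)`. The weak
gradient is unique almost everywhere, so the infimum is over equal values (or over the empty set,
which gives `∞`). -/
def h1Norm (U : Set E3) (u : E3 → ℂ) : ℝ≥0∞ :=
  ⨅ (G : E3 → EuclideanSpace ℂ (Fin 3)) (_ : HasWeakGradient U u G),
    (eLpNorm u 2 (volume.restrict U) ^ 2 + eLpNorm G 2 (volume.restrict U) ^ 2) ^ (1 / 2 : ℝ)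

/-- `u` is locally `H¹` up to the boundary of the half-space `Ω`, with weak gradient `G`:
`u ∈ H¹(Ω ∩ B_r)` for every `r`. -/
structure IsH1Loc (u : E3 → ℂ) (G : E3 → EuclideanSpace ℂ (Fin 3)) : Prop where
  weakGrad : HasWeakGradient lowerHalfSpace u G
  memLp : ∀ r : ℝ, MemLp u 2 (volume.restrict (lowerHalfSpace ∩ Metric.ball 0 r))
  memLp_grad : ∀ r : ℝ, MemLp G 2 (volume.restrict (lowerHalfSpace ∩ Metric.ball 0 r))

/-- `f` is the boundary trace of `u` (with weak gradient `G`): it is locally `L²` on the boundary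
plane, and the Gauss-Green formula `∫_Ω ∂ᵢ(φ u) = ∫_∂Ω φ f nᵢ ds` holds for all test functions. -/
structure IsTrace (u : E3 → ℂ) (G : E3 → EuclideanSpace ℂ (Fin 3)) (f : E3 → ℂ) : Prop where
  memLp : ∀ r : ℝ, MemLp f 2 (surfaceMeasure.restrict (Metric.ball 0 r))
  gaussGreen : ∀ φ : E3 → ℝ, IsTestFunction univ φ → ∀ i : Fin 3,
    (∫ x in lowerHalfSpace, partialDeriv i φ x • u x) + (∫ x in lowerHalfSpace, φ x • G x i)
      = ∫ y, (φ y * outwardNormal i) • f y ∂surfaceMeasure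

/-- Weak form of `Δu = 0` in the half-space, for `u` with weak gradient `G`. -/
def IsWeaklyHarmonic (G : E3 → EuclideanSpace ℂ (Fin 3)) : Prop :=
  ∀ φ : E3 → ℝ, IsTestFunction lowerHalfSpace φ →
    (∫ x in lowerHalfSpace, ∑ i, partialDeriv i φ x • G x i) = 0

/-- `g` is the normal derivative `∂u/∂n` on the boundary of a harmonic `u` with weak gradient `G`,
in the sense of Green's formula `∫_Ω ∇u · ∇φ = ∫_∂Ω (∂u/∂n) φ ds`. -/
structure IsNormalDerivative (G : E3 → EuclideanSpace ℂ (Fin 3)) (g : E3 → ℂ) : Prop where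
  locInt : LocallyIntegrable g surfaceMeasure
  green : ∀ φ : E3 → ℝ, IsTestFunction univ φ →
    (∫ x in lowerHalfSpace, ∑ i, partialDeriv i φ x • G x i) = ∫ y, φ y • g y ∂surfaceMeasure

/-- `u` solves the complete electrode model in the half-space for the disk electrodes of radius `h`
centred at `pPlus` and `pMinus`, with contact impedances `zPlus`, `zMinus`, electrode potentials
`PPlus`, `PMinus` and unit injected current, and decays at infinity. -/
def IsCEMSolution (pPlus pMinus : E3) (h : ℝ) (zPlus zMinus PPlus PMinus : ℂ) (u : E3 → ℂ) :
    Prop :=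
  ∃ (G : E3 → EuclideanSpace ℂ (Fin 3)) (f g : E3 → ℂ),
    IsH1Loc u G ∧ IsTrace u G f ∧ IsWeaklyHarmonic G ∧ IsNormalDerivative G g ∧
    (∀ᵐ y ∂surfaceMeasure, y ∈ electrode pPlus h → f y + zPlus * g y = PPlus) ∧
    (∀ᵐ y ∂surfaceMeasure, y ∈ electrode pMinus h → f y + zMinus * g y = PMinus) ∧
    (∫ y in electrode pPlus h, g y ∂surfaceMeasure) = 1 ∧
    (∫ y in electrode pMinus h, g y ∂surfaceMeasure) = -1 ∧
    (∀ᵐ y ∂surfaceMeasure, y ∉ electrode pPlus h ∪ electrode pMinus h → g y = 0) ∧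
    Tendsto u (cocompact E3 ⊓ ae (volume.restrict lowerHalfSpace)) (𝓝 0)

end

/-! A decaying solution is determined by its boundary flux `g`: in the half-space it equals the
single layer potential `slp g`, the integral of `g(y) / (2π|x - y|)` over the plane, and its trace
is the same integral (`ae_eq_slp`, `trace_ae_eq_slp`). The function `v` is that potential with `g`
replaced by the difference of two unit point charges. Far from the electrodes, `u - v` therefore
measures how `g` differs from two point charges when tested against the smooth function `y ↦ 1 /
(2π|x - y|)`. No bound on the `L¹` norm of `g` that is uniform in `h` is at hand, since `g` is
complex and may oscillate; the Dirichlet energy takes its place.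

Energy bound (`energy_le`). By the energy identity, `∫|∇u|²` is the real part of the integral of `f`
times the conjugate of `g`. On each electrode `f = P - zg` with `Re z ≥ 0`, and since `|g|²` has at
least the integral of its constant competitor, the power is at most the mean of `Re f`, with the
sign of the current (`integral_power_le`). Conversely the integral of `Re f` over a disk of radius
`h` is at most `√(4πh³ · energy)`, as one sees by integrating the gradient along rays that spread
downwards from the disk to infinity (`IsNeumannPotential.sq_integral_electrode_le`). The two
estimates give `energy ≤ 16/(πh)`, whatever the impedances are.

Duality (`exists_pointCharge_bound`). For a smooth `k` with `|∇k| ≤ M` near the electrodes, localize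
`k - k(p)` to a ball of radius comparable to `h`. The resulting `Ψ` has gradient `O(M)` on a set of
volume `O(h³)`, and Green's formula turns `∫ Ψ g` into `∫ ∇Ψ · ∇u`, which is at most of order `M ·
h^(3/2) · h^(-1/2) = Mh`. Hence `g` acts on `k` as the pair of point charges up to `O(Mh)`. Two
electrodes that are close compared with `h` are treated by a single ball.

Conclusion. Since `2h < R`, the kernel may be replaced for `x` in `Ξ_R` by one that is smooth
everywhere. It and its first partial derivatives have gradients `O((1 + |x|)⁻²)` near the
electrodes, which is square integrable in three dimensions (`exists_farField_bound`). This bounds `u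
- v` and its gradient in `L²`.

The flux `g` is merely integrable, so that its potential need be neither continuous nor bounded up
to the plane. Limits are therefore taken along smooth compactly supported approximations
`slpApprox`, with weak `L²` convergence in the interior and the majorant `riesz` on the plane. -/

noncomputable section

/-! ### The regularized Newton kernel and its scale-invariant bounds. -/

/-- A smooth profile that agrees with `s ↦ 1 / (4π√s)` for `s ≥ 1` and vanishes near `0`. -/
def newtonProfile (s : ℝ) : ℝ := Real.smoothTransition (2 * s - 1) * (1 / (4 * Real.pi * √s))

lemma newtonProfile_contDiff : ContDiff ℝ ∞ newtonProfile := by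
  rw [contDiff_iff_contDiffAt]
  intro s
  rcases lt_or_ge s (1 / 2) with hs | hs
  · have : newtonProfile =ᶠ[𝓝 s] fun _ => 0 := by
      filter_upwards [Iio_mem_nhds hs] with t ht
      have ht' : t < 1 / 2 := ht
      rw [newtonProfile, Real.smoothTransition.zero_of_nonpos (by linarith), zero_mul]
    exact contDiffAt_const.congr_of_eventuallyEq this
  · have hs0 : s ≠ 0 := by positivity
    have hsq : √s ≠ 0 := (Real.sqrt_pos.2 (by positivity)).ne'
    refine ContDiffAt.mul ?_ ?_
    · exact (Real.smoothTransition.contDiff (n := ⊤)).contDiffAt.comp s (by fun_prop)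
    · refine contDiffAt_const.div (contDiffAt_const.mul (contDiffAt_id.sqrt hs0)) ?_
      positivity

lemma newtonProfile_of_one_le {s : ℝ} (hs : 1 ≤ s) : newtonProfile s = 1 / (4 * Real.pi * √s) := by
  rw [newtonProfile, Real.smoothTransition.one_of_one_le (by linarith), one_mul]

lemma newtonProfile_of_le_half {s : ℝ} (hs : s ≤ 1 / 2) : newtonProfile s = 0 := by
  rw [newtonProfile, Real.smoothTransition.zero_of_nonpos (by linarith), zero_mul]

lemma newtonProfile_nonneg (s : ℝ) : 0 ≤ newtonProfile s :=
  mul_nonneg (Real.smoothTransition.nonneg _) (by positivity)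

lemma newtonProfile_le (s : ℝ) : newtonProfile s ≤ 1 / (4 * Real.pi * √s) :=
  mul_le_of_le_one_left (by positivity) (Real.smoothTransition.le_one _)

lemma newtonProfile_le_const (s : ℝ) : newtonProfile s ≤ 1 / (2 * Real.pi) := by
  rcases le_total s (1 / 2) with hs | hs
  · rw [newtonProfile_of_le_half hs]; positivity
  · refine (newtonProfile_le s).trans ?_
    have : (1 / 2 : ℝ) ≤ √s := by
      apply Real.le_sqrt_of_sq_le; linarith
    have hpi := Real.pi_pos
    apply one_div_le_one_div_of_le (by positivity)
    nlinarith

/-- Regularization at scale `ε` of the fundamental solution `1 / (4π|x|)`. -/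
def newt (ε : ℝ) (x : E3) : ℝ := ε⁻¹ * newtonProfile (‖x‖ ^ 2 / ε ^ 2)

lemma newt_contDiff (ε : ℝ) : ContDiff ℝ ∞ (newt ε) := by
  unfold newt
  exact contDiff_const.mul (newtonProfile_contDiff.comp ((contDiff_norm_sq ℝ).div_const _))

lemma newt_of_le {ε : ℝ} (hε : 0 < ε) {x : E3} (hx : ε ≤ ‖x‖) :
    newt ε x = 1 / (4 * Real.pi * ‖x‖) := by
  have h1 : 1 ≤ ‖x‖ ^ 2 / ε ^ 2 := by
    rw [one_le_div (by positivity)]; gcongr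
  have hx0 : 0 < ‖x‖ := hε.trans_le hx
  rw [newt, newtonProfile_of_one_le h1, Real.sqrt_div (by positivity), Real.sqrt_sq hx0.le,
    Real.sqrt_sq hε.le]
  field_simp

lemma newt_nonneg {ε : ℝ} (hε : 0 < ε) (x : E3) : 0 ≤ newt ε x :=
  mul_nonneg (by positivity) (newtonProfile_nonneg _)

lemma newt_le {ε : ℝ} (hε : 0 < ε) (x : E3) : newt ε x ≤ 1 / (4 * Real.pi * ‖x‖) := by
  rcases eq_or_ne x 0 with rfl | hx
  · rw [newt, newtonProfile_of_le_half] <;> simp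
  have hx0 : 0 < ‖x‖ := norm_pos_iff.2 hx
  have := newtonProfile_le (‖x‖ ^ 2 / ε ^ 2)
  rw [Real.sqrt_div (by positivity), Real.sqrt_sq hx0.le, Real.sqrt_sq hε.le] at this
  calc newt ε x ≤ ε⁻¹ * (1 / (4 * Real.pi * (‖x‖ / ε))) := by unfold newt; gcongr
    _ = _ := by field_simp

lemma newt_le_const {ε : ℝ} (hε : 0 < ε) (x : E3) : newt ε x ≤ ε⁻¹ := by
  have h : newtonProfile (‖x‖ ^ 2 / ε ^ 2) ≤ 1 := by
    refine (newtonProfile_le_const _).trans ?_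
    have := Real.pi_gt_three
    rw [div_le_one (by positivity)]; linarith
  calc newt ε x ≤ ε⁻¹ * 1 := by unfold newt; gcongr
    _ = _ := mul_one _

lemma newt_scale (ε : ℝ) (x : E3) : newt ε x = ε⁻¹ * newt 1 (ε⁻¹ • x) := by
  simp only [newt, norm_smul, norm_inv, inv_one, one_mul, one_pow, div_one, mul_pow, inv_pow,
    Real.norm_eq_abs, sq_abs]
  rw [div_eq_inv_mul]

lemma newt_eq_newt {ε r : ℝ} (hε : 0 < ε) (hr : 0 < r) {x : E3} (h1 : ε ≤ ‖x‖) (h2 : r ≤ ‖x‖) :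
    newt ε x = newt r x := by
  rw [newt_of_le hε h1, newt_of_le hr h2]

lemma newt_eventuallyEq {ε r : ℝ} (hε : 0 < ε) (hr : 0 < r) {x : E3} (h1 : ε < ‖x‖) (h2 : r < ‖x‖) :
    newt ε =ᶠ[𝓝 x] newt r := by
  have hc : Continuous fun z : E3 => ‖z‖ := continuous_norm
  filter_upwards [hc.continuousAt.eventually (lt_mem_nhds h1),
    hc.continuousAt.eventually (lt_mem_nhds h2)] with z hz1 hz2
  exact newt_eq_newt hε hr hz1.le hz2.le

lemma newt_sub_hasCompactSupport {ε r : ℝ} (hε : 0 < ε) (hr : 0 < r) :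
    HasCompactSupport (fun x => newt ε x - newt r x) := by
  refine HasCompactSupport.intro (isCompact_closedBall (0 : E3) (max ε r)) fun x hx => ?_
  rw [mem_closedBall_zero_iff, not_le, max_lt_iff] at hx
  rw [newt_eq_newt hε hr hx.1.le hx.2.le, sub_self]

lemma fderiv_newt_scale (ε : ℝ) (x : E3) :
    fderiv ℝ (newt ε) x = (ε⁻¹ * ε⁻¹) • fderiv ℝ (newt 1) (ε⁻¹ • x) := by
  have : newt ε = fun x => ε⁻¹ • newt 1 (ε⁻¹ • x) := by ext x; exact newt_scale ε x
  have hd : Differentiable ℝ (newt 1) := (newt_contDiff 1).differentiable (by simp)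
  rw [this, fderiv_fun_const_smul (by fun_prop), fderiv_comp_smul, smul_smul]

lemma fderiv_newt_contDiff (ε : ℝ) : ContDiff ℝ ∞ (fderiv ℝ (newt ε)) :=
  (newt_contDiff ε).fderiv_right (by simp)

lemma fderiv_fderiv_newt_scale (ε : ℝ) (x : E3) :
    fderiv ℝ (fderiv ℝ (newt ε)) x =
      (ε⁻¹ * ε⁻¹ * ε⁻¹) • fderiv ℝ (fderiv ℝ (newt 1)) (ε⁻¹ • x) := by
  have : fderiv ℝ (newt ε) = fun x => (ε⁻¹ * ε⁻¹) • fderiv ℝ (newt 1) (ε⁻¹ • x) := by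
    ext1 x; exact fderiv_newt_scale ε x
  have hd : Differentiable ℝ (fderiv ℝ (newt 1)) := (fderiv_newt_contDiff 1).differentiable (by simp)
  have hd' : DifferentiableAt ℝ (fun x => fderiv ℝ (newt 1) (ε⁻¹ • x)) x := by fun_prop
  have h1 := (hd'.hasFDerivAt.const_smul (ε⁻¹ * ε⁻¹)).fderiv
  have h2 : fderiv ℝ (fun x => (ε⁻¹ * ε⁻¹) • fderiv ℝ (newt 1) (ε⁻¹ • x)) x = _ := h1
  rw [this, h2, fderiv_comp_smul, smul_smul]

/-- Reduction of bounds on the derivatives of `newt` to points within distance `2ε`. -/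
lemma exists_newt_bounds : ∃ C : ℝ, 0 < C ∧
    (∀ ε > 0, ∀ x : E3, ‖fderiv ℝ (newt ε) x‖ ≤ C / ‖x‖ ^ 2 ∨ x = 0) ∧
    (∀ ε > 0, ∀ x : E3, ‖fderiv ℝ (newt ε) x‖ ≤ C / ε ^ 2) ∧
    (∀ ε > 0, ∀ x : E3, ‖fderiv ℝ (fderiv ℝ (newt ε)) x‖ ≤ C / ‖x‖ ^ 3 ∨ x = 0) := by
  obtain ⟨A, hA⟩ := (isCompact_closedBall (0 : E3) 2).exists_bound_of_continuousOn
    (f := fderiv ℝ (newt 1)) (fderiv_newt_contDiff 1).continuous.continuousOn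
  obtain ⟨B, hB⟩ := (isCompact_closedBall (0 : E3) 2).exists_bound_of_continuousOn
    (f := fderiv ℝ (fderiv ℝ (newt 1)))
    ((fderiv_newt_contDiff 1).continuous_fderiv (by simp)).continuousOn
  have hA0 : 0 ≤ A := (norm_nonneg _).trans (hA 0 (by simp))
  have hB0 : 0 ≤ B := (norm_nonneg _).trans (hB 0 (by simp))
  set C := 1 + 4 * A + 8 * B
  -- By homogeneity the point is rescaled into the fixed ball of radius 2, where compactness gives
  -- the bound.
  have near1 : ∀ ε > 0, ∀ x : E3, ‖x‖ ≤ 2 * ε → ‖fderiv ℝ (newt ε) x‖ ≤ A / ε ^ 2 := by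
    intro ε hε x hx
    rw [fderiv_newt_scale, norm_smul]
    have hm : ε⁻¹ • x ∈ Metric.closedBall (0 : E3) 2 := by
      rw [mem_closedBall_zero_iff, norm_smul, norm_inv, Real.norm_of_nonneg hε.le,
        inv_mul_le_iff₀ hε]; linarith
    rw [Real.norm_of_nonneg (by positivity)]
    calc ε⁻¹ * ε⁻¹ * ‖fderiv ℝ (newt 1) (ε⁻¹ • x)‖ ≤ ε⁻¹ * ε⁻¹ * A := by gcongr; exact hA _ hm
      _ = A / ε ^ 2 := by field_simp
  have near2 : ∀ ε > 0, ∀ x : E3, ‖x‖ ≤ 2 * ε →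
      ‖fderiv ℝ (fderiv ℝ (newt ε)) x‖ ≤ B / ε ^ 3 := by
    intro ε hε x hx
    rw [fderiv_fderiv_newt_scale]
    refine (ContinuousLinearMap.opNorm_smul_le _ _).trans ?_
    have hm : ε⁻¹ • x ∈ Metric.closedBall (0 : E3) 2 := by
      rw [mem_closedBall_zero_iff, norm_smul, norm_inv, Real.norm_of_nonneg hε.le,
        inv_mul_le_iff₀ hε]; linarith
    rw [Real.norm_of_nonneg (by positivity)]
    calc ε⁻¹ * ε⁻¹ * ε⁻¹ * ‖fderiv ℝ (fderiv ℝ (newt 1)) (ε⁻¹ • x)‖ ≤ ε⁻¹ * ε⁻¹ * ε⁻¹ * B := by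
          gcongr; exact hB _ hm
      _ = B / ε ^ 3 := by field_simp
  have first : ∀ ε > 0, ∀ x : E3, x ≠ 0 → ‖fderiv ℝ (newt ε) x‖ ≤ 4 * A / ‖x‖ ^ 2 := by
    intro ε hε x hx
    have hx0 : 0 < ‖x‖ := norm_pos_iff.2 hx
    rcases le_or_gt ‖x‖ (2 * ε) with h | h
    · refine (near1 ε hε x h).trans ?_
      rw [div_le_div_iff₀ (by positivity) (by positivity)]
      have : ‖x‖ ^ 2 ≤ (2 * ε) ^ 2 := by gcongr
      nlinarith
    -- Beyond its scale the kernel no longer depends on it, so `ε` may be replaced by `‖x‖ / 2`;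
    -- then `x` lies exactly on the edge of the region of `near1`.
    · rw [(newt_eventuallyEq hε (half_pos hx0) (by linarith) (by linarith)).fderiv_eq]
      refine (near1 _ (half_pos hx0) x (by linarith)).trans (le_of_eq ?_)
      field_simp
      norm_num
  refine ⟨C, by positivity, fun ε hε x => ?_, fun ε hε x => ?_, fun ε hε x => ?_⟩
  · refine or_iff_not_imp_right.2 fun hx => (first ε hε x hx).trans ?_
    gcongr; linarith
  · rcases le_or_gt ‖x‖ (2 * ε) with h | h
    · refine (near1 ε hε x h).trans ?_
      gcongr; linarith
    · have hx0 : 0 < ‖x‖ := by linarith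
      refine (first ε hε x (norm_pos_iff.1 hx0)).trans ?_
      have h1 : ε ^ 2 ≤ ‖x‖ ^ 2 := by gcongr; linarith
      gcongr; linarith
  · refine or_iff_not_imp_right.2 fun hx => ?_
    have hx0 : 0 < ‖x‖ := norm_pos_iff.2 hx
    refine le_trans (b := 8 * B / ‖x‖ ^ 3) ?_ (by gcongr; linarith)
    rcases le_or_gt ‖x‖ (2 * ε) with h | h
    · refine (near2 ε hε x h).trans ?_
      rw [div_le_div_iff₀ (by positivity) (by positivity)]
      have : ‖x‖ ^ 3 ≤ (2 * ε) ^ 3 := by gcongr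
      nlinarith
    · rw [(newt_eventuallyEq hε (half_pos hx0) (by linarith) (by linarith)).fderiv.fderiv_eq]
      refine (near2 _ (half_pos hx0) x (by linarith)).trans (le_of_eq ?_)
      field_simp
      norm_num

/-- A constant bounding the derivatives of `newt`. -/
def newtC : ℝ := exists_newt_bounds.choose

lemma newtC_pos : 0 < newtC := exists_newt_bounds.choose_spec.1

lemma norm_fderiv_newt_le {ε : ℝ} (hε : 0 < ε) {x : E3} (hx : x ≠ 0) :
    ‖fderiv ℝ (newt ε) x‖ ≤ newtC / ‖x‖ ^ 2 :=
  (exists_newt_bounds.choose_spec.2.1 ε hε x).resolve_right hx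

lemma norm_fderiv_newt_le_const {ε : ℝ} (hε : 0 < ε) (x : E3) :
    ‖fderiv ℝ (newt ε) x‖ ≤ newtC / ε ^ 2 :=
  exists_newt_bounds.choose_spec.2.2.1 ε hε x

lemma norm_fderiv_fderiv_newt_le {ε : ℝ} (hε : 0 < ε) {x : E3} (hx : x ≠ 0) :
    ‖fderiv ℝ (fderiv ℝ (newt ε)) x‖ ≤ newtC / ‖x‖ ^ 3 :=
  (exists_newt_bounds.choose_spec.2.2.2 ε hε x).resolve_right hx

/-! ### The Laplacian of the kernel as a smooth approximate identity. -/

/-- The Laplacian `∑ᵢ ∂ᵢ∂ᵢ φ`. -/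
def laplace (φ : E3 → ℝ) (x : E3) : ℝ := ∑ i, partialDeriv i (partialDeriv i φ) x

/-- The profile of `-Δ (newt 1)`. -/
def deltaProfile (s : ℝ) : ℝ :=
  -(6 * deriv newtonProfile s + 4 * s * deriv (deriv newtonProfile) s)

lemma partialDeriv_radial {q : ℝ → ℝ} (hq : Differentiable ℝ q) (i : Fin 3) (x : E3) :
    partialDeriv i (fun x => q (‖x‖ ^ 2)) x = deriv q (‖x‖ ^ 2) * (2 * x i) := by
  have h1 := (hasStrictFDerivAt_norm_sq x).hasFDerivAt
  have h2 := (hq (‖x‖ ^ 2)).hasDerivAt.comp_hasFDerivAt x h1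
  rw [partialDeriv]
  have h3 : fderiv ℝ (fun x : E3 => q (‖x‖ ^ 2)) x = _ := h2.fderiv
  rw [h3]
  simp [EuclideanSpace.inner_single_right]

/-- The factor 6 is twice the dimension, and `∑ xᵢ² = ‖x‖²` collects the second order terms. -/
lemma laplace_radial {q : ℝ → ℝ} (hq : ContDiff ℝ ∞ q) (x : E3) :
    laplace (fun x => q (‖x‖ ^ 2)) x =
      6 * deriv q (‖x‖ ^ 2) + 4 * ‖x‖ ^ 2 * deriv (deriv q) (‖x‖ ^ 2) := by
  have hq1 : Differentiable ℝ q := hq.differentiable (by simp)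
  have hq2 : Differentiable ℝ (deriv q) := by
    have : ContDiff ℝ ∞ (deriv q) := (contDiff_infty_iff_deriv.1 hq).2
    exact this.differentiable (by simp)
  have h : ∀ i, partialDeriv i (partialDeriv i (fun x : E3 => q (‖x‖ ^ 2))) x =
      2 * deriv q (‖x‖ ^ 2) + 4 * (x i) ^ 2 * deriv (deriv q) (‖x‖ ^ 2) := by
    intro i
    have e : partialDeriv i (fun x : E3 => q (‖x‖ ^ 2)) =
        fun x => deriv q (‖x‖ ^ 2) * (2 * x i) := by
      ext x; exact partialDeriv_radial hq1 i x
    have e2 := partialDeriv_radial hq2 i x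
    rw [partialDeriv] at e2 ⊢
    have hd1 : DifferentiableAt ℝ (fun x : E3 => deriv q (‖x‖ ^ 2)) x :=
      (hq2 _).comp x (hasStrictFDerivAt_norm_sq x).hasFDerivAt.differentiableAt
    rw [e, fderiv_fun_mul hd1 (by fun_prop)]
    have h3 : fderiv ℝ (fun x : E3 => 2 * x i) x (EuclideanSpace.single i 1) = 2 := by
      have h4 : HasFDerivAt (fun x : E3 => 2 * x i)
          ((2 : ℝ) • (EuclideanSpace.proj i : E3 →L[ℝ] ℝ)) x :=
        (EuclideanSpace.proj (𝕜 := ℝ) i : E3 →L[ℝ] ℝ).hasFDerivAt.const_mul 2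
      rw [h4.fderiv]
      simp
    simp only [_root_.add_apply, _root_.smul_apply, smul_eq_mul, h3]
    have e2' : (fderiv ℝ (fun x : E3 => deriv q (‖x‖ ^ 2)) x) (EuclideanSpace.single i 1) = _ := e2
    rw [e2']
    ring
  rw [laplace, Finset.sum_congr rfl fun i _ => h i]
  have hn : ‖x‖ ^ 2 = x 0 ^ 2 + x 1 ^ 2 + x 2 ^ 2 := by
    rw [EuclideanSpace.norm_sq_eq]; simp [Fin.sum_univ_three]
  rw [Fin.sum_univ_three]
  linear_combination (-4 * deriv (deriv q) (‖x‖ ^ 2)) * hn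

lemma laplace_newt (ε : ℝ) (x : E3) :
    laplace (newt ε) x = -((ε⁻¹) ^ 3 * deltaProfile (‖x‖ ^ 2 / ε ^ 2)) := by
  set q : ℝ → ℝ := fun s => ε⁻¹ * newtonProfile (s / ε ^ 2)
  have hq : ContDiff ℝ ∞ q := contDiff_const.mul (newtonProfile_contDiff.comp (by fun_prop))
  have hd1 : Differentiable ℝ newtonProfile := newtonProfile_contDiff.differentiable (by simp)
  have hc2 : ContDiff ℝ ∞ (deriv newtonProfile) := (contDiff_infty_iff_deriv.1 newtonProfile_contDiff).2
  have hd2 : Differentiable ℝ (deriv newtonProfile) := hc2.differentiable (by simp)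
  have e1 : deriv q = fun s => (ε⁻¹) ^ 3 * deriv newtonProfile (s / ε ^ 2) := by
    ext s
    have h := ((hd1 (s / ε ^ 2)).hasDerivAt.comp s ((hasDerivAt_id s).div_const (ε ^ 2))).const_mul
      ε⁻¹
    have h' : deriv q s = _ := h.deriv
    rw [h']; ring
  have e2 : deriv (deriv q) = fun s => (ε⁻¹) ^ 5 * deriv (deriv newtonProfile) (s / ε ^ 2) := by
    rw [e1]
    ext s
    have h := ((hd2 (s / ε ^ 2)).hasDerivAt.comp s ((hasDerivAt_id s).div_const (ε ^ 2))).const_mul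
      ((ε⁻¹) ^ 3)
    have h' : deriv (fun s => (ε⁻¹) ^ 3 * deriv newtonProfile (s / ε ^ 2)) s = _ := h.deriv
    rw [h']; ring
  have := laplace_radial hq x
  rw [e2, e1] at this
  rw [show newt ε = fun x => q (‖x‖ ^ 2) from rfl, this, deltaProfile]
  ring

lemma deltaProfile_continuous : Continuous deltaProfile := by
  have hc2 : ContDiff ℝ ∞ (deriv newtonProfile) := (contDiff_infty_iff_deriv.1 newtonProfile_contDiff).2
  have hc3 : ContDiff ℝ ∞ (deriv (deriv newtonProfile)) := (contDiff_infty_iff_deriv.1 hc2).2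
  have := hc2.continuous
  have := hc3.continuous
  unfold deltaProfile
  fun_prop

lemma deriv_newtonProfile {s : ℝ} (hs : 1 < s) :
    deriv newtonProfile s = -(1 / (8 * Real.pi * (s * √s))) := by
  have h : newtonProfile =ᶠ[𝓝 s] fun s => 1 / (4 * Real.pi * √s) := by
    filter_upwards [lt_mem_nhds hs] with t ht using newtonProfile_of_one_le ht.le
  have hs0 : 0 < √s := Real.sqrt_pos.2 (by linarith)
  have hsq : √s * √s = s := Real.mul_self_sqrt (by linarith)
  rw [h.deriv_eq]
  have h1 := ((Real.hasDerivAt_sqrt (by linarith : s ≠ 0)).const_mul (4 * Real.pi)).inv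
    (by positivity)
  simp only [one_div]
  rw [show (fun s => (4 * Real.pi * √s)⁻¹) = (fun s => 4 * Real.pi * √s)⁻¹ from rfl, h1.deriv]
  have hpi := Real.pi_pos
  have hs1 : 0 < s := by linarith
  rw [show (4 * Real.pi * √s) ^ 2 = 16 * Real.pi ^ 2 * s by rw [mul_pow, Real.sq_sqrt hs1.le]; ring]
  field_simp
  norm_num

/-- This is harmonicity of `1/|x|`: for `s > 1` the profile is a multiple of `s^(-1/2)`, which
solves `6q' + 4sq'' = 0`. The endpoint `s = 1` follows by continuity. -/
lemma deltaProfile_of_one_le {s : ℝ} (hs : 1 ≤ s) : deltaProfile s = 0 := by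
  have key : ∀ s ∈ Ioi (1 : ℝ), deltaProfile s = 0 := by
    intro s hs
    have hs' : (1 : ℝ) < s := hs
    have h : deriv newtonProfile =ᶠ[𝓝 s] fun s => -(1 / (8 * Real.pi * (s * √s))) := by
      filter_upwards [lt_mem_nhds hs'] with t ht using deriv_newtonProfile ht
    have hs0 : 0 < √s := Real.sqrt_pos.2 (by linarith)
    have hsq : √s * √s = s := Real.mul_self_sqrt (by linarith)
    have hpi := Real.pi_pos
    have hs1 : 0 < s := by linarith
    have h1 := ((((hasDerivAt_id s).mul (Real.hasDerivAt_sqrt hs1.ne')).const_mul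
      (8 * Real.pi)).inv (by simp only [Pi.mul_apply, id]; positivity)).neg
    have h2 := h1.deriv
    rw [deltaProfile, h.deriv_eq, deriv_newtonProfile hs']
    simp only [one_div]
    rw [show (fun s => -(8 * Real.pi * (s * √s))⁻¹) =
      (-(fun y => 8 * Real.pi * (id * fun x : ℝ => √x : ℝ → ℝ) y)⁻¹) from rfl, h2]
    simp only [id, Pi.mul_apply]
    simp only [mul_one_div]
    rw [show s / (2 * √s) = √s / 2 by rw [div_eq_div_iff (by positivity) (by positivity)]; nlinarith]
    field_simp
    ring
  have hcl : closure (Ioi (1 : ℝ)) ⊆ {s | deltaProfile s = 0} :=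
    (isClosed_eq deltaProfile_continuous continuous_const).closure_subset_iff.2 key
  rw [closure_Ioi] at hcl
  exact hcl hs

/-- The smooth approximate identity `-Δ (newt ε)`. -/
def delta (ε : ℝ) (x : E3) : ℝ := (ε⁻¹) ^ 3 * deltaProfile (‖x‖ ^ 2 / ε ^ 2)

lemma delta_continuous (ε : ℝ) : Continuous (delta ε) := by
  have := deltaProfile_continuous
  unfold delta; fun_prop

lemma delta_of_le {ε : ℝ} (hε : 0 < ε) {x : E3} (hx : ε ≤ ‖x‖) : delta ε x = 0 := by
  have h1 : 1 ≤ ‖x‖ ^ 2 / ε ^ 2 := by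
    rw [one_le_div (by positivity)]; gcongr
  rw [delta, deltaProfile_of_one_le h1, mul_zero]

lemma exists_deltaProfile_bound : ∃ C : ℝ, 0 < C ∧ ∀ s, 0 ≤ s → |deltaProfile s| ≤ C := by
  obtain ⟨A, hA⟩ := (isCompact_Icc (a := (0 : ℝ)) (b := 1)).exists_bound_of_continuousOn
    deltaProfile_continuous.continuousOn
  have hA0 : 0 ≤ A := (norm_nonneg _).trans (hA 0 (by simp))
  refine ⟨A + 1, by positivity, fun s hs => ?_⟩
  rcases le_total s 1 with h | h
  · have := hA s ⟨hs, h⟩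
    rw [Real.norm_eq_abs] at this; linarith
  · rw [deltaProfile_of_one_le h, abs_zero]; positivity

/-- A bound on `deltaProfile`. -/
def deltaC : ℝ := exists_deltaProfile_bound.choose

lemma deltaC_pos : 0 < deltaC := exists_deltaProfile_bound.choose_spec.1

lemma abs_delta_le {ε : ℝ} (hε : 0 < ε) (x : E3) : |delta ε x| ≤ deltaC * (ε⁻¹) ^ 3 := by
  rw [delta, abs_mul, abs_of_nonneg (by positivity), mul_comm]
  gcongr
  exact exists_deltaProfile_bound.choose_spec.2 _ (by positivity)

/-- In polar coordinates the integrand `r² · deltaProfile (r²)` is the derivative of `-2r³ q'(r²)`,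
the flux through the sphere of radius `r` up to the factor `4π`. It vanishes at 0 and is constantly
`1/(4π)` for `r > 1`. -/
lemma integral_deltaProfile : ∫ x : E3, deltaProfile (‖x‖ ^ 2) = 1 := by
  have hd1 : Differentiable ℝ newtonProfile := newtonProfile_contDiff.differentiable (by simp)
  have hc2 : ContDiff ℝ ∞ (deriv newtonProfile) :=
    (contDiff_infty_iff_deriv.1 newtonProfile_contDiff).2
  have hd2 : Differentiable ℝ (deriv newtonProfile) := hc2.differentiable (by simp)
  have h := integral_fun_norm_addHaar (volume : Measure E3) (fun r => deltaProfile (r ^ 2))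
  rw [h]
  have hv : (volume : Measure E3).real (Metric.ball 0 1) = Real.pi * 4 / 3 := by
    rw [Measure.real, EuclideanSpace.volume_ball_fin_three]
    simp
    positivity
  have hder : ∀ r : ℝ, HasDerivAt (fun r => -(2 * r ^ 3 * deriv newtonProfile (r ^ 2)))
      (r ^ 2 * deltaProfile (r ^ 2)) r := by
    intro r
    have h1 := (((hasDerivAt_pow 3 r).const_mul 2).mul
      ((hd2 (r ^ 2)).hasDerivAt.comp r (hasDerivAt_pow 2 r))).neg
    refine h1.congr_deriv ?_
    simp only [deltaProfile, Function.comp]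
    push_cast
    ring
  have hlim : Tendsto (fun r : ℝ => -(2 * r ^ 3 * deriv newtonProfile (r ^ 2))) atTop
      (𝓝 (1 / (4 * Real.pi))) := by
    refine tendsto_const_nhds.congr' ?_
    filter_upwards [eventually_gt_atTop 1] with r hr
    have hr2 : 1 < r ^ 2 := by nlinarith
    rw [deriv_newtonProfile hr2, Real.sqrt_sq (by linarith)]
    have hpi := Real.pi_pos
    have : r ≠ 0 := by positivity
    field_simp
    norm_num
  have hint : IntegrableOn (fun r : ℝ => r ^ 2 * deltaProfile (r ^ 2)) (Ioi 0) := by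
    have hc : Continuous fun r : ℝ => r ^ 2 * deltaProfile (r ^ 2) := by
      have := deltaProfile_continuous
      fun_prop
    refine (hc.integrable_of_hasCompactSupport ?_).integrableOn
    refine HasCompactSupport.intro (isCompact_Icc (a := (-1 : ℝ)) (b := 1)) fun x hx => ?_
    rw [deltaProfile_of_one_le, mul_zero]
    by_contra! hlt
    exact hx (abs_le.1 ((sq_lt_one_iff_abs_lt_one x).1 hlt).le)
  have hI := integral_Ioi_of_hasDerivAt_of_tendsto (hder 0).continuousAt.continuousWithinAt
    (fun r _ => hder r) hint hlim
  simp only [finrank_euclideanSpace, Fintype.card_fin, Nat.add_one_sub_one, smul_eq_mul, hv]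
  rw [hI]
  have hpi := Real.pi_pos
  field_simp
  norm_num

lemma integral_delta {ε : ℝ} (hε : 0 < ε) : ∫ x : E3, delta ε x = 1 := by
  have h := Measure.integral_comp_smul (volume : Measure E3) (fun x => deltaProfile (‖x‖ ^ 2)) ε⁻¹
  rw [integral_deltaProfile] at h
  simp only [norm_smul, mul_pow, norm_inv, Real.norm_eq_abs, inv_pow, sq_abs,
    finrank_euclideanSpace, Fintype.card_fin, inv_inv, smul_eq_mul, mul_one] at h
  have e : (fun x : E3 => delta ε x) =
      fun x => (ε⁻¹) ^ 3 * deltaProfile ((ε ^ 2)⁻¹ * ‖x‖ ^ 2) := by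
    ext x; rw [delta, div_eq_inv_mul]
  rw [e, integral_const_mul, h, abs_of_pos (by positivity)]
  field_simp

lemma laplace_newt_eq (ε : ℝ) (x : E3) : laplace (newt ε) x = -delta ε x := laplace_newt ε x

/-! ### The boundary plane, its surface measure and the divergence theorem. -/

/-- Cartesian coordinates `(y, s) ↦ (y, s)` of space adapted to the boundary plane. -/
def planeProd (q : EuclideanSpace ℝ (Fin 2) × ℝ) : E3 := !₂[q.1 0, q.1 1, q.2]

lemma planeProd_measurePreserving : MeasurePreserving planeProd volume volume := by
  have h1 : MeasurePreserving (fun q : EuclideanSpace ℝ (Fin 2) × ℝ =>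
      (Prod.map (id : ℝ → ℝ) (MeasurableEquiv.toLp 2 (Fin 2 → ℝ)).symm q.swap)) volume volume :=
    ((MeasurePreserving.id volume).prod
      (EuclideanSpace.volume_preserving_symm_measurableEquiv_toLp (Fin 2))).comp
      Measure.measurePreserving_swap
  have h2 := ((volume_preserving_piFinSuccAbove (fun _ : Fin 3 => ℝ) 2).symm).comp h1
  have h3 := (EuclideanSpace.volume_preserving_symm_measurableEquiv_toLp (Fin 3)).symm.comp h2
  have h4 : planeProd = (MeasurableEquiv.toLp 2 (Fin 3 → ℝ)).symm.symm ∘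
      (MeasurableEquiv.piFinSuccAbove (fun _ => ℝ) 2).symm ∘
      fun q => Prod.map id (MeasurableEquiv.toLp 2 (Fin 2 → ℝ)).symm q.swap := by
    funext q
    refine PiLp.ext fun i => ?_
    fin_cases i <;> rfl
  rw [h4]
  exact h3

lemma planeProd_eq (y : EuclideanSpace ℝ (Fin 2)) (s : ℝ) :
    planeProd (y, s) = boundaryEmb y + s • outwardNormal := by
  ext i
  fin_cases i <;> simp [planeProd, boundaryEmb, outwardNormal]

lemma boundaryEmb_continuous : Continuous boundaryEmb := by
  unfold boundaryEmb
  refine (PiLp.continuous_toLp 2 _).comp (continuous_pi fun i => ?_)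
  fin_cases i <;> simp <;> fun_prop

lemma planeProd_continuous : Continuous planeProd := by
  unfold planeProd
  refine (PiLp.continuous_toLp 2 _).comp (continuous_pi fun i => ?_)
  fin_cases i <;> simp <;> fun_prop

lemma norm_boundaryEmb_sub (y z : EuclideanSpace ℝ (Fin 2)) :
    ‖boundaryEmb y - boundaryEmb z‖ = ‖y - z‖ := by
  rw [EuclideanSpace.norm_eq, EuclideanSpace.norm_eq]
  simp [boundaryEmb, Fin.sum_univ_three, Fin.sum_univ_two]

lemma boundaryEmb_isometry : Isometry boundaryEmb :=
  Isometry.of_dist_eq fun y z => by rw [dist_eq_norm, dist_eq_norm, norm_boundaryEmb_sub]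

lemma boundaryEmb_measurableEmbedding : MeasurableEmbedding boundaryEmb :=
  boundaryEmb_isometry.isClosedEmbedding.measurableEmbedding

lemma boundaryEmb_apply_two (y : EuclideanSpace ℝ (Fin 2)) : boundaryEmb y 2 = 0 := rfl

lemma exists_boundaryEmb {x : E3} (hx : x 2 = 0) : ∃ y, boundaryEmb y = x :=
  ⟨!₂[x 0, x 1], by ext i; fin_cases i <;> simp [boundaryEmb, hx]⟩

instance surfaceMeasure_isFiniteMeasureOnCompacts : IsFiniteMeasureOnCompacts surfaceMeasure where
  lt_top_of_isCompact := by
    intro K hK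
    rw [surfaceMeasure, boundaryEmb_measurableEmbedding.map_apply]
    exact (boundaryEmb_isometry.isClosedEmbedding.isCompact_preimage hK).measure_lt_top

instance surfaceMeasure_sFinite : SFinite surfaceMeasure := by unfold surfaceMeasure; infer_instance

lemma ae_surfaceMeasure_mem_plane : ∀ᵐ y ∂surfaceMeasure, y 2 = 0 := by
  rw [surfaceMeasure, ae_map_iff boundaryEmb_continuous.aemeasurable]
  · exact Eventually.of_forall boundaryEmb_apply_two
  · exact measurableSet_eq_fun (by fun_prop) (by fun_prop)

lemma surfaceMeasure_electrode {p : E3} (hp : p 2 = 0) {h : ℝ} (hh : 0 ≤ h) :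
    surfaceMeasure (electrode p h) = ENNReal.ofReal (Real.pi * h ^ 2) := by
  obtain ⟨q, rfl⟩ := exists_boundaryEmb hp
  rw [surfaceMeasure, boundaryEmb_measurableEmbedding.map_apply]
  have : boundaryEmb ⁻¹' electrode (boundaryEmb q) h = Metric.ball q h := by
    ext y
    simp [electrode, boundaryEmb_apply_two, norm_boundaryEmb_sub, dist_eq_norm]
  rw [this, EuclideanSpace.volume_ball_fin_two, ← ENNReal.ofReal_pow hh,
    ← ENNReal.ofReal_mul (by positivity), mul_comm]

lemma measurableSet_electrode (p : E3) (h : ℝ) : MeasurableSet (electrode p h) := by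
  have h1 : MeasurableSet {y : E3 | y 2 = 0} := measurableSet_eq_fun (by fun_prop) (by fun_prop)
  have h2 : MeasurableSet {y : E3 | ‖y - p‖ < h} := measurableSet_lt (by fun_prop) (by fun_prop)
  exact h1.inter h2

lemma isOpen_lowerHalfSpace : IsOpen lowerHalfSpace :=
  isOpen_lt (by fun_prop) continuous_const

lemma measurableSet_lowerHalfSpace : MeasurableSet lowerHalfSpace :=
  isOpen_lowerHalfSpace.measurableSet

lemma frontier_lowerHalfSpace_subset {x : E3} (hx : x ∈ frontier lowerHalfSpace) : x 2 = 0 := by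
  have h1 : x ∈ closure lowerHalfSpace := hx.1
  have h2 : closure lowerHalfSpace ⊆ {x : E3 | x 2 ≤ 0} :=
    closure_minimal (fun y (hy : y 2 < 0) => hy.le) (isClosed_le (by fun_prop) continuous_const)
  have h3 : ¬ x 2 < 0 := fun h => hx.2 (by rwa [isOpen_lowerHalfSpace.interior_eq])
  have h4 : x 2 ≤ 0 := h2 h1
  linarith [not_lt.1 h3]

lemma setLIntegral_lowerHalfSpace_eq {F : E3 → ℝ≥0∞} (hF : Measurable F) :
    ∫⁻ x in lowerHalfSpace, F x = ∫⁻ s in Iio (0 : ℝ), ∫⁻ y, F (planeProd (y, s)) := by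
  have hpre : planeProd ⁻¹' lowerHalfSpace = univ ×ˢ Iio (0 : ℝ) := by
    ext q; simp [planeProd, lowerHalfSpace]
  rw [← (planeProd_measurePreserving.restrict_preimage
    measurableSet_lowerHalfSpace).lintegral_comp hF, hpre, Measure.volume_eq_prod,
    ← Measure.prod_restrict, Measure.restrict_univ,
    lintegral_prod_symm' (fun q => F (planeProd q)) (hF.comp planeProd_continuous.measurable)]

lemma integral_surfaceMeasure {F : Type*} [NormedAddCommGroup F] [NormedSpace ℝ F] (f : E3 → F) :
    ∫ y, f y ∂surfaceMeasure = ∫ y, f (boundaryEmb y) := by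
  rw [surfaceMeasure, boundaryEmb_measurableEmbedding.integral_map]

/-- The divergence theorem in the half-space, for the vertical derivative. -/
lemma integral_lowerHalfSpace_fderiv_two {F : Type*} [NormedAddCommGroup F] [NormedSpace ℝ F]
    [CompleteSpace F] {ψ : E3 → F} (hψ : ContDiff ℝ 1 ψ)
    (hc : HasCompactSupport ψ) :
    ∫ x in lowerHalfSpace, fderiv ℝ ψ x outwardNormal = ∫ y, ψ y ∂surfaceMeasure := by
  have hcont : Continuous fun x => fderiv ℝ ψ x outwardNormal :=
    (hψ.continuous_fderiv (by simp)).clm_apply continuous_const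
  have hint : Integrable fun x => fderiv ℝ ψ x outwardNormal :=
    hcont.integrable_of_hasCompactSupport (hc.fderiv_apply (𝕜 := ℝ) outwardNormal)
  have hpre : planeProd ⁻¹' lowerHalfSpace = univ ×ˢ Iio (0 : ℝ) := by
    ext q; simp [planeProd, lowerHalfSpace]
  have hmp := planeProd_measurePreserving.restrict_preimage measurableSet_lowerHalfSpace
  have hemb : MeasurableEmbedding planeProd := by
    have hcl : IsClosedEmbedding planeProd := by
      refine Topology.IsClosedEmbedding.of_continuous_injective_isClosedMap planeProd_continuous ?_ ?_
      · rintro ⟨y, s⟩ ⟨z, t⟩ h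
        have h0 := congrArg (fun x : E3 => x 0) h
        have h1 := congrArg (fun x : E3 => x 1) h
        have h2 := congrArg (fun x : E3 => x 2) h
        simp [planeProd] at h0 h1 h2
        refine Prod.ext ?_ h2
        ext i; fin_cases i <;> simp [h0, h1]
      · let inv : E3 → EuclideanSpace ℝ (Fin 2) × ℝ := fun x => (!₂[x 0, x 1], x 2)
        have hinv : Continuous inv := by
          refine Continuous.prodMk ((PiLp.continuous_toLp 2 _).comp (continuous_pi fun i => ?_))
            (by fun_prop)
          fin_cases i <;> simp <;> fun_prop
        have hl : Function.LeftInverse planeProd inv := by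
          intro x; ext i; fin_cases i <;> simp [planeProd, inv]
        have hr : Function.RightInverse planeProd inv := by
          rintro ⟨y, s⟩
          refine Prod.ext ?_ ?_
          · ext i; fin_cases i <;> simp [planeProd, inv]
          · simp [planeProd, inv]
        intro S hS
        rw [image_eq_preimage_of_inverse hr hl]
        exact hS.preimage hinv
    exact hcl.measurableEmbedding
  rw [← hmp.integral_comp hemb, hpre, Measure.volume_eq_prod, ← Measure.prod_restrict,
    Measure.restrict_univ, integral_prod, integral_surfaceMeasure]
  · refine integral_congr_ae (Eventually.of_forall fun y => ?_)
    simp only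
    have hline : ∀ s : ℝ, HasDerivAt (fun s => planeProd (y, s)) outwardNormal s := by
      intro s
      have : (fun s => planeProd (y, s)) = fun s : ℝ => boundaryEmb y + s • outwardNormal := by
        ext1 s; exact planeProd_eq y s
      rw [this]
      simpa using ((hasDerivAt_id s).smul_const outwardNormal).const_add (boundaryEmb y)
    have hder : ∀ s : ℝ, HasDerivAt (fun s => ψ (planeProd (y, s)))
        (fderiv ℝ ψ (planeProd (y, s)) outwardNormal) s := fun s =>
      ((hψ.differentiable (by simp)) _).hasFDerivAt.comp_hasDerivAt s (hline s)
    have hcl : IsClosedEmbedding fun s : ℝ => planeProd (y, s) := by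
      refine Isometry.isClosedEmbedding (Isometry.of_dist_eq fun s t => ?_)
      rw [planeProd_eq, planeProd_eq, dist_eq_norm, add_sub_add_left_eq_sub, ← sub_smul, norm_smul]
      simp [outwardNormal, dist_eq_norm]
    rw [← integral_Iic_eq_integral_Iio]
    have hcs : HasCompactSupport fun s => ψ (planeProd (y, s)) := hc.comp_isClosedEmbedding hcl
    have h0 : Tendsto (fun s => ψ (planeProd (y, s))) atBot (𝓝 0) := by
      refine Tendsto.mono_left ?_ atBot_le_cocompact
      exact tendsto_const_nhds.congr' (EventuallyEq.symm (hasCompactSupport_iff_eventuallyEq.1 hcs |>.filter_mono (by rw [Filter.coclosedCompact_eq_cocompact])))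
    rw [integral_Iic_of_hasDerivAt_of_tendsto (hder 0).continuousAt.continuousWithinAt
      (fun s _ => hder s) ?_ h0, sub_zero]
    · rfl
    · have hcs' := (hc.fderiv_apply (𝕜 := ℝ) outwardNormal).comp_isClosedEmbedding hcl
      exact ((hcont.comp hcl.continuous).integrable_of_hasCompactSupport hcs').integrableOn
  · have h1 := (hmp.integrable_comp_emb hemb).2 hint.integrableOn
    rw [hpre, Measure.volume_eq_prod, ← Measure.prod_restrict, Measure.restrict_univ] at h1
    exact h1

/-! ### Single layer potentials of integrable densities. -/

section SingleLayer

variable {F : Type*} [NormedAddCommGroup F] [NormedSpace ℝ F]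

lemma integrable_kernel_smul {μ : Measure E3} {g : E3 → F} (hg : Integrable g μ) {A : E3 → ℝ}
    (hA : Continuous A) {B : ℝ} (hB : ∀ x, |A x| ≤ B) (x : E3) :
    Integrable (fun y => A (x - y) • g y) μ :=
  hg.bdd_smul B (by fun_prop) (Eventually.of_forall fun y => hB _)

lemma hasFDerivAt_integral_kernel {μ : Measure E3} {g : E3 → F} (hg : Integrable g μ) {A : E3 → ℝ}
    (hA : ContDiff ℝ ∞ A) {B : ℝ} (hB : ∀ x, |A x| ≤ B) {C : ℝ} (hC : ∀ x, ‖fderiv ℝ A x‖ ≤ C)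
    (x : E3) :
    HasFDerivAt (fun x => ∫ y, A (x - y) • g y ∂μ)
      (∫ y, (fderiv ℝ A (x - y)).smulRight (g y) ∂μ) x := by
  have hA' : Continuous (fderiv ℝ A) := hA.continuous_fderiv (by simp)
  refine hasFDerivAt_integral_of_dominated_of_fderiv_le (s := univ) (bound := fun y => C * ‖g y‖)
    (F' := fun x y => (fderiv ℝ A (x - y)).smulRight (g y)) univ_mem
    (Eventually.of_forall fun x => (integrable_kernel_smul hg hA.continuous hB x).1)
    (integrable_kernel_smul hg hA.continuous hB x) ?_ ?_ (hg.norm.const_mul C) ?_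
  · have h1 : AEStronglyMeasurable (fun y => fderiv ℝ A (x - y)) μ :=
      (by fun_prop : Continuous fun y => fderiv ℝ A (x - y)).aestronglyMeasurable
    have h2 : Continuous fun p : (E3 →L[ℝ] ℝ) × F => p.1.smulRight p.2 := by fun_prop
    exact h2.comp_aestronglyMeasurable (h1.prodMk hg.1)
  · refine Eventually.of_forall fun y z _ => ?_
    rw [ContinuousLinearMap.norm_smulRight_apply]
    gcongr
    exact hC _
  · refine Eventually.of_forall fun y z _ => ?_
    have h1 := ((hA.differentiable (by simp)) (z - y)).hasFDerivAt.comp z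
      ((hasFDerivAt_id z).sub_const y)
    exact h1.smul_const (g y)

lemma fderiv_integral_kernel [CompleteSpace F] {μ : Measure E3} {g : E3 → F} (hg : Integrable g μ) {A : E3 → ℝ}
    (hA : ContDiff ℝ ∞ A) {B : ℝ} (hB : ∀ x, |A x| ≤ B) {C : ℝ} (hC : ∀ x, ‖fderiv ℝ A x‖ ≤ C)
    (x v : E3) :
    fderiv ℝ (fun x => ∫ y, A (x - y) • g y ∂μ) x v = ∫ y, fderiv ℝ A (x - y) v • g y ∂μ := by
  have hA' : Continuous (fderiv ℝ A) := hA.continuous_fderiv (by simp)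
  rw [(hasFDerivAt_integral_kernel hg hA hB hC x).fderiv, ContinuousLinearMap.integral_apply]
  · rfl
  · refine (hg.norm.const_mul C).mono' ?_ (Eventually.of_forall fun y => ?_)
    · have h1 : AEStronglyMeasurable (fun y => fderiv ℝ A (x - y)) μ :=
        (by fun_prop : Continuous fun y => fderiv ℝ A (x - y)).aestronglyMeasurable
      have h2 : Continuous fun p : (E3 →L[ℝ] ℝ) × F => p.1.smulRight p.2 := by fun_prop
      exact h2.comp_aestronglyMeasurable (h1.prodMk hg.1)
    · rw [ContinuousLinearMap.norm_smulRight_apply]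
      gcongr
      exact hC _

/-- The single layer potential of the density `g` on the boundary plane, normalized so that it is
the harmonic function in the half-space with Neumann data `g`. -/
def slp (g : E3 → F) (x : E3) : F := ∫ y, (1 / (2 * Real.pi * ‖x - y‖)) • g y ∂surfaceMeasure

/-- The single layer potential with the kernel regularized at scale `ε`. -/
def slpReg (ε : ℝ) (g : E3 → F) (x : E3) : F := ∫ y, (2 * newt ε (x - y)) • g y ∂surfaceMeasure

lemma two_newt_contDiff (ε : ℝ) : ContDiff ℝ ∞ (fun x => 2 * newt ε x) :=
  contDiff_const.mul (newt_contDiff ε)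

lemma abs_two_newt_le {ε : ℝ} (hε : 0 < ε) (x : E3) : |2 * newt ε x| ≤ 2 * ε⁻¹ := by
  rw [abs_of_nonneg (mul_nonneg zero_le_two (newt_nonneg hε x))]
  gcongr
  exact newt_le_const hε x

lemma fderiv_two_newt (ε : ℝ) (x : E3) :
    fderiv ℝ (fun x => 2 * newt ε x) x = (2 : ℝ) • fderiv ℝ (newt ε) x :=
  (((newt_contDiff ε).differentiable (by simp) x).hasFDerivAt.const_mul 2).fderiv

lemma norm_fderiv_two_newt_le {ε : ℝ} (hε : 0 < ε) (x : E3) :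
    ‖fderiv ℝ (fun x => 2 * newt ε x) x‖ ≤ 2 * (newtC / ε ^ 2) := by
  rw [fderiv_two_newt, norm_smul, Real.norm_of_nonneg zero_le_two]
  gcongr
  exact norm_fderiv_newt_le_const hε x

lemma norm_fderiv_two_newt_le' {ε : ℝ} (hε : 0 < ε) {x : E3} (hx : x ≠ 0) :
    ‖fderiv ℝ (fun x => 2 * newt ε x) x‖ ≤ 2 * (newtC / ‖x‖ ^ 2) := by
  rw [fderiv_two_newt, norm_smul, Real.norm_of_nonneg zero_le_two]
  gcongr
  exact norm_fderiv_newt_le hε hx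

/-- A density on the boundary plane that is integrable and vanishes outside a ball. -/
structure IsDensity (ρ : ℝ) (g : E3 → F) : Prop where
  pos : 0 < ρ
  int : Integrable g surfaceMeasure
  supp : ∀ᵐ y ∂surfaceMeasure, ρ < ‖y‖ → g y = 0

variable {g : E3 → F} {ρ : ℝ}

lemma abs_apply_two_le (x : E3) : |x 2| ≤ ‖x‖ := PiLp.norm_apply_le x 2

/-- A point at depth at least `ε` has distance at least `ε` from the plane, and there the
regularized kernel is exact. Smoothness and bounds for `slp` below the plane are all drawn from
`slpReg` in this way. -/
lemma slp_eq_slpReg {ε : ℝ} (hε : 0 < ε) (g : E3 → F) {x : E3} (hx : x 2 ≤ -ε) :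
    slp g x = slpReg ε g x := by
  refine integral_congr_ae ?_
  filter_upwards [ae_surfaceMeasure_mem_plane] with y hy
  have h1 : ε ≤ ‖x - y‖ := by
    refine le_trans ?_ (abs_apply_two_le _)
    rw [PiLp.sub_apply, hy, sub_zero, abs_of_neg (by linarith)]
    linarith
  rw [newt_of_le hε h1]
  congr 1
  have : 0 < ‖x - y‖ := hε.trans_le h1
  have := Real.pi_pos
  field_simp
  norm_num

lemma slp_eventuallyEq {ε : ℝ} (hε : 0 < ε) (g : E3 → F) {x : E3} (hx : x 2 < -ε) :
    slp g =ᶠ[𝓝 x] slpReg ε g := by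
  have hc : Continuous fun z : E3 => z 2 := by fun_prop
  filter_upwards [hc.continuousAt.eventually (gt_mem_nhds hx)] with z hz
  exact slp_eq_slpReg hε g (le_of_lt hz)

lemma IsDensity.hasFDerivAt_slpReg (hg : IsDensity ρ g) {ε : ℝ} (hε : 0 < ε) (x : E3) :
    HasFDerivAt (slpReg ε g)
      (∫ y, (fderiv ℝ (fun x => 2 * newt ε x) (x - y)).smulRight (g y) ∂surfaceMeasure) x :=
  hasFDerivAt_integral_kernel hg.int (two_newt_contDiff ε) (abs_two_newt_le hε)
    (norm_fderiv_two_newt_le hε) x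

lemma IsDensity.fderiv_slpReg [CompleteSpace F] (hg : IsDensity ρ g) {ε : ℝ} (hε : 0 < ε) (x v : E3) :
    fderiv ℝ (slpReg ε g) x v =
      ∫ y, fderiv ℝ (fun x => 2 * newt ε x) (x - y) v • g y ∂surfaceMeasure :=
  fderiv_integral_kernel hg.int (two_newt_contDiff ε) (abs_two_newt_le hε)
    (norm_fderiv_two_newt_le hε) x v

lemma IsDensity.norm_slpReg_le (hg : IsDensity ρ g) {ε : ℝ} (hε : 0 < ε) (x : E3) :
    ‖slpReg ε g x‖ ≤ 2 * ε⁻¹ * ∫ y, ‖g y‖ ∂surfaceMeasure := by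
  rw [← integral_const_mul]
  refine norm_integral_le_of_norm_le (hg.int.norm.const_mul _) (Eventually.of_forall fun y => ?_)
  rw [norm_smul]
  gcongr
  exact abs_two_newt_le hε _

lemma IsDensity.norm_fderiv_slpReg_le (hg : IsDensity ρ g) {ε : ℝ} (hε : 0 < ε) (x : E3) :
    ‖fderiv ℝ (slpReg ε g) x‖ ≤ 2 * (newtC / ε ^ 2) * ∫ y, ‖g y‖ ∂surfaceMeasure := by
  rw [(hg.hasFDerivAt_slpReg hε x).fderiv, ← integral_const_mul]
  refine norm_integral_le_of_norm_le (hg.int.norm.const_mul _) (Eventually.of_forall fun y => ?_)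
  rw [ContinuousLinearMap.norm_smulRight_apply]
  gcongr
  exact norm_fderiv_two_newt_le hε _

lemma half_norm_le_of_far {ρ : ℝ} (hρ : 0 < ρ) {x y : E3} (hx : 2 * ρ ≤ ‖x‖) (hy : ‖y‖ ≤ ρ) :
    ‖x‖ / 2 ≤ ‖x - y‖ ∧ x - y ≠ 0 := by
  have := norm_sub_norm_le x y
  have h : ‖x‖ / 2 ≤ ‖x - y‖ := by linarith
  refine ⟨h, norm_pos_iff.1 (by linarith)⟩

/-- On the support of the density `‖x - y‖ ≥ ‖x‖ / 2`, so the quadratic decay of the kernel's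
gradient survives with a constant that does not depend on `ε`. -/
lemma IsDensity.norm_fderiv_slpReg_le_far (hg : IsDensity ρ g) {ε : ℝ} (hε : 0 < ε) {x : E3}
    (hx : 2 * ρ ≤ ‖x‖) :
    ‖fderiv ℝ (slpReg ε g) x‖ ≤ 8 * newtC / ‖x‖ ^ 2 * ∫ y, ‖g y‖ ∂surfaceMeasure := by
  rw [(hg.hasFDerivAt_slpReg hε x).fderiv, ← integral_const_mul]
  refine norm_integral_le_of_norm_le (hg.int.norm.const_mul _) ?_
  filter_upwards [hg.supp] with y hy
  rw [ContinuousLinearMap.norm_smulRight_apply]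
  rcases lt_or_ge ρ ‖y‖ with h | h
  · simp [hy h]
  · obtain ⟨h1, h2⟩ := half_norm_le_of_far hg.pos hx h
    have hx0 : 0 < ‖x‖ := by linarith [hg.pos]
    have hC := newtC_pos
    gcongr
    calc ‖fderiv ℝ (fun x => 2 * newt ε x) (x - y)‖ ≤ 2 * (newtC / ‖x - y‖ ^ 2) :=
          norm_fderiv_two_newt_le' hε h2
      _ ≤ 2 * (newtC / (‖x‖ / 2) ^ 2) := by gcongr
      _ = 8 * newtC / ‖x‖ ^ 2 := by field_simp; norm_num

/-- The profile vanishes near the origin, so at a large scale the whole density sits where the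
kernel is zero. Large scales thus drop out of limits and serve as a truncation at infinity. -/
lemma IsDensity.slpReg_eq_zero (hg : IsDensity ρ g) {r : ℝ} {x : E3}
    (hx : 2 * (‖x‖ + ρ) ≤ r) : slpReg r g x = 0 := by
  refine integral_eq_zero_of_ae ?_
  filter_upwards [hg.supp] with y hy
  rcases lt_or_ge ρ ‖y‖ with h | h
  · simp [hy h]
  · have hr : 0 < r := by linarith [hg.pos, norm_nonneg x]
    have h1 : ‖x - y‖ ≤ r / 2 := by linarith [norm_sub_le x y]
    have h2 : ‖x - y‖ ^ 2 / r ^ 2 ≤ 1 / 2 := by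
      rw [div_le_iff₀ (by positivity)]
      have : ‖x - y‖ ^ 2 ≤ (r / 2) ^ 2 := by gcongr
      nlinarith
    simp [newt, newtonProfile_of_le_half h2]

lemma IsDensity.slpReg_sub_eq_zero (hg : IsDensity ρ g) {ε r : ℝ} (hε : 0 < ε) (hr : 0 < r) {x : E3}
    (hx : ρ + ε + r ≤ ‖x‖) : slpReg ε g x - slpReg r g x = 0 := by
  rw [sub_eq_zero]
  refine integral_congr_ae ?_
  filter_upwards [hg.supp] with y hy
  rcases lt_or_ge ρ ‖y‖ with h | h
  · simp [hy h]
  · have h1 := norm_sub_norm_le x y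
    rw [newt_eq_newt hε hr (by linarith) (by linarith)]

/-- Two regularized kernels agree far away, so their difference is smooth with compact support, and
convolution with it smooths any integrable density. -/
lemma IsDensity.slpReg_sub_contDiff (hg : IsDensity ρ g) {ε r : ℝ} (hε : 0 < ε) (hr : 0 < r) :
    ContDiff ℝ ∞ fun x => slpReg ε g x - slpReg r g x := by
  have h := HasCompactSupport.contDiff_convolution_right (𝕜 := ℝ) (μ := surfaceMeasure) (n := ⊤)
    ((ContinuousLinearMap.lsmul ℝ ℝ (E := F)).flip) (f := g)
    (g := fun x => 2 * (newt ε x - newt r x))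
    ((newt_sub_hasCompactSupport hε hr).mul_left (f := fun _ => (2 : ℝ))) hg.int.locallyIntegrable
    (contDiff_const.mul ((newt_contDiff ε).sub (newt_contDiff r)))
  convert h using 1
  ext x
  rw [convolution_def, slpReg, slpReg, ← integral_sub]
  · refine integral_congr_ae (Eventually.of_forall fun y => ?_)
    simp [mul_sub, sub_smul]
  · exact integrable_kernel_smul hg.int (two_newt_contDiff ε).continuous (abs_two_newt_le hε) x
  · exact integrable_kernel_smul hg.int (two_newt_contDiff r).continuous (abs_two_newt_le hr) x

lemma IsDensity.slpReg_contDiff (hg : IsDensity ρ g) {ε : ℝ} (hε : 0 < ε) :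
    ContDiff ℝ ∞ (slpReg ε g) := by
  rw [contDiff_iff_contDiffAt]
  intro x
  -- At this scale `slpReg r g` vanishes on the unit ball around `x`, and subtracting it changes
  -- nothing there.
  set r := 2 * (‖x‖ + 1 + ρ)
  have hr : 0 < r := by have := hg.pos; positivity
  refine (hg.slpReg_sub_contDiff hε hr).contDiffAt.congr_of_eventuallyEq ?_
  filter_upwards [Metric.ball_mem_nhds x one_pos] with z hz
  rw [hg.slpReg_eq_zero (r := r), sub_zero]
  have : ‖z‖ ≤ ‖x‖ + 1 := by
    have h1 : ‖z - x‖ < 1 := by simpa [dist_eq_norm] using hz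
    linarith [norm_le_norm_add_norm_sub x z, norm_sub_rev x z]
  linarith

lemma IsDensity.slp_contDiffAt (hg : IsDensity ρ g) {x : E3} (hx : x ∈ lowerHalfSpace) :
    ContDiffAt ℝ ∞ (slp g) x := by
  have hx' : x 2 < 0 := hx
  exact (hg.slpReg_contDiff (ε := -(x 2) / 2) (by linarith)).contDiffAt.congr_of_eventuallyEq
    (slp_eventuallyEq (by linarith) g (by linarith))

lemma fderiv_slp_eq {ε : ℝ} (hε : 0 < ε) (g : E3 → F) {x : E3} (hx : x 2 < -ε) :
    fderiv ℝ (slp g) x = fderiv ℝ (slpReg ε g) x :=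
  (slp_eventuallyEq hε g hx).fderiv_eq

lemma IsDensity.norm_fderiv_slp_le_far (hg : IsDensity ρ g) {x : E3} (hx : x ∈ lowerHalfSpace)
    (h : 2 * ρ ≤ ‖x‖) :
    ‖fderiv ℝ (slp g) x‖ ≤ 8 * newtC / ‖x‖ ^ 2 * ∫ y, ‖g y‖ ∂surfaceMeasure := by
  have hx' : x 2 < 0 := hx
  rw [fderiv_slp_eq (ε := -(x 2) / 2) (by linarith) g (by linarith)]
  exact hg.norm_fderiv_slpReg_le_far (by linarith) h

end SingleLayer

/-! ### Green's second identity for weak solutions. -/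

section GreenIdentity

variable {F : Type*} [NormedAddCommGroup F] [NormedSpace ℝ F]

lemma integrable_smul_of_memLp_ball {ψ : E3 → ℝ} (hψ : Continuous ψ) (hc : HasCompactSupport ψ)
    {w : E3 → F} (hw : ∀ r : ℝ, MemLp w 2 (volume.restrict (lowerHalfSpace ∩ Metric.ball 0 r))) :
    Integrable (fun x => ψ x • w x) (volume.restrict lowerHalfSpace) := by
  obtain ⟨r, hr⟩ := hc.isCompact.isBounded.subset_ball (0 : E3)
  obtain ⟨B, hB⟩ := hc.exists_bound_of_continuous hψ
  have hfin : IsFiniteMeasure (volume.restrict (lowerHalfSpace ∩ Metric.ball (0 : E3) r)) :=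
    ⟨by rw [Measure.restrict_apply_univ]
        exact (measure_mono inter_subset_right).trans_lt measure_ball_lt_top⟩
  have h1 : IntegrableOn (fun x => ψ x • w x) (lowerHalfSpace ∩ Metric.ball 0 r) :=
    ((hw r).integrable (by norm_num)).bdd_smul B hψ.aestronglyMeasurable
      (Eventually.of_forall hB)
  refine h1.of_forall_sdiff_eq_zero measurableSet_lowerHalfSpace fun x hx => ?_
  have : x ∉ tsupport ψ := fun h => hx.2 ⟨hx.1, hr h⟩
  simp [image_eq_zero_of_notMem_tsupport this]

lemma IsTestFunction.partialDeriv {φ : E3 → ℝ} (hφ : IsTestFunction univ φ) (i : Fin 3) :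
    IsTestFunction univ (partialDeriv i φ) where
  smooth := (hφ.smooth.fderiv_right (m := ∞) (by simp)).clm_apply contDiff_const
  compact := hφ.compact.fderiv_apply (𝕜 := ℝ) _
  support_subset := subset_univ _

/-- The Gauss-Green formula applied to each `∂ᵢφ` moves the second derivative onto the test
function. On the plane only `∂₃φ` meets the trace, and it vanishes by `h0`; the identity thus
involves only `u` and `g`. -/
lemma green_second_identity {u f g : E3 → ℂ} {G : E3 → EuclideanSpace ℂ (Fin 3)}
    (hu : IsH1Loc u G) (hf : IsTrace u G f) (hg : IsNormalDerivative G g) {φ : E3 → ℝ}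
    (hφ : IsTestFunction univ φ) (h0 : ∀ y : E3, y 2 = 0 → partialDeriv 2 φ y = 0) :
    -∫ x in lowerHalfSpace, laplace φ x • u x = ∫ y, φ y • g y ∂surfaceMeasure := by
  have hGi : ∀ i, ∀ r : ℝ, MemLp (fun x => G x i) 2
      (volume.restrict (lowerHalfSpace ∩ Metric.ball 0 r)) := fun i r =>
    (hu.memLp_grad r).of_le
      ((PiLp.continuous_apply 2 (fun _ : Fin 3 => ℂ) i).comp_aestronglyMeasurable (hu.memLp_grad r).1)
      (Eventually.of_forall fun x => PiLp.norm_apply_le (G x) i)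
  have h1 : ∀ i, (∫ x in lowerHalfSpace, partialDeriv i (partialDeriv i φ) x • u x) +
      (∫ x in lowerHalfSpace, partialDeriv i φ x • G x i) = 0 := by
    intro i
    rw [hf.gaussGreen _ (hφ.partialDeriv i) i]
    refine integral_eq_zero_of_ae ?_
    filter_upwards [ae_surfaceMeasure_mem_plane] with y hy
    by_cases hi : i = 2
    · subst hi; simp [h0 y hy]
    · simp [outwardNormal, hi]
  have h2 : ∫ x in lowerHalfSpace, laplace φ x • u x =
      ∑ i, ∫ x in lowerHalfSpace, partialDeriv i (partialDeriv i φ) x • u x := by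
    rw [← integral_finsetSum]
    · simp only [laplace, Finset.sum_smul]
    · intro i _
      exact integrable_smul_of_memLp_ball ((hφ.partialDeriv i).partialDeriv i).smooth.continuous
        ((hφ.partialDeriv i).partialDeriv i).compact hu.memLp
  have h3 : ∫ x in lowerHalfSpace, ∑ i, partialDeriv i φ x • G x i =
      ∑ i, ∫ x in lowerHalfSpace, partialDeriv i φ x • G x i := by
    rw [← integral_finsetSum]
    intro i _
    exact integrable_smul_of_memLp_ball (hφ.partialDeriv i).smooth.continuous
        (hφ.partialDeriv i).compact (hGi i)
  rw [← hg.green φ hφ, h2, h3, ← Finset.sum_neg_distrib]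
  exact Finset.sum_congr rfl fun i _ => neg_eq_of_add_eq_zero_right (h1 i)

end GreenIdentity

lemma partialDeriv_comp_sub (i : Fin 3) (φ : E3 → ℝ) (c : E3) :
    partialDeriv i (fun y => φ (y - c)) = fun y => partialDeriv i φ (y - c) := by
  ext y
  rw [partialDeriv, fderiv_comp_sub, partialDeriv]

lemma laplace_comp_sub (φ : E3 → ℝ) (c y : E3) :
    laplace (fun y => φ (y - c)) y = laplace φ (y - c) := by
  simp only [laplace, partialDeriv_comp_sub]

lemma partialDeriv_add {φ ψ : E3 → ℝ} (hφ : ContDiff ℝ ∞ φ) (hψ : ContDiff ℝ ∞ ψ) (i : Fin 3) :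
    partialDeriv i (fun y => φ y + ψ y) = fun y => partialDeriv i φ y + partialDeriv i ψ y := by
  ext y
  rw [partialDeriv, fderiv_fun_add (hφ.differentiable (by simp) y) (hψ.differentiable (by simp) y)]
  rfl

lemma partialDeriv_sub {φ ψ : E3 → ℝ} (hφ : ContDiff ℝ ∞ φ) (hψ : ContDiff ℝ ∞ ψ) (i : Fin 3) :
    partialDeriv i (fun y => φ y - ψ y) = fun y => partialDeriv i φ y - partialDeriv i ψ y := by
  ext y
  rw [partialDeriv, fderiv_fun_sub (hφ.differentiable (by simp) y) (hψ.differentiable (by simp) y)]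
  rfl

lemma partialDeriv_contDiff {φ : E3 → ℝ} (hφ : ContDiff ℝ ∞ φ) (i : Fin 3) :
    ContDiff ℝ ∞ (partialDeriv i φ) :=
  (hφ.fderiv_right (m := ∞) (by simp)).clm_apply contDiff_const

lemma laplace_add {φ ψ : E3 → ℝ} (hφ : ContDiff ℝ ∞ φ) (hψ : ContDiff ℝ ∞ ψ) (y : E3) :
    laplace (fun y => φ y + ψ y) y = laplace φ y + laplace ψ y := by
  simp only [laplace, partialDeriv_add hφ hψ, ← Finset.sum_add_distrib]
  refine Finset.sum_congr rfl fun i _ => ?_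
  rw [partialDeriv_add (partialDeriv_contDiff hφ i) (partialDeriv_contDiff hψ i)]

lemma laplace_sub {φ ψ : E3 → ℝ} (hφ : ContDiff ℝ ∞ φ) (hψ : ContDiff ℝ ∞ ψ) (y : E3) :
    laplace (fun y => φ y - ψ y) y = laplace φ y - laplace ψ y := by
  simp only [laplace, partialDeriv_sub hφ hψ, ← Finset.sum_sub_distrib]
  refine Finset.sum_congr rfl fun i _ => ?_
  rw [partialDeriv_sub (partialDeriv_contDiff hφ i) (partialDeriv_contDiff hψ i)]

/-! ### Reflection and the representation of solutions by their flux. -/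

/-- Reflection in the boundary plane. -/
def reflect (x : E3) : E3 := x - (2 * x 2) • outwardNormal

lemma reflect_apply_two (x : E3) : reflect x 2 = -x 2 := by
  simp [reflect, outwardNormal]; ring

lemma norm_sub_reflect {x y : E3} (hy : y 2 = 0) : ‖y - reflect x‖ = ‖y - x‖ := by
  rw [EuclideanSpace.norm_eq, EuclideanSpace.norm_eq]
  simp [Fin.sum_univ_three, reflect, outwardNormal, hy]
  congr 2
  ring

lemma newt_congr (ε : ℝ) {x y : E3} (h : ‖x‖ = ‖y‖) : newt ε x = newt ε y := by
  rw [newt, newt, h]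

/-- The test function in the representation formula: even in the vertical variable. -/
def evenTest (ε r : ℝ) (x y : E3) : ℝ :=
  (newt ε (y - x) - newt r (y - x)) + (newt ε (y - reflect x) - newt r (y - reflect x))

lemma newt_sub_contDiff (ε r : ℝ) : ContDiff ℝ ∞ fun z => newt ε z - newt r z :=
  (newt_contDiff ε).sub (newt_contDiff r)

lemma evenTest_isTestFunction {ε r : ℝ} (hε : 0 < ε) (hr : 0 < r) (x : E3) :
    IsTestFunction univ (evenTest ε r x) where
  smooth := by
    have h := newt_sub_contDiff ε r
    exact (h.comp (contDiff_id.sub contDiff_const)).add (h.comp (contDiff_id.sub contDiff_const))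
  compact := by
    have h : ∀ c : E3, HasCompactSupport fun y => newt ε (y - c) - newt r (y - c) := fun c =>
      (newt_sub_hasCompactSupport hε hr).comp_homeomorph (Homeomorph.subRight c)
    exact (h x).add (h (reflect x))
  support_subset := subset_univ _

lemma laplace_evenTest (ε r : ℝ) (x y : E3) : laplace (evenTest ε r x) y =
    (delta r (y - x) - delta ε (y - x)) + (delta r (y - reflect x) - delta ε (y - reflect x)) := by
  have h := newt_sub_contDiff ε r
  have h' : ∀ c : E3, ContDiff ℝ ∞ fun y => newt ε (y - c) - newt r (y - c) := fun c =>
    h.comp (contDiff_id.sub contDiff_const)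
  have e : ∀ c, laplace (fun y => newt ε (y - c) - newt r (y - c)) y =
      delta r (y - c) - delta ε (y - c) := by
    intro c
    rw [laplace_comp_sub (fun y => newt ε y - newt r y),
      laplace_sub (newt_contDiff ε) (newt_contDiff r), laplace_newt_eq, laplace_newt_eq]
    ring
  have := laplace_add (h' x) (h' (reflect x)) y
  rw [e, e] at this
  exact this

lemma partialDeriv_newt (ε : ℝ) (i : Fin 3) : ∃ k : ℝ → ℝ, ∀ z,
    partialDeriv i (newt ε) z = k ‖z‖ * z i := by
  have hq : Differentiable ℝ fun s => ε⁻¹ * newtonProfile (s / ε ^ 2) :=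
    (contDiff_const.mul (newtonProfile_contDiff.comp (by fun_prop)) : ContDiff ℝ ∞ _).differentiable
      (by simp)
  refine ⟨fun t => deriv (fun s => ε⁻¹ * newtonProfile (s / ε ^ 2)) (t ^ 2) * 2, fun z => ?_⟩
  rw [mul_assoc]
  exact partialDeriv_radial hq i z

/-- A boundary point is equidistant from `x` and its reflection, while its vertical offsets from
them are opposite, so the two radial contributions cancel. -/
lemma partialDeriv_two_evenTest (ε r : ℝ) (x : E3) {y : E3} (hy : y 2 = 0) :
    partialDeriv 2 (evenTest ε r x) y = 0 := by
  have h := newt_sub_contDiff ε r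
  have h' : ∀ c : E3, ContDiff ℝ ∞ fun y => newt ε (y - c) - newt r (y - c) := fun c =>
    h.comp (contDiff_id.sub contDiff_const)
  have h1 := congrFun (partialDeriv_add (h' x) (h' (reflect x)) 2) y
  rw [partialDeriv_comp_sub 2 (fun z => newt ε z - newt r z),
    partialDeriv_comp_sub 2 (fun z => newt ε z - newt r z),
    partialDeriv_sub (newt_contDiff ε) (newt_contDiff r)] at h1
  obtain ⟨k, hk⟩ := partialDeriv_newt ε 2
  obtain ⟨l, hl⟩ := partialDeriv_newt r 2
  refine h1.trans ?_
  simp only [hk, hl, norm_sub_reflect hy, PiLp.sub_apply, reflect_apply_two, hy]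
  ring

/-- The exact mean value identity behind the representation formula. -/
lemma delta_convolution_identity {u f g : E3 → ℂ} {G : E3 → EuclideanSpace ℂ (Fin 3)} {ρ : ℝ}
    (hu : IsH1Loc u G) (hf : IsTrace u G f) (hg : IsNormalDerivative G g) (hd : IsDensity ρ g)
    {ε r : ℝ} (hε : 0 < ε) (hr : 0 < r) {x : E3} (hx : x 2 ≤ -ε) :
    (∫ y in lowerHalfSpace, delta ε (y - x) • u y) -
      ((∫ y in lowerHalfSpace, delta r (y - x) • u y) +
        ∫ y in lowerHalfSpace, delta r (y - reflect x) • u y) = slpReg ε g x - slpReg r g x := by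
  have key := green_second_identity hu hf hg (evenTest_isTestFunction hε hr x)
    fun y hy => partialDeriv_two_evenTest ε r x hy
  have hi : ∀ {η : ℝ}, 0 < η → ∀ c : E3,
      Integrable (fun y => delta η (y - c) • u y) (volume.restrict lowerHalfSpace) := by
    intro η hη c
    refine integrable_smul_of_memLp_ball
      ((delta_continuous η).comp (continuous_id.sub continuous_const)) ?_ hu.memLp
    refine HasCompactSupport.intro (isCompact_closedBall c η) fun y hy => ?_
    refine delta_of_le hη ?_
    rw [Metric.mem_closedBall, dist_eq_norm, not_le] at hy
    exact hy.le
  have e1 : ∫ y in lowerHalfSpace, laplace (evenTest ε r x) y • u y =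
      ∫ y in lowerHalfSpace, ((delta r (y - x) • u y + delta r (y - reflect x) • u y) -
        delta ε (y - x) • u y) := by
    refine setIntegral_congr_fun measurableSet_lowerHalfSpace fun y hy => ?_
    -- The reflected point has height at least `ε`, so the bump around it does not meet the
    -- half-space.
    have h0 : delta ε (y - reflect x) = 0 := by
      refine delta_of_le hε (le_trans ?_ (abs_apply_two_le _))
      have hy' : y 2 < 0 := hy
      rw [PiLp.sub_apply, reflect_apply_two, abs_of_neg (by linarith)]
      linarith
    simp only [laplace_evenTest, h0]
    module
  have e2 : ∫ y, evenTest ε r x y • g y ∂surfaceMeasure = slpReg ε g x - slpReg r g x := by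
    rw [slpReg, slpReg, ← integral_sub]
    -- On the plane the two poles are equidistant and the test function is twice the kernel, the
    -- factor built into `slpReg`.
    · refine integral_congr_ae ?_
      filter_upwards [ae_surfaceMeasure_mem_plane] with y hy
      rw [evenTest, newt_congr ε (norm_sub_reflect hy), newt_congr r (norm_sub_reflect hy),
        newt_congr ε (norm_sub_rev x y), newt_congr r (norm_sub_rev x y)]
      module
    · exact integrable_kernel_smul hd.int (two_newt_contDiff ε).continuous (abs_two_newt_le hε) x
    · exact integrable_kernel_smul hd.int (two_newt_contDiff r).continuous (abs_two_newt_le hr) x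
  rw [e1, e2, integral_sub (by exact (hi hr _).add (hi hr _)) (hi hε _),
    integral_add (hi hr _) (hi hr _)] at key
  rw [← key]
  ring

/-- Since `delta r` is `O(r⁻³)` on a ball of radius `r`, this is a weighted mean over a growing
ball. A bounded region contributes `O(r⁻³)`, and outside of it `u` is uniformly small almost
everywhere. -/
lemma tendsto_delta_integral {u : E3 → ℂ}
    (hu : ∀ r : ℝ, MemLp u 2 (volume.restrict (lowerHalfSpace ∩ Metric.ball 0 r)))
    (h0 : Tendsto u (cocompact E3 ⊓ ae (volume.restrict lowerHalfSpace)) (𝓝 0)) (c : E3) :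
    Tendsto (fun r : ℝ => ∫ y in lowerHalfSpace, delta r (y - c) • u y) atTop (𝓝 0) := by
  rw [Metric.tendsto_atTop]
  intro η hη
  -- Chosen so that the region where `‖u‖ < κ` contributes at most `η / 2`.
  set κ := η / (2 * (deltaC * (Real.pi * 4 / 3)))
  have hC := deltaC_pos
  have hpi := Real.pi_pos
  have hκ : 0 < κ := by positivity
  have hev : ∀ᶠ x in cocompact E3 ⊓ ae (volume.restrict lowerHalfSpace), ‖u x‖ < κ := by
    filter_upwards [h0.eventually (Metric.ball_mem_nhds 0 hκ)] with x hx
    simpa using hx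
  obtain ⟨s, hs, t, ht, hst⟩ := Filter.mem_inf_iff_superset.1 hev
  obtain ⟨K, hK, hKs⟩ := mem_cocompact.1 hs
  obtain ⟨m, hm⟩ := hK.isBounded.subset_ball (0 : E3)
  have hfin : IsFiniteMeasure (volume.restrict (lowerHalfSpace ∩ Metric.ball (0 : E3) m)) :=
    ⟨by rw [Measure.restrict_apply_univ]
        exact (measure_mono inter_subset_right).trans_lt measure_ball_lt_top⟩
  have hui : IntegrableOn u (lowerHalfSpace ∩ Metric.ball 0 m) := (hu m).integrable (by norm_num)
  set w : E3 → ℝ := (lowerHalfSpace ∩ Metric.ball 0 m).indicator fun x => ‖u x‖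
  have hw : Integrable w := by
    rw [integrable_indicator_iff (measurableSet_lowerHalfSpace.inter measurableSet_ball)]
    exact hui.norm
  have hw0 : 0 ≤ ∫ y, w y := integral_nonneg fun y => indicator_nonneg (fun _ _ => norm_nonneg _) y
  have hbound : ∀ᵐ y ∂volume.restrict lowerHalfSpace, ‖u y‖ ≤ w y + κ := by
    filter_upwards [ht, ae_restrict_mem measurableSet_lowerHalfSpace] with y hy hyΩ
    by_cases hyK : y ∈ Metric.ball (0 : E3) m
    · have h3 : w y = ‖u y‖ := indicator_of_mem (show y ∈ lowerHalfSpace ∩ _ from ⟨hyΩ, hyK⟩) _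
      linarith
    · have h1 : y ∈ s := hKs fun h => hyK (hm h)
      have h2 : ‖u y‖ < κ := hst ⟨h1, hy⟩
      have h3 : w y = 0 := indicator_of_notMem (fun h => hyK h.2) _
      linarith
  have hmain : ∀ r : ℝ, 0 < r → ‖∫ y in lowerHalfSpace, delta r (y - c) • u y‖ ≤
      deltaC * (r⁻¹) ^ 3 * (∫ y, w y) + deltaC * (Real.pi * 4 / 3) * κ := by
    intro r hr
    set W : E3 → ℝ := fun y => deltaC * (r⁻¹) ^ 3 * w y +
      (Metric.ball c r).indicator (fun _ => deltaC * (r⁻¹) ^ 3 * κ) y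
    have hWi : Integrable W := (hw.const_mul _).add
      ((integrable_indicator_iff measurableSet_ball).2 (integrableOn_const measure_ball_lt_top.ne))
    have hW0 : ∀ y, 0 ≤ W y := fun y =>
      add_nonneg (mul_nonneg (by positivity) (indicator_nonneg (fun _ _ => norm_nonneg _) y))
        (indicator_nonneg (fun _ _ => by positivity) y)
    calc ‖∫ y in lowerHalfSpace, delta r (y - c) • u y‖ ≤ ∫ y in lowerHalfSpace, W y := by
          refine norm_integral_le_of_norm_le hWi.integrableOn ?_
          filter_upwards [hbound] with y hy
          rw [norm_smul, Real.norm_eq_abs]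
          by_cases hyc : y ∈ Metric.ball c r
          · simp only [W, indicator_of_mem hyc]
            calc |delta r (y - c)| * ‖u y‖ ≤ deltaC * (r⁻¹) ^ 3 * (w y + κ) := by
                  gcongr; exact abs_delta_le hr _
              _ = _ := by ring
          · rw [Metric.mem_ball, dist_eq_norm, not_lt] at hyc
            rw [delta_of_le hr hyc]
            simpa using hW0 y
      _ ≤ ∫ y, W y := setIntegral_le_integral hWi (Eventually.of_forall hW0)
      _ = _ := by
          have hv : (volume : Measure E3).real (Metric.ball c r) = r ^ 3 * (Real.pi * 4 / 3) := by
            rw [Measure.real, EuclideanSpace.volume_ball_fin_three, ENNReal.toReal_mul,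
              ENNReal.toReal_pow, ENNReal.toReal_ofReal hr.le, ENNReal.toReal_ofReal (by positivity)]
          rw [integral_add (hw.const_mul _) ((integrable_indicator_iff measurableSet_ball).2
            (integrableOn_const measure_ball_lt_top.ne)), integral_const_mul,
            integral_indicator measurableSet_ball, setIntegral_const, hv, smul_eq_mul]
          field_simp
  have hlim : Tendsto (fun r : ℝ => deltaC * (r⁻¹) ^ 3 * (∫ y, w y)) atTop (𝓝 0) := by
    have := ((tendsto_inv_atTop_zero (𝕜 := ℝ)).pow 3).const_mul deltaC |>.mul_const (∫ y, w y)
    simpa using this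
  obtain ⟨r0, hr0⟩ := (hlim.eventually (gt_mem_nhds (half_pos hη))).and
    (eventually_gt_atTop (0 : ℝ)) |>.exists_forall_of_atTop
  refine ⟨r0, fun r hr => ?_⟩
  obtain ⟨h1, h2⟩ := hr0 r hr
  rw [dist_zero_right]
  refine (hmain r h2).trans_lt ?_
  have : deltaC * (Real.pi * 4 / 3) * κ = η / 2 := by simp only [κ]; field_simp
  linarith

/-- Mean value form of the representation formula. -/
lemma delta_integral_eq_slp {u f g : E3 → ℂ} {G : E3 → EuclideanSpace ℂ (Fin 3)} {ρ : ℝ}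
    (hu : IsH1Loc u G) (hf : IsTrace u G f) (hg : IsNormalDerivative G g) (hd : IsDensity ρ g)
    (h0 : Tendsto u (cocompact E3 ⊓ ae (volume.restrict lowerHalfSpace)) (𝓝 0))
    {ε : ℝ} (hε : 0 < ε) {x : E3} (hx : x 2 ≤ -ε) :
    ∫ y in lowerHalfSpace, delta ε (y - x) • u y = slp g x := by
  rw [slp_eq_slpReg hε g hx]
  have h1 : Tendsto (fun r => slpReg r g x) atTop (𝓝 0) := by
    refine tendsto_const_nhds.congr' ?_
    filter_upwards [eventually_ge_atTop (2 * (‖x‖ + ρ))] with r hr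
    exact (hd.slpReg_eq_zero hr).symm
  have h2 : Tendsto (fun r => (slpReg ε g x - slpReg r g x) +
      ((∫ y in lowerHalfSpace, delta r (y - x) • u y) +
        ∫ y in lowerHalfSpace, delta r (y - reflect x) • u y)) atTop (𝓝 (slpReg ε g x - 0 + (0 + 0))) :=
    (tendsto_const_nhds.sub h1).add
      ((tendsto_delta_integral hu.memLp h0 x).add (tendsto_delta_integral hu.memLp h0 _))
  -- The left side is independent of the outer scale `r`; as `r → ∞` every term containing `r`
  -- disappears from the convolution identity.
  have h3 : Tendsto (fun _ : ℝ => ∫ y in lowerHalfSpace, delta ε (y - x) • u y) atTop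
      (𝓝 (slpReg ε g x - 0 + (0 + 0))) := by
    refine h2.congr' ?_
    filter_upwards [eventually_gt_atTop 0] with r hr
    rw [← delta_convolution_identity hu hf hg hd hε hr hx]
    ring
  have := tendsto_nhds_unique h3 tendsto_const_nhds
  simpa using this.symm

/-- A decaying harmonic function is the single layer potential of its Neumann data. -/
theorem ae_eq_slp {u f g : E3 → ℂ} {G : E3 → EuclideanSpace ℂ (Fin 3)} {ρ : ℝ}
    (hu : IsH1Loc u G) (hf : IsTrace u G f) (hg : IsNormalDerivative G g) (hd : IsDensity ρ g)
    (h0 : Tendsto u (cocompact E3 ⊓ ae (volume.restrict lowerHalfSpace)) (𝓝 0)) :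
    ∀ᵐ x ∂volume.restrict lowerHalfSpace, u x = slp g x := by
  have hm : ∀ m : ℕ, ∀ᵐ x : E3, x ∈ lowerHalfSpace → x ∈ Metric.ball (0 : E3) m → u x = slp g x := by
    intro m
    set O := lowerHalfSpace ∩ Metric.ball (0 : E3) m
    have hO : IsOpen O := isOpen_lowerHalfSpace.inter Metric.isOpen_ball
    have hfin : IsFiniteMeasure (volume.restrict O) :=
      ⟨by rw [Measure.restrict_apply_univ]
          exact (measure_mono inter_subset_right).trans_lt measure_ball_lt_top⟩
    have hui : IntegrableOn u O := (hu.memLp m).integrable (by norm_num)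
    have hw : Integrable (O.indicator u) := (integrable_indicator_iff hO.measurableSet).2 hui
    -- Almost every `x` is a Lebesgue point of the localized `u`.
    filter_upwards [IsUnifLocDoublingMeasure.ae_tendsto_average_norm_sub volume
      hw.locallyIntegrable 1] with x hx hxΩ hxm
    have hxO : x ∈ O := ⟨hxΩ, hxm⟩
    have hx' : x 2 < 0 := hxΩ
    have hlim := hx (l := 𝓝[>] (0 : ℝ)) (fun _ => x) id tendsto_id (by
      filter_upwards [self_mem_nhdsWithin] with j hj
      have : (0 : ℝ) < j := hj
      simp [this.le])
    simp only [id] at hlim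
    -- As `delta ε` has integral one and size `O(ε⁻³)`, the mollified value `slp g x` differs from
    -- `u x` by at most a multiple of the mean oscillation of `u` on the ball of radius `ε`.
    have hsmall : ∀ᶠ ε in 𝓝[>] (0 : ℝ), ‖slp g x - u x‖ ≤ deltaC * (Real.pi * 4 / 3) *
        ⨍ y in Metric.closedBall x ε, ‖O.indicator u y - O.indicator u x‖ := by
      obtain ⟨η, hη, hηO⟩ := Metric.isOpen_iff.1 hO x hxO
      filter_upwards [self_mem_nhdsWithin, Ioo_mem_nhdsGT (lt_min hη (neg_pos.2 hx'))] with ε hε hε2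
      have hε0 : 0 < ε := hε
      have hεη : ε < η := hε2.2.trans_le (min_le_left _ _)
      have hεx : ε < -x 2 := hε2.2.trans_le (min_le_right _ _)
      have hsub : Metric.closedBall x ε ⊆ O := (Metric.closedBall_subset_ball hεη).trans hηO
      have hz : ∀ y ∉ Metric.closedBall x ε, delta ε (y - x) = 0 := fun y hy => by
        rw [Metric.mem_closedBall, dist_eq_norm, not_le] at hy
        exact delta_of_le hε0 hy.le
      have e1 : ∫ y in lowerHalfSpace, delta ε (y - x) • u y =
          ∫ y in Metric.closedBall x ε, delta ε (y - x) • O.indicator u y := by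
        rw [setIntegral_eq_of_subset_of_forall_sdiff_eq_zero measurableSet_lowerHalfSpace
          (hsub.trans inter_subset_left) (fun y hy => by rw [hz y hy.2, zero_smul])]
        exact setIntegral_congr_fun measurableSet_closedBall fun y hy => by
          simp only [indicator_of_mem (hsub hy)]
      have e2 : ∫ y in Metric.closedBall x ε, delta ε (y - x) = 1 := by
        rw [setIntegral_eq_integral_of_forall_compl_eq_zero hz,
          integral_sub_right_eq_self (fun y => delta ε y) x, integral_delta hε0]
      have hcd : Continuous fun y : E3 => delta ε (y - x) :=
        (delta_continuous ε).comp (continuous_id.sub continuous_const)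
      have i1 : IntegrableOn (fun y => delta ε (y - x) • O.indicator u y) (Metric.closedBall x ε) :=
        hw.integrableOn.bdd_smul (deltaC * (ε⁻¹) ^ 3) hcd.aestronglyMeasurable
          (Eventually.of_forall fun y => abs_delta_le hε0 _)
      have i2 : IntegrableOn (fun y => delta ε (y - x) • O.indicator u x) (Metric.closedBall x ε) :=
        (hcd.continuousOn.integrableOn_compact (isCompact_closedBall x ε)).smul_const _
      have e3 : slp g x - u x =
          ∫ y in Metric.closedBall x ε, delta ε (y - x) • (O.indicator u y - O.indicator u x) := by
        rw [← delta_integral_eq_slp hu hf hg hd h0 hε0 (by linarith : x 2 ≤ -ε), e1]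
        simp only [smul_sub]
        rw [integral_sub i1 i2, integral_smul_const, e2, one_smul, indicator_of_mem hxO]
      have hint : IntegrableOn (fun y => ‖O.indicator u y - O.indicator u x‖)
          (Metric.closedBall x ε) :=
        (hw.integrableOn.sub (integrableOn_const measure_closedBall_lt_top.ne)).norm
      have hv : (volume : Measure E3).real (Metric.closedBall x ε) = ε ^ 3 * (Real.pi * 4 / 3) := by
        rw [Measure.real, EuclideanSpace.volume_closedBall_fin_three, ENNReal.toReal_mul,
          ENNReal.toReal_pow, ENNReal.toReal_ofReal hε0.le,
          ENNReal.toReal_ofReal (by have := Real.pi_pos; positivity)]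
      rw [e3]
      calc _ ≤ ∫ y in Metric.closedBall x ε,
              deltaC * (ε⁻¹) ^ 3 * ‖O.indicator u y - O.indicator u x‖ := by
            refine norm_integral_le_of_norm_le (hint.const_mul _) (Eventually.of_forall fun y => ?_)
            rw [norm_smul]
            gcongr
            exact abs_delta_le hε0 _
        _ = _ := by
            rw [integral_const_mul, setAverage_eq, hv, smul_eq_mul]
            have := Real.pi_pos
            field_simp
    have hlim2 := hlim.const_mul (deltaC * (Real.pi * 4 / 3))
    rw [mul_zero] at hlim2
    have := ge_of_tendsto hlim2 hsmall
    exact (sub_eq_zero.1 (norm_le_zero_iff.1 this)).symm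
  rw [ae_restrict_iff' measurableSet_lowerHalfSpace]
  filter_upwards [ae_all_iff.2 hm] with x hx hxΩ
  obtain ⟨m, hm⟩ := exists_nat_gt ‖x‖
  exact hx m hxΩ (by simpa using hm)

/-! ### Classical and weak gradients of the potential. -/

/-- The gradient of a complex-valued function, as a complex vector. -/
def gradC (V : E3 → ℂ) (x : E3) : EuclideanSpace ℂ (Fin 3) :=
  WithLp.toLp 2 fun i => fderiv ℝ V x (EuclideanSpace.single i 1)

lemma gradC_apply (V : E3 → ℂ) (x : E3) (i : Fin 3) :
    gradC V x i = fderiv ℝ V x (EuclideanSpace.single i 1) := rfl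

lemma integrable_smul_of_continuousOn {F : Type*} [NormedAddCommGroup F] [NormedSpace ℝ F]
    {O : Set E3} {φ : E3 → ℝ} (hφ : Continuous φ) (hc : HasCompactSupport φ) (hs : tsupport φ ⊆ O)
    {V : E3 → F} (hV : ContinuousOn V O) : Integrable fun x => φ x • V x := by
  have h : IntegrableOn (fun x => φ x • V x) (tsupport φ) :=
    (hφ.continuousOn.smul (hV.mono hs)).integrableOn_compact hc.isCompact
  refine (integrableOn_iff_integrable_of_support_subset fun x hx => ?_).1 h
  by_contra hn
  exact hx (by simp [image_eq_zero_of_notMem_tsupport hn])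

lemma IsTestFunction.partialDeriv_subset {U : Set E3} {φ : E3 → ℝ} (hφ : IsTestFunction U φ)
    (i : Fin 3) : tsupport (_root_.partialDeriv i φ) ⊆ U :=
  (closure_mono fun x hx => support_fderiv_subset ℝ (f := φ) (by
    intro h0; exact hx (by simp [_root_.partialDeriv, h0]))).trans
    (by rw [(isClosed_tsupport φ).closure_eq]; exact hφ.support_subset)

lemma HasWeakGradient.of_contDiffOn {O : Set E3} (hO : IsOpen O) {V : E3 → ℂ}
    (hV : ContDiffOn ℝ 1 V O) : HasWeakGradient O V (gradC V) where
  locInt := hV.continuousOn.locallyIntegrableOn hO.measurableSet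
  locInt_grad := by
    refine ContinuousOn.locallyIntegrableOn ?_ hO.measurableSet
    refine (PiLp.continuous_toLp 2 _).comp_continuousOn (continuousOn_pi.2 fun i => ?_)
    exact (hV.continuousOn_fderiv_of_isOpen hO (by simp)).clm_apply continuousOn_const
  integral_eq := by
    intro φ hφ i
    have hd : Differentiable ℝ φ := hφ.smooth.differentiable (by simp)
    have hcd : Continuous (partialDeriv i φ) := (partialDeriv_contDiff hφ.smooth i).continuous
    have hcs : HasCompactSupport (partialDeriv i φ) := hφ.compact.fderiv_apply (𝕜 := ℝ) _
    have hdV : ContinuousOn (fun x => fderiv ℝ V x (EuclideanSpace.single i 1)) O :=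
      (hV.continuousOn_fderiv_of_isOpen hO (by simp)).clm_apply continuousOn_const
    have i1 := integrable_smul_of_continuousOn hcd hcs (hφ.partialDeriv_subset i) hV.continuousOn
    have i2 := integrable_smul_of_continuousOn hφ.smooth.continuous hφ.compact hφ.support_subset hdV
    have i3 := integrable_smul_of_continuousOn hφ.smooth.continuous hφ.compact hφ.support_subset
      hV.continuousOn
    have key := integral_smul_fderiv_eq_neg_fderiv_smul_of_integrable (μ := (volume : Measure E3))
      i1 i2 i3 (fun x _ => hd x) (fun x hx =>
        ((hV.differentiableOn (by simp)) x (hφ.support_subset hx)).differentiableAt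
          (hO.mem_nhds (hφ.support_subset hx)))
    rw [setIntegral_eq_integral_of_forall_compl_eq_zero, setIntegral_eq_integral_of_forall_compl_eq_zero]
    · simp only [gradC_apply]
      rw [key, neg_neg]
      rfl
    · intro x hx
      rw [image_eq_zero_of_notMem_tsupport fun h => hx (hφ.support_subset h), zero_smul]
    · intro x hx
      rw [image_eq_zero_of_notMem_tsupport fun h => hx (hφ.partialDeriv_subset i h), zero_smul]

lemma HasWeakGradient.congr {O : Set E3} {u V : E3 → ℂ}
    {G : E3 → EuclideanSpace ℂ (Fin 3)} (h : HasWeakGradient O V G)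
    (huV : ∀ᵐ x ∂volume.restrict O, u x = V x) : HasWeakGradient O u G where
  locInt := fun x hx => by
    obtain ⟨s, hs, hi⟩ := h.locInt x hx
    refine ⟨s ∩ O, inter_mem hs self_mem_nhdsWithin, ?_⟩
    refine (hi.mono_set inter_subset_left).congr_fun_ae ?_
    filter_upwards [ae_mono (Measure.restrict_mono (inter_subset_right (s := s)) le_rfl) huV]
      with x hx using hx.symm
  locInt_grad := h.locInt_grad
  integral_eq := by
    intro φ hφ i
    rw [← h.integral_eq φ hφ i]
    refine integral_congr_ae ?_
    filter_upwards [huV] with x hx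
    rw [hx]

/-- The fundamental lemma of the calculus of variations, one component at a time. -/
lemma HasWeakGradient.ae_eq {O : Set E3} (hO : IsOpen O) {u : E3 → ℂ}
    {G H : E3 → EuclideanSpace ℂ (Fin 3)} (hG : HasWeakGradient O u G) (hH : HasWeakGradient O u H) :
    ∀ᵐ x ∂volume.restrict O, G x = H x := by
  have hcomp : ∀ {K : E3 → EuclideanSpace ℂ (Fin 3)}, LocallyIntegrableOn K O → ∀ i,
      LocallyIntegrableOn (fun x => K x i) O := by
    intro K hK i x hx
    obtain ⟨s, hs, hi⟩ := hK x hx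
    exact ⟨s, hs, (EuclideanSpace.proj (𝕜 := ℂ) i : EuclideanSpace ℂ (Fin 3) →L[ℂ] ℂ).integrable_comp hi⟩
  have hi : ∀ i, ∀ᵐ x, x ∈ O → G x i - H x i = 0 := by
    intro i
    refine hO.ae_eq_zero_of_integral_contDiff_smul_eq_zero
      ((hcomp hG.locInt_grad i).sub (hcomp hH.locInt_grad i)) fun φ h1 h2 h3 => ?_
    have hφ : IsTestFunction O φ := ⟨h1, h2, h3⟩
    have e : ∀ {K : E3 → EuclideanSpace ℂ (Fin 3)}, LocallyIntegrableOn K O →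
        IntegrableOn (fun x => φ x • K x i) O := by
      intro K hK
      obtain ⟨B, hB⟩ := h2.exists_bound_of_continuous h1.continuous
      have h4 : IntegrableOn (fun x => φ x • K x i) (tsupport φ) :=
        ((hcomp hK i).integrableOn_compact_subset h3 h2.isCompact).bdd_smul B
          h1.continuous.aestronglyMeasurable (Eventually.of_forall hB)
      exact h4.of_forall_sdiff_eq_zero hO.measurableSet fun x hx => by
        simp [image_eq_zero_of_notMem_tsupport hx.2]
    have hz : ∀ x ∉ O, φ x • (G x i - H x i) = 0 := fun x hx => by
      rw [image_eq_zero_of_notMem_tsupport fun h => hx (h3 h), zero_smul]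
    rw [← setIntegral_eq_integral_of_forall_compl_eq_zero hz]
    simp only [smul_sub]
    rw [integral_sub (e hG.locInt_grad) (e hH.locInt_grad), sub_eq_zero, ← neg_inj,
      ← hG.integral_eq φ hφ i, ← hH.integral_eq φ hφ i]
  rw [ae_restrict_iff' hO.measurableSet]
  filter_upwards [ae_all_iff.2 hi] with x hx hxO
  exact PiLp.ext fun i => sub_eq_zero.1 (hx i hxO)

lemma IsDensity.slp_contDiffOn {F : Type*} [NormedAddCommGroup F] [NormedSpace ℝ F] {g : E3 → F}
    {ρ : ℝ} (hg : IsDensity ρ g) {n : ℕ∞} : ContDiffOn ℝ n (slp g) lowerHalfSpace :=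
  fun _ hx => ((hg.slp_contDiffAt hx).of_le (by exact_mod_cast le_top)).contDiffWithinAt

lemma ae_eq_gradC_slp {u f g : E3 → ℂ} {G : E3 → EuclideanSpace ℂ (Fin 3)} {ρ : ℝ}
    (hu : IsH1Loc u G) (hf : IsTrace u G f) (hg : IsNormalDerivative G g) (hd : IsDensity ρ g)
    (h0 : Tendsto u (cocompact E3 ⊓ ae (volume.restrict lowerHalfSpace)) (𝓝 0)) :
    ∀ᵐ x ∂volume.restrict lowerHalfSpace, G x = gradC (slp g) x :=
  hu.weakGrad.ae_eq isOpen_lowerHalfSpace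
    ((HasWeakGradient.of_contDiffOn isOpen_lowerHalfSpace (hd.slp_contDiffOn (n := 1))).congr
      (ae_eq_slp hu hf hg hd h0))

/-! ### Quadratic decay and square integrability of the gradient. -/

/-- The square decays like `|x|⁻⁴`, and `4 > 3`. This weight is the majorant for the tails of the
gradients and for the final estimate. -/
lemma memLp_one_add_norm : MemLp (fun x : E3 => ((1 + ‖x‖) ^ 2)⁻¹) 2 volume := by
  have hc : Continuous fun x : E3 => ((1 + ‖x‖) ^ 2)⁻¹ := by
    refine Continuous.inv₀ (by fun_prop) fun x => ?_
    positivity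
  rw [memLp_two_iff_integrable_sq hc.aestronglyMeasurable]
  have h := integrable_one_add_norm (E := E3) (μ := volume) (r := 4) (by simp; norm_num)
  refine h.congr (Eventually.of_forall fun x => ?_)
  simp only
  rw [Real.rpow_neg (by positivity), ← inv_pow, ← pow_mul, inv_pow]
  norm_num

section

variable {F : Type*} [NormedAddCommGroup F] [NormedSpace ℝ F] {g : E3 → F} {ρ : ℝ}

/-- Uniform decay of the gradients of the regularized potentials at large scales. -/
lemma IsDensity.exists_fderiv_slpReg_bound (hg : IsDensity ρ g) : ∃ C : ℝ, 0 ≤ C ∧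
    ∀ r : ℝ, 1 ≤ r → ∀ x, ‖fderiv ℝ (slpReg r g) x‖ ≤ C * ((1 + ‖x‖) ^ 2)⁻¹ := by
  have hM : 0 ≤ ∫ y, ‖g y‖ ∂surfaceMeasure := integral_nonneg fun _ => norm_nonneg _
  have hC := newtC_pos
  have hρ := hg.pos
  set M := ∫ y, ‖g y‖ ∂surfaceMeasure
  set C := 2 * newtC * (1 + 2 * ρ) ^ 2 * M + 8 * newtC * (1 + 1 / (2 * ρ)) ^ 2 * M
  have h1 : 0 ≤ 2 * newtC * (1 + 2 * ρ) ^ 2 * M := by positivity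
  have h2 : 0 ≤ 8 * newtC * (1 + 1 / (2 * ρ)) ^ 2 * M := by positivity
  refine ⟨C, by positivity, fun r hr x => ?_⟩
  have hr0 : 0 < r := by linarith
  rw [← div_eq_mul_inv, le_div_iff₀ (by positivity)]
  rcases le_total (2 * ρ) ‖x‖ with h | h
  · have hx0 : 0 < ‖x‖ := by linarith
    calc _ ≤ 8 * newtC / ‖x‖ ^ 2 * M * (1 + ‖x‖) ^ 2 := by
          gcongr; exact hg.norm_fderiv_slpReg_le_far hr0 h
      _ = 8 * newtC * ((1 + ‖x‖) / ‖x‖) ^ 2 * M := by field_simp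
      _ ≤ 8 * newtC * (1 + 1 / (2 * ρ)) ^ 2 * M := by
          gcongr
          rw [add_div, div_self hx0.ne', add_comm]
          gcongr
      _ ≤ C := by linarith
  · calc _ ≤ 2 * (newtC / r ^ 2) * M * (1 + ‖x‖) ^ 2 := by
          gcongr; exact hg.norm_fderiv_slpReg_le hr0 x
      _ ≤ 2 * (newtC / 1 ^ 2) * M * (1 + 2 * ρ) ^ 2 := by gcongr
      _ = 2 * newtC * (1 + 2 * ρ) ^ 2 * M := by ring
      _ ≤ C := by linarith

lemma IsDensity.exists_fderiv_slp_bound_far (hg : IsDensity ρ g) : ∃ C : ℝ, 0 ≤ C ∧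
    ∀ x ∈ lowerHalfSpace, 2 * ρ ≤ ‖x‖ → ‖fderiv ℝ (slp g) x‖ ≤ C * ((1 + ‖x‖) ^ 2)⁻¹ := by
  have hM : 0 ≤ ∫ y, ‖g y‖ ∂surfaceMeasure := integral_nonneg fun _ => norm_nonneg _
  have hC := newtC_pos
  have hρ := hg.pos
  refine ⟨8 * newtC * (1 + 1 / (2 * ρ)) ^ 2 * ∫ y, ‖g y‖ ∂surfaceMeasure, by positivity,
    fun x hx h => ?_⟩
  set M := ∫ y, ‖g y‖ ∂surfaceMeasure
  have hx0 : 0 < ‖x‖ := by linarith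
  rw [← div_eq_mul_inv, le_div_iff₀ (by positivity)]
  calc _ ≤ 8 * newtC / ‖x‖ ^ 2 * M * (1 + ‖x‖) ^ 2 := by
        gcongr; exact hg.norm_fderiv_slp_le_far hx h
    _ = 8 * newtC * ((1 + ‖x‖) / ‖x‖) ^ 2 * M := by field_simp
    _ ≤ 8 * newtC * (1 + 1 / (2 * ρ)) ^ 2 * M := by
        gcongr
        rw [add_div, div_self hx0.ne', add_comm]
        gcongr

lemma IsDensity.continuousOn_fderiv_slp (hg : IsDensity ρ g) (v : E3) :
    ContinuousOn (fun x => fderiv ℝ (slp g) x v) lowerHalfSpace :=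
  ((hg.slp_contDiffOn (n := 1)).continuousOn_fderiv_of_isOpen isOpen_lowerHalfSpace
    (by simp)).clm_apply continuousOn_const

/-- Far from the density the gradient decays quadratically, so only square integrability near the
density has to be supplied; for a solution it comes from membership in local `H¹`. -/
lemma IsDensity.memLp_fderiv_slp (hg : IsDensity ρ g) {v : E3}
    (hloc : MemLp (fun x => fderiv ℝ (slp g) x v) 2
      (volume.restrict (lowerHalfSpace ∩ Metric.ball 0 (2 * ρ)))) :
    MemLp (fun x => fderiv ℝ (slp g) x v) 2 (volume.restrict lowerHalfSpace) := by
  obtain ⟨C, hC, hb⟩ := hg.exists_fderiv_slp_bound_far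
  set D : E3 → F := fun x => fderiv ℝ (slp g) x v
  have hmeas : AEStronglyMeasurable D (volume.restrict lowerHalfSpace) :=
    (hg.continuousOn_fderiv_slp v).aestronglyMeasurable measurableSet_lowerHalfSpace
  have h1 : MemLp ((Metric.ball (0 : E3) (2 * ρ)).indicator D) 2 (volume.restrict lowerHalfSpace) := by
    rw [memLp_indicator_iff_restrict measurableSet_ball, Measure.restrict_restrict measurableSet_ball,
      inter_comm]
    exact hloc
  have h2 : MemLp ((Metric.ball (0 : E3) (2 * ρ))ᶜ.indicator D) 2 (volume.restrict lowerHalfSpace) := by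
    refine (((memLp_one_add_norm.const_mul (C * ‖v‖)).restrict lowerHalfSpace)).of_le
      (hmeas.indicator measurableSet_ball.compl) ?_
    filter_upwards [ae_restrict_mem measurableSet_lowerHalfSpace] with x hx
    by_cases h : x ∈ Metric.ball (0 : E3) (2 * ρ)
    · rw [indicator_of_notMem (by simpa using h), norm_zero]; positivity
    · rw [indicator_of_mem h]
      have h' : 2 * ρ ≤ ‖x‖ := by simpa using h
      rw [Real.norm_of_nonneg (by positivity)]
      calc ‖D x‖ ≤ ‖fderiv ℝ (slp g) x‖ * ‖v‖ := ContinuousLinearMap.le_opNorm _ _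
        _ ≤ C * ((1 + ‖x‖) ^ 2)⁻¹ * ‖v‖ := by gcongr; exact hb x hx h'
        _ = _ := by ring
  have := h1.add h2
  rwa [indicator_self_add_compl] at this

end

/-! ### Weak convergence of bounded sequences in `L²`. -/

section WeakConvergence

variable {α : Type*} [MeasurableSpace α] {μ : Measure α}
  {F : Type*} [NormedAddCommGroup F] [NormedSpace ℝ F]

/-- A sequence bounded in `L²` that converges almost everywhere converges weakly. -/
lemma tendsto_integral_smul_of_bounded {f : α → ℝ} (hf : MemLp f 2 μ) {k : ℕ → α → F} {l : α → F}
    (hk : ∀ n, AEStronglyMeasurable (k n) μ) {C : ℝ≥0∞} (hC : C ≠ ⊤)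
    (hb : ∀ n, eLpNorm (k n) 2 μ ≤ C) (hlim : ∀ᵐ x ∂μ, Tendsto (fun n => k n x) atTop (𝓝 (l x))) :
    Tendsto (fun n => ∫ x, f x • k n x ∂μ) atTop (𝓝 (∫ x, f x • l x ∂μ)) := by
  have hl : AEStronglyMeasurable l μ := aestronglyMeasurable_of_tendsto_ae _ hk hlim
  have hlC : eLpNorm l 2 μ ≤ C := by
    refine (Lp.eLpNorm_lim_le_liminf_eLpNorm hk l hlim).trans ?_
    exact (liminf_le_liminf (Eventually.of_forall hb)).trans (by simp)
  have hkm : ∀ n, MemLp (k n) 2 μ := fun n => ⟨hk n, (hb n).trans_lt hC.lt_top⟩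
  have hlm : MemLp l 2 μ := ⟨hl, hlC.trans_lt hC.lt_top⟩
  have hkl : ∀ n, MemLp (k n - l) 2 μ := fun n => MemLp.sub (hkm n) hlm
  have hklC : ∀ n, eLpNorm (k n - l) 2 μ ≤ C + C := fun n =>
    (eLpNorm_sub_le (hk n) hl (by norm_num)).trans (add_le_add (hb n) hlC)
  -- By Hölder, uniform integrability and tightness of the products are inherited from the single
  -- function `f`, since `k n - l` is bounded in `L²`. Vitali's theorem then gives convergence in
  -- `L¹`.
  have hui : UnifIntegrable (fun n x => f x • (k n x - l x)) 1 μ := by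
    intro ε hε
    obtain ⟨δ, hδ, h⟩ := hf.eLpNorm_indicator_le (by norm_num) (by norm_num)
      (ε := ε / ((C + C).toReal + 1)) (by positivity)
    refine ⟨δ, hδ, fun n s hs hμs => ?_⟩
    have e : s.indicator (fun x => f x • (k n x - l x)) = s.indicator f • (k n - l) := by
      ext x; by_cases hx : x ∈ s <;> simp [hx]
    rw [e]
    have hCC : C + C ≠ ⊤ := ENNReal.add_ne_top.2 ⟨hC, hC⟩
    calc eLpNorm (s.indicator f • (k n - l)) 1 μ
        ≤ eLpNorm (s.indicator f) 2 μ * eLpNorm (k n - l) 2 μ :=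
          eLpNorm_smul_le_mul_eLpNorm (hkl n).1 (hf.1.indicator hs)
      _ ≤ ENNReal.ofReal (ε / ((C + C).toReal + 1)) * (C + C) := by
          gcongr
          · exact h s hs hμs
          · exact hklC n
      _ = ENNReal.ofReal (ε / ((C + C).toReal + 1) * (C + C).toReal) := by
          rw [ENNReal.ofReal_mul (by positivity), ENNReal.ofReal_toReal hCC]
      _ ≤ ENNReal.ofReal ε := by
          refine ENNReal.ofReal_le_ofReal ?_
          rw [div_mul_eq_mul_div, div_le_iff₀ (by positivity)]
          nlinarith
  have hut : UnifTight (fun n x => f x • (k n x - l x)) 1 μ := by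
    rw [unifTight_iff_real]
    intro ε hε
    have hCC : C + C ≠ ⊤ := ENNReal.add_ne_top.2 ⟨hC, hC⟩
    obtain ⟨s, hs, hsμ, h⟩ := hf.exists_eLpNorm_indicator_compl_lt (by norm_num)
      (ε := ENNReal.ofReal (ε / ((C + C).toReal + 1))) (by simp; positivity)
    refine ⟨s, hsμ.ne, fun n => ?_⟩
    have e : sᶜ.indicator (fun x => f x • (k n x - l x)) = sᶜ.indicator f • (k n - l) := by
      ext x; by_cases hx : x ∈ s <;> simp [hx]
    rw [e]
    calc eLpNorm (sᶜ.indicator f • (k n - l)) 1 μ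
        ≤ eLpNorm (sᶜ.indicator f) 2 μ * eLpNorm (k n - l) 2 μ :=
          eLpNorm_smul_le_mul_eLpNorm (hkl n).1 (hf.1.indicator hs.compl)
      _ ≤ ENNReal.ofReal (ε / ((C + C).toReal + 1)) * (C + C) := by
          gcongr
          exact hklC n
      _ = ENNReal.ofReal (ε / ((C + C).toReal + 1) * (C + C).toReal) := by
          rw [ENNReal.ofReal_mul (by positivity), ENNReal.ofReal_toReal hCC]
      _ ≤ ENNReal.ofReal ε := by
          refine ENNReal.ofReal_le_ofReal ?_
          rw [div_mul_eq_mul_div, div_le_iff₀ (by positivity)]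
          nlinarith
  have h0 : Tendsto (fun n => eLpNorm ((fun x => f x • (k n x - l x)) - fun _ => (0 : F)) 1 μ) atTop
      (𝓝 0) := by
    refine tendsto_Lp_of_tendsto_ae (by norm_num) (by norm_num) (fun n => hf.1.smul (hkl n).1)
      MemLp.zero hui hut ?_
    filter_upwards [hlim] with x hx
    have := (hx.sub_const (l x)).const_smul (f x)
    simpa using this
  have hi : ∀ n, Integrable (fun x => f x • k n x) μ := fun n =>
    memLp_one_iff_integrable.1 (MemLp.smul (hkm n) hf)
  have hil : Integrable (fun x => f x • l x) μ :=
    memLp_one_iff_integrable.1 (MemLp.smul hlm hf)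
  refine tendsto_integral_of_L1' _ hil.1 (Eventually.of_forall hi) ?_
  refine h0.congr fun n => ?_
  congr 1
  ext x
  simp [smul_sub]

end WeakConvergence

/-! ### The majorant of boundary potentials of integrable densities. -/

section RieszPotential

instance surfaceMeasure_nullSingletonClass : NullSingletonClass surfaceMeasure where
  measure_singleton z := by
    rw [surfaceMeasure, boundaryEmb_measurableEmbedding.map_apply]
    exact (subsingleton_singleton.preimage boundaryEmb_isometry.injective).measure_zero _

lemma integrableOn_ball_inv_norm_two :
    IntegrableOn (fun y : EuclideanSpace ℝ (Fin 2) => ‖y‖⁻¹) (Metric.ball 0 1) := by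
  refine integrableOn_ball_of_norm_le_rpow (C := 1) (α := 1) (by simp) (by simp) ?_ ?_
  · refine Eventually.of_forall fun x => ?_
    rw [Real.rpow_neg_one, one_mul, norm_inv, norm_norm]
  · exact (measurable_norm.inv).aestronglyMeasurable

/-- The Newton kernel is locally integrable on the plane, uniformly in the position of the pole. -/
lemma exists_integral_inv_norm_sub_le (m : ℝ) : ∃ C : ℝ, ∀ z : E3, z 2 = 0 →
    IntegrableOn (fun y => ‖y - z‖⁻¹) (Metric.ball 0 m) surfaceMeasure ∧
      ∫ y in Metric.ball 0 m, ‖y - z‖⁻¹ ∂surfaceMeasure ≤ C := by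
  have hfin : surfaceMeasure (Metric.ball (0 : E3) m) ≠ ⊤ :=
    ((measure_mono Metric.ball_subset_closedBall).trans_lt
      (isCompact_closedBall _ _).measure_lt_top).ne
  -- The unit disk around the pole contributes the same amount for every pole by translation
  -- invariance; elsewhere the kernel is at most 1.
  refine ⟨(∫ y in Metric.ball (0 : EuclideanSpace ℝ (Fin 2)) 1, ‖y‖⁻¹) +
    surfaceMeasure.real (Metric.ball (0 : E3) m), fun z hz => ?_⟩
  obtain ⟨w, rfl⟩ := exists_boundaryEmb hz
  have hnear : IntegrableOn (fun y => ‖y - boundaryEmb w‖⁻¹) (Metric.ball (boundaryEmb w) 1)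
      surfaceMeasure ∧ ∫ y in Metric.ball (boundaryEmb w) 1, ‖y - boundaryEmb w‖⁻¹ ∂surfaceMeasure =
        ∫ y in Metric.ball (0 : EuclideanSpace ℝ (Fin 2)) 1, ‖y‖⁻¹ := by
    have hpre : boundaryEmb ⁻¹' Metric.ball (boundaryEmb w) 1 = Metric.ball w 1 :=
      boundaryEmb_isometry.preimage_ball w 1
    have hmp : MeasurePreserving (fun y : EuclideanSpace ℝ (Fin 2) => y - w)
        (volume.restrict (Metric.ball w 1)) (volume.restrict (Metric.ball 0 1)) := by
      have := (measurePreserving_sub_right volume w).restrict_preimage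
        (measurableSet_ball (x := (0 : EuclideanSpace ℝ (Fin 2))) (ε := 1))
      convert this using 3
      ext y; simp [dist_eq_norm]
    have hemb : MeasurableEmbedding (fun y : EuclideanSpace ℝ (Fin 2) => y - w) :=
      measurableEmbedding_subRight w
    constructor
    · rw [surfaceMeasure, boundaryEmb_measurableEmbedding.integrableOn_map_iff, hpre]
      have := (hmp.integrable_comp_emb hemb).2 integrableOn_ball_inv_norm_two
      refine this.congr (Eventually.of_forall fun y => ?_)
      simp [norm_boundaryEmb_sub]
    · rw [surfaceMeasure, boundaryEmb_measurableEmbedding.setIntegral_map, hpre,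
        ← hmp.integral_comp hemb]
      simp [norm_boundaryEmb_sub]
  set W : E3 → ℝ := fun y => (Metric.ball (boundaryEmb w) 1).indicator
    (fun y => ‖y - boundaryEmb w‖⁻¹) y + 1
  have hW0 : ∀ y, 0 ≤ (Metric.ball (boundaryEmb w) 1).indicator
    (fun y => ‖y - boundaryEmb w‖⁻¹) y := fun y => indicator_nonneg (fun _ _ => by positivity) y
  have hWi : Integrable ((Metric.ball (boundaryEmb w) 1).indicator
      (fun y => ‖y - boundaryEmb w‖⁻¹)) surfaceMeasure :=
    (integrable_indicator_iff measurableSet_ball).2 hnear.1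
  have hle : ∀ y, ‖y - boundaryEmb w‖⁻¹ ≤ W y := by
    intro y
    by_cases h : y ∈ Metric.ball (boundaryEmb w) 1
    · simp [W, indicator_of_mem h]
    · simp only [W, indicator_of_notMem h, zero_add]
      rw [Metric.mem_ball, dist_eq_norm, not_lt] at h
      exact inv_le_one_of_one_le₀ h
  have hWi' : IntegrableOn W (Metric.ball 0 m) surfaceMeasure :=
    hWi.integrableOn.add (integrableOn_const hfin)
  have hint : IntegrableOn (fun y => ‖y - boundaryEmb w‖⁻¹) (Metric.ball 0 m) surfaceMeasure := by
    refine hWi'.mono' ((by fun_prop : Measurable fun y : E3 => ‖y - boundaryEmb w‖⁻¹)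
      |>.aestronglyMeasurable) (Eventually.of_forall fun y => ?_)
    rw [Real.norm_of_nonneg (by positivity)]
    exact hle y
  refine ⟨hint, (setIntegral_mono hint hWi' hle).trans ?_⟩
  rw [integral_add hWi.integrableOn (integrableOn_const hfin), setIntegral_const, smul_eq_mul, mul_one]
  gcongr
  refine (setIntegral_le_integral hWi (Eventually.of_forall hW0)).trans (le_of_eq ?_)
  rw [integral_indicator measurableSet_ball, hnear.2]

variable {F : Type*} [NormedAddCommGroup F] {g : E3 → F}

/-- The potential majorizing single layer potentials with density `g` on the boundary. -/
def riesz (g : E3 → F) (y : E3) : ℝ := ∫ z, ‖y - z‖⁻¹ * ‖g z‖ ∂surfaceMeasure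

/-- Tonelli, integrating first in the variable confined to the ball: the bound uniform in the pole
leaves just the `L¹` norm of `g`. No higher integrability of `g` is required. -/
lemma integrable_riesz_kernel (hg : Integrable g surfaceMeasure) (m : ℝ) :
    Integrable (fun q : E3 × E3 => ‖q.1 - q.2‖⁻¹ * ‖g q.2‖)
      ((surfaceMeasure.restrict (Metric.ball 0 m)).prod surfaceMeasure) := by
  obtain ⟨C, hC⟩ := exists_integral_inv_norm_sub_le m
  have hmeas : AEStronglyMeasurable (fun q : E3 × E3 => ‖q.1 - q.2‖⁻¹ * ‖g q.2‖)
      ((surfaceMeasure.restrict (Metric.ball 0 m)).prod surfaceMeasure) :=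
    ((by fun_prop : Measurable fun q : E3 × E3 => ‖q.1 - q.2‖⁻¹).aestronglyMeasurable).mul
      hg.1.norm.comp_snd
  rw [integrable_prod_iff' hmeas]
  constructor
  · filter_upwards [ae_surfaceMeasure_mem_plane] with z hz
    exact (hC z hz).1.mul_const _
  · refine (hg.norm.const_mul C).mono' hmeas.norm.prod_swap.integral_prod_right' ?_
    filter_upwards [ae_surfaceMeasure_mem_plane] with z hz
    have e : ∀ y : E3, ‖‖y - z‖⁻¹ * ‖g z‖‖ = ‖y - z‖⁻¹ * ‖g z‖ := fun y =>
      Real.norm_of_nonneg (by positivity)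
    simp only [e]
    rw [integral_mul_const, Real.norm_of_nonneg]
    · gcongr
      exact (hC z hz).2
    · exact mul_nonneg (integral_nonneg fun _ => by positivity) (norm_nonneg _)

lemma ae_integrable_riesz (hg : Integrable g surfaceMeasure) :
    ∀ᵐ y ∂surfaceMeasure, Integrable (fun z => ‖y - z‖⁻¹ * ‖g z‖) surfaceMeasure := by
  have h : ∀ m : ℕ, ∀ᵐ y ∂surfaceMeasure, y ∈ Metric.ball (0 : E3) m →
      Integrable (fun z => ‖y - z‖⁻¹ * ‖g z‖) surfaceMeasure := fun m =>
    (ae_restrict_iff' measurableSet_ball).1 (integrable_riesz_kernel hg m).prod_right_ae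
  filter_upwards [ae_all_iff.2 h] with y hy
  obtain ⟨m, hm⟩ := exists_nat_gt ‖y‖
  exact hy m (by simpa using hm)

lemma integrableOn_riesz (hg : Integrable g surfaceMeasure) (m : ℝ) :
    IntegrableOn (riesz g) (Metric.ball 0 m) surfaceMeasure := by
  refine (integrable_riesz_kernel hg m).integral_norm_prod_left.congr
    (Eventually.of_forall fun y => ?_)
  refine integral_congr_ae (Eventually.of_forall fun z => ?_)
  exact Real.norm_of_nonneg (by positivity)

end RieszPotential

/-! ### Smooth compactly supported approximations of the potential. -/

/-- The scales of the approximation of single layer potentials. -/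
def scale (n : ℕ) : ℝ := 1 / ((n : ℝ) + 1)

lemma scale_pos (n : ℕ) : 0 < scale n := by unfold scale; positivity

lemma scale_le_one (n : ℕ) : scale n ≤ 1 := by
  unfold scale
  rw [div_le_one (by positivity)]
  have : (0 : ℝ) ≤ n := Nat.cast_nonneg n
  linarith

lemma tendsto_scale : Tendsto scale atTop (𝓝 0) := tendsto_one_div_add_atTop_nhds_zero_nat

lemma eLpNorm_comp_sub_le {F : Type*} [NormedAddCommGroup F] {D : E3 → F} {S T : Set E3}
    (hT : MeasurableSet T) (hD : AEStronglyMeasurable D (volume.restrict T)) {c : E3}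
    (hST : ∀ x ∈ S, x - c ∈ T) :
    eLpNorm (fun x => D (x - c)) 2 (volume.restrict S) ≤ eLpNorm D 2 (volume.restrict T) := by
  have hmp := (measurePreserving_sub_right (volume : Measure E3) c).restrict_preimage hT
  have h := eLpNorm_comp_measurePreserving (p := 2) hD hmp
  rw [← h]
  exact eLpNorm_mono_measure _ (Measure.restrict_mono (fun x hx => hST x hx) le_rfl)

section Approximation

variable {F : Type*} [NormedAddCommGroup F] [NormedSpace ℝ F] {g : E3 → F} {ρ : ℝ}

/-- Smooth compactly supported approximations of the single layer potential in the closed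
half-space: translation upwards, and truncation at infinity. -/
def slpApprox (n : ℕ) (g : E3 → F) (x : E3) : F :=
  slpReg (scale n) g (x - scale n • outwardNormal) -
    slpReg (scale n)⁻¹ g (x - scale n • outwardNormal)

lemma sub_smul_outwardNormal_two (x : E3) (t : ℝ) : (x - t • outwardNormal) 2 = x 2 - t := by
  simp [outwardNormal]

lemma IsDensity.slpApprox_contDiff (hg : IsDensity ρ g) (n : ℕ) : ContDiff ℝ ∞ (slpApprox n g) :=
  (hg.slpReg_sub_contDiff (scale_pos n) (inv_pos.2 (scale_pos n))).comp
    (contDiff_id.sub contDiff_const)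

lemma IsDensity.slpApprox_hasCompactSupport (hg : IsDensity ρ g) (n : ℕ) :
    HasCompactSupport (slpApprox n g) := by
  have h : HasCompactSupport fun x => slpReg (scale n) g x - slpReg (scale n)⁻¹ g x := by
    refine HasCompactSupport.intro
      (isCompact_closedBall (0 : E3) (ρ + scale n + (scale n)⁻¹)) fun x hx => ?_
    rw [mem_closedBall_zero_iff, not_le] at hx
    exact hg.slpReg_sub_eq_zero (scale_pos n) (inv_pos.2 (scale_pos n)) hx.le
  exact h.comp_homeomorph (Homeomorph.subRight (scale n • outwardNormal))

lemma slpApprox_eq (n : ℕ) (g : E3 → F) {x : E3} (hx : x 2 ≤ 0) :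
    slpApprox n g x = slp g (x - scale n • outwardNormal) -
      slpReg (scale n)⁻¹ g (x - scale n • outwardNormal) := by
  rw [slpApprox, slp_eq_slpReg (scale_pos n) g]
  rw [sub_smul_outwardNormal_two]; linarith

lemma tendsto_sub_scale (x : E3) :
    Tendsto (fun n => x - scale n • outwardNormal) atTop (𝓝 x) := by
  simpa using tendsto_const_nhds.sub (tendsto_scale.smul_const outwardNormal)

lemma IsDensity.tendsto_slpReg_scale (hg : IsDensity ρ g) (c : ℕ → E3) :
    Tendsto (fun n => slpReg (scale n)⁻¹ g (c n)) atTop (𝓝 0) := by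
  refine squeeze_zero_norm (fun n => hg.norm_slpReg_le (inv_pos.2 (scale_pos n)) _) ?_
  simp only [inv_inv]
  simpa using (tendsto_scale.const_mul 2).mul_const (∫ y, ‖g y‖ ∂surfaceMeasure)

lemma IsDensity.tendsto_slpApprox (hg : IsDensity ρ g) {x : E3} (hx : x ∈ lowerHalfSpace) :
    Tendsto (fun n => slpApprox n g x) atTop (𝓝 (slp g x)) := by
  have h1 := ((hg.slp_contDiffAt hx).continuousAt.tendsto.comp (tendsto_sub_scale x)).sub
    (hg.tendsto_slpReg_scale fun n => x - scale n • outwardNormal)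
  rw [sub_zero] at h1
  refine h1.congr fun n => ?_
  rw [slpApprox_eq n g (le_of_lt hx), Function.comp]

lemma IsDensity.fderiv_slpApprox (hg : IsDensity ρ g) (n : ℕ) {x : E3} (hx : x ∈ lowerHalfSpace) :
    fderiv ℝ (slpApprox n g) x = fderiv ℝ (slp g) (x - scale n • outwardNormal) -
      fderiv ℝ (slpReg (scale n)⁻¹ g) (x - scale n • outwardNormal) := by
  have hx' : x 2 < 0 := hx
  have hd : ∀ {ε : ℝ}, 0 < ε → DifferentiableAt ℝ
      (fun x => slpReg ε g (x - scale n • outwardNormal)) x := fun hε =>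
    (((hg.slpReg_contDiff hε).differentiable (by simp)).comp
      (differentiable_id.sub_const _)) x
  rw [fderiv_slp_eq (scale_pos n) g (by rw [sub_smul_outwardNormal_two]; linarith),
    ← fderiv_comp_sub, ← fderiv_comp_sub,
    ← fderiv_fun_sub (hd (scale_pos n)) (hd (inv_pos.2 (scale_pos n)))]
  rfl

lemma IsDensity.tendsto_fderiv_slpApprox (hg : IsDensity ρ g) (v : E3) {x : E3}
    (hx : x ∈ lowerHalfSpace) :
    Tendsto (fun n => fderiv ℝ (slpApprox n g) x v) atTop (𝓝 (fderiv ℝ (slp g) x v)) := by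
  have hc : ContinuousAt (fun x => fderiv ℝ (slp g) x v) x :=
    (hg.continuousOn_fderiv_slp v).continuousAt (isOpen_lowerHalfSpace.mem_nhds hx)
  have h2 : Tendsto (fun n => fderiv ℝ (slpReg (scale n)⁻¹ g) (x - scale n • outwardNormal) v)
      atTop (𝓝 0) := by
    have hlim : Tendsto (fun n => 2 * (newtC * scale n ^ 2) *
        (∫ y, ‖g y‖ ∂surfaceMeasure) * ‖v‖) atTop (𝓝 0) := by
      have := ((((tendsto_scale.pow 2).const_mul newtC).const_mul 2).mul_const
        (∫ y, ‖g y‖ ∂surfaceMeasure)).mul_const ‖v‖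
      simpa using this
    refine squeeze_zero_norm (fun n => ?_) hlim
    refine (ContinuousLinearMap.le_opNorm _ _).trans ?_
    gcongr
    have := hg.norm_fderiv_slpReg_le (inv_pos.2 (scale_pos n)) (x - scale n • outwardNormal)
    rwa [inv_pow, div_inv_eq_mul] at this
  have h1 := (hc.tendsto.comp (tendsto_sub_scale x)).sub h2
  rw [sub_zero] at h1
  refine h1.congr fun n => ?_
  rw [hg.fderiv_slpApprox n hx]
  rfl

/-- The shift maps the half-space into itself, so the main term has no larger norm than the gradient
of `slp g`. The truncation term lives at scales at least 1, where the decay is uniform. -/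
lemma IsDensity.exists_eLpNorm_fderiv_slpApprox_le (hg : IsDensity ρ g) {v : E3}
    (hL : MemLp (fun x => fderiv ℝ (slp g) x v) 2 (volume.restrict lowerHalfSpace)) :
    ∃ C : ℝ≥0∞, C ≠ ⊤ ∧ ∀ n, eLpNorm (fun x => fderiv ℝ (slpApprox n g) x v) 2
      (volume.restrict lowerHalfSpace) ≤ C := by
  obtain ⟨C, hC, hb⟩ := hg.exists_fderiv_slpReg_bound
  set D1 := eLpNorm (fun x => fderiv ℝ (slp g) x v) 2 (volume.restrict lowerHalfSpace)
  set D2 := eLpNorm (fun x : E3 => C * ‖v‖ * ((1 + ‖x‖) ^ 2)⁻¹) 2 (volume.restrict lowerHalfSpace)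
  refine ⟨D1 + D2, ENNReal.add_ne_top.2 ⟨hL.2.ne,
    ((memLp_one_add_norm.const_mul (C * ‖v‖)).restrict lowerHalfSpace).2.ne⟩, fun n => ?_⟩
  have hsub : ∀ x ∈ lowerHalfSpace, x - scale n • outwardNormal ∈ lowerHalfSpace := fun x hx => by
    have hx' : x 2 < 0 := hx
    change (x - scale n • outwardNormal) 2 < 0
    rw [sub_smul_outwardNormal_two]; linarith [scale_pos n]
  have e : eLpNorm (fun x => fderiv ℝ (slpApprox n g) x v) 2 (volume.restrict lowerHalfSpace) =
      eLpNorm ((fun x => fderiv ℝ (slp g) (x - scale n • outwardNormal) v) -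
        fun x => fderiv ℝ (slpReg (scale n)⁻¹ g) (x - scale n • outwardNormal) v) 2
        (volume.restrict lowerHalfSpace) := by
    refine eLpNorm_congr_ae ?_
    filter_upwards [ae_restrict_mem measurableSet_lowerHalfSpace] with x hx
    rw [hg.fderiv_slpApprox n hx]
    rfl
  have hm1 : AEStronglyMeasurable (fun x => fderiv ℝ (slp g) (x - scale n • outwardNormal) v)
      (volume.restrict lowerHalfSpace) :=
    ((hg.continuousOn_fderiv_slp v).comp (by fun_prop) hsub).aestronglyMeasurable
      measurableSet_lowerHalfSpace
  have hc2 : Continuous fun x => fderiv ℝ (slpReg (scale n)⁻¹ g) x v :=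
    ((hg.slpReg_contDiff (inv_pos.2 (scale_pos n))).continuous_fderiv (by simp)).clm_apply
      continuous_const
  rw [e]
  refine (eLpNorm_sub_le hm1 (hc2.comp (by fun_prop)).aestronglyMeasurable (by norm_num)).trans
    (add_le_add (eLpNorm_comp_sub_le measurableSet_lowerHalfSpace hL.1 hsub) ?_)
  refine (eLpNorm_comp_sub_le measurableSet_lowerHalfSpace hc2.aestronglyMeasurable hsub).trans ?_
  refine eLpNorm_mono fun x => ?_
  rw [Real.norm_of_nonneg (by positivity)]
  calc _ ≤ ‖fderiv ℝ (slpReg (scale n)⁻¹ g) x‖ * ‖v‖ := ContinuousLinearMap.le_opNorm _ _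
    _ ≤ C * ((1 + ‖x‖) ^ 2)⁻¹ * ‖v‖ := by
        gcongr; exact hb _ (one_le_inv_iff₀.2 ⟨scale_pos n, scale_le_one n⟩) x
    _ = _ := by ring

lemma IsDensity.exists_eLpNorm_slpApprox_le (hg : IsDensity ρ g) {r : ℝ}
    (hL : MemLp (slp g) 2 (volume.restrict (lowerHalfSpace ∩ Metric.ball 0 (r + 1)))) :
    ∃ C : ℝ≥0∞, C ≠ ⊤ ∧ ∀ n, eLpNorm (slpApprox n g) 2
      (volume.restrict (lowerHalfSpace ∩ Metric.ball 0 r)) ≤ C := by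
  have hfin : IsFiniteMeasure (volume.restrict (lowerHalfSpace ∩ Metric.ball (0 : E3) r)) :=
    ⟨by rw [Measure.restrict_apply_univ]
        exact (measure_mono inter_subset_right).trans_lt measure_ball_lt_top⟩
  set M := ∫ y, ‖g y‖ ∂surfaceMeasure
  have hM : 0 ≤ M := integral_nonneg fun _ => norm_nonneg _
  set D1 := eLpNorm (slp g) 2 (volume.restrict (lowerHalfSpace ∩ Metric.ball 0 (r + 1)))
  set D2 := eLpNorm (fun _ : E3 => 2 * M) 2 (volume.restrict (lowerHalfSpace ∩ Metric.ball 0 r))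
  refine ⟨D1 + D2, ENNReal.add_ne_top.2 ⟨hL.2.ne, (memLp_const _).2.ne⟩, fun n => ?_⟩
  have hsub : ∀ x ∈ lowerHalfSpace ∩ Metric.ball (0 : E3) r,
      x - scale n • outwardNormal ∈ lowerHalfSpace ∩ Metric.ball (0 : E3) (r + 1) := by
    intro x hx
    have hx' : x 2 < 0 := hx.1
    refine ⟨?_, ?_⟩
    · change (x - scale n • outwardNormal) 2 < 0
      rw [sub_smul_outwardNormal_two]; linarith [scale_pos n]
    · have h1 : ‖x‖ < r := by simpa using hx.2
      have h2 : ‖scale n • outwardNormal‖ ≤ 1 := by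
        rw [norm_smul, outwardNormal]
        simpa [abs_of_pos (scale_pos n)] using scale_le_one n
      rw [mem_ball_zero_iff]
      linarith [norm_sub_le x (scale n • outwardNormal)]
  have e : eLpNorm (slpApprox n g) 2 (volume.restrict (lowerHalfSpace ∩ Metric.ball 0 r)) =
      eLpNorm ((fun x => slp g (x - scale n • outwardNormal)) -
        fun x => slpReg (scale n)⁻¹ g (x - scale n • outwardNormal)) 2
        (volume.restrict (lowerHalfSpace ∩ Metric.ball 0 r)) := by
    refine eLpNorm_congr_ae ?_
    filter_upwards [ae_restrict_mem (measurableSet_lowerHalfSpace.inter measurableSet_ball)]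
      with x hx
    rw [slpApprox_eq n g (le_of_lt hx.1)]
    rfl
  have hm1 : AEStronglyMeasurable (fun x => slp g (x - scale n • outwardNormal))
      (volume.restrict (lowerHalfSpace ∩ Metric.ball 0 r)) :=
    ((hg.slp_contDiffOn (n := 1)).continuousOn.comp (by fun_prop)
      fun x hx => (hsub x hx).1).aestronglyMeasurable
      (measurableSet_lowerHalfSpace.inter measurableSet_ball)
  have hc2 : Continuous (slpReg (scale n)⁻¹ g) :=
    (hg.slpReg_contDiff (inv_pos.2 (scale_pos n))).continuous
  rw [e]
  refine (eLpNorm_sub_le hm1 (hc2.comp (by fun_prop)).aestronglyMeasurable (by norm_num)).trans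
    (add_le_add (eLpNorm_comp_sub_le (measurableSet_lowerHalfSpace.inter measurableSet_ball)
      hL.1 hsub) ?_)
  refine eLpNorm_mono fun x => ?_
  rw [Real.norm_of_nonneg (by positivity)]
  refine (hg.norm_slpReg_le (inv_pos.2 (scale_pos n)) _).trans ?_
  rw [inv_inv]
  have := scale_le_one n
  gcongr
  linarith

lemma norm_le_norm_sub_smul_outwardNormal {x : E3} (hx : x 2 = 0) (t : ℝ) :
    ‖x‖ ≤ ‖x - t • outwardNormal‖ := by
  rw [EuclideanSpace.norm_eq, EuclideanSpace.norm_eq]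
  apply Real.sqrt_le_sqrt
  simp [Fin.sum_univ_three, outwardNormal, hx]
  positivity

lemma two_newt_le_inv {ε : ℝ} (hε : 0 < ε) {x z : E3} (hz : z ≠ 0) (h : ‖z‖ ≤ ‖x‖) :
    2 * newt ε x ≤ ‖z‖⁻¹ := by
  have hz0 : 0 < ‖z‖ := norm_pos_iff.2 hz
  have hpi := Real.pi_gt_three
  calc 2 * newt ε x ≤ 2 * (1 / (4 * Real.pi * ‖x‖)) := by gcongr; exact newt_le hε _
    _ ≤ 2 * (1 / (4 * Real.pi * ‖z‖)) := by gcongr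
    _ = (2 * Real.pi)⁻¹ * ‖z‖⁻¹ := by field_simp; norm_num
    _ ≤ 1 * ‖z‖⁻¹ := by gcongr; exact inv_le_one_of_one_le₀ (by linarith)
    _ = _ := one_mul _

lemma ae_ne_surfaceMeasure (y : E3) : ∀ᵐ z ∂surfaceMeasure, y - z ≠ 0 := by
  have : ∀ᵐ z ∂surfaceMeasure, z ≠ y := by
    rw [ae_iff]; simp
  filter_upwards [this] with z hz h
  exact hz (sub_eq_zero.1 h).symm

/-- Leaving the plane vertically only increases the distance to its points, so the kernel seen from
the shifted point is dominated by `‖y - z‖⁻¹`. This is the domination, uniform in the shift and in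
`ε`, for all limits on the plane. -/
lemma norm_slpReg_sub_le_riesz {ε : ℝ} (hε : 0 < ε) {y : E3} (hy : y 2 = 0)
    (hi : Integrable (fun z => ‖y - z‖⁻¹ * ‖g z‖) surfaceMeasure) (t : ℝ) :
    ‖slpReg ε g (y - t • outwardNormal)‖ ≤ riesz g y := by
  refine norm_integral_le_of_norm_le hi ?_
  filter_upwards [ae_surfaceMeasure_mem_plane, ae_ne_surfaceMeasure y] with z hz hzy
  rw [norm_smul, Real.norm_of_nonneg (mul_nonneg zero_le_two (newt_nonneg hε _))]
  gcongr
  refine two_newt_le_inv hε hzy ?_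
  rw [sub_right_comm]
  exact norm_le_norm_sub_smul_outwardNormal (by rw [PiLp.sub_apply, hy, hz, sub_zero]) t

lemma norm_slpApprox_le_riesz (n : ℕ) {y : E3} (hy : y 2 = 0)
    (hi : Integrable (fun z => ‖y - z‖⁻¹ * ‖g z‖) surfaceMeasure) :
    ‖slpApprox n g y‖ ≤ 2 * riesz g y := by
  refine (norm_sub_le _ _).trans ?_
  have h1 := norm_slpReg_sub_le_riesz (scale_pos n) hy hi (scale n)
  have h2 := norm_slpReg_sub_le_riesz (inv_pos.2 (scale_pos n)) hy hi (scale n)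
  linarith

lemma tendsto_slp_sub_scale (hg : Integrable g surfaceMeasure) {y : E3} (hy : y 2 = 0)
    (hi : Integrable (fun z => ‖y - z‖⁻¹ * ‖g z‖) surfaceMeasure) :
    Tendsto (fun n => slp g (y - scale n • outwardNormal)) atTop (𝓝 (slp g y)) := by
  refine tendsto_integral_of_dominated_convergence (fun z => ‖y - z‖⁻¹ * ‖g z‖) (fun n => ?_) hi
    (fun n => ?_) ?_
  · exact ((by fun_prop : Measurable fun z : E3 =>
      1 / (2 * Real.pi * ‖y - scale n • outwardNormal - z‖)).aestronglyMeasurable).smul hg.1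
  · filter_upwards [ae_surfaceMeasure_mem_plane, ae_ne_surfaceMeasure y] with z hz hzy
    rw [norm_smul, Real.norm_of_nonneg (by have := Real.pi_pos; positivity)]
    gcongr
    have hz0 : 0 < ‖y - z‖ := norm_pos_iff.2 hzy
    have h1 : ‖y - z‖ ≤ ‖y - scale n • outwardNormal - z‖ := by
      rw [sub_right_comm]
      exact norm_le_norm_sub_smul_outwardNormal (by rw [PiLp.sub_apply, hy, hz, sub_zero]) _
    rw [one_div]
    gcongr
    have := Real.pi_gt_three
    nlinarith
  · filter_upwards [ae_ne_surfaceMeasure y] with z hzy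
    have hz0 : 0 < ‖y - z‖ := norm_pos_iff.2 hzy
    have hpi := Real.pi_pos
    refine Tendsto.smul_const ?_ _
    refine tendsto_const_nhds.div (((tendsto_sub_scale y).sub_const z).norm.const_mul _) ?_
    positivity

lemma IsDensity.tendsto_slpApprox_plane (hg : IsDensity ρ g) {y : E3} (hy : y 2 = 0)
    (hi : Integrable (fun z => ‖y - z‖⁻¹ * ‖g z‖) surfaceMeasure) :
    Tendsto (fun n => slpApprox n g y) atTop (𝓝 (slp g y)) := by
  have h := (tendsto_slp_sub_scale hg.int hy hi).sub
    (hg.tendsto_slpReg_scale fun n => y - scale n • outwardNormal)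
  rw [sub_zero] at h
  exact h.congr fun n => (slpApprox_eq n g hy.le).symm

end Approximation

/-! ### Identification of the trace. -/

/-- On the plane the potential is an almost everywhere limit of the continuous functions `slpApprox
n g`. -/
lemma IsDensity.aestronglyMeasurable_slp {F : Type*} [NormedAddCommGroup F] [NormedSpace ℝ F]
    {g : E3 → F} {ρ : ℝ} (hg : IsDensity ρ g) : AEStronglyMeasurable (slp g) surfaceMeasure := by
  refine aestronglyMeasurable_of_tendsto_ae atTop
    (fun n => (hg.slpApprox_contDiff n).continuous.aestronglyMeasurable) ?_
  filter_upwards [ae_surfaceMeasure_mem_plane, ae_integrable_riesz hg.int] with y hy hi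
  exact hg.tendsto_slpApprox_plane hy hi

lemma IsDensity.ae_norm_slp_le {F : Type*} [NormedAddCommGroup F] [NormedSpace ℝ F]
    {g : E3 → F} {ρ : ℝ} (hg : IsDensity ρ g) :
    ∀ᵐ y ∂surfaceMeasure, ‖slp g y‖ ≤ 2 * riesz g y := by
  filter_upwards [ae_surfaceMeasure_mem_plane, ae_integrable_riesz hg.int] with y hy hi
  exact le_of_tendsto (hg.tendsto_slpApprox_plane hy hi).norm
    (Eventually.of_forall fun n => norm_slpApprox_le_riesz n hy hi)

lemma IsDensity.locallyIntegrable_slp {F : Type*} [NormedAddCommGroup F] [NormedSpace ℝ F]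
    {g : E3 → F} {ρ : ℝ} (hg : IsDensity ρ g) : LocallyIntegrable (slp g) surfaceMeasure := by
  rw [locallyIntegrable_iff]
  intro K hK
  obtain ⟨m, hm⟩ := hK.isBounded.subset_ball (0 : E3)
  refine IntegrableOn.mono_set ?_ hm
  exact ((integrableOn_riesz hg.int m).const_mul 2).mono' hg.aestronglyMeasurable_slp.restrict
    (ae_restrict_of_ae hg.ae_norm_slp_le)

lemma memLp_two_locallyIntegrable {f : E3 → ℂ}
    (hf : ∀ r : ℝ, MemLp f 2 (surfaceMeasure.restrict (Metric.ball 0 r))) :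
    LocallyIntegrable f surfaceMeasure := by
  rw [locallyIntegrable_iff]
  intro K hK
  obtain ⟨m, hm⟩ := hK.isBounded.subset_ball (0 : E3)
  have hfin : IsFiniteMeasure (surfaceMeasure.restrict (Metric.ball (0 : E3) m)) :=
    ⟨by rw [Measure.restrict_apply_univ]
        exact (measure_mono Metric.ball_subset_closedBall).trans_lt
          (isCompact_closedBall _ _).measure_lt_top⟩
  exact IntegrableOn.mono_set ((hf m).integrable (by norm_num)) hm

section TraceAndEnergy

variable {u f g : E3 → ℂ} {G : E3 → EuclideanSpace ℂ (Fin 3)} {ρ : ℝ}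

lemma memLp_component {S : Set E3} (h : MemLp G 2 (volume.restrict S)) (i : Fin 3) :
    MemLp (fun x => G x i) 2 (volume.restrict S) :=
  h.of_le ((PiLp.continuous_apply 2 (fun _ : Fin 3 => ℂ) i).comp_aestronglyMeasurable h.1)
    (Eventually.of_forall fun x => PiLp.norm_apply_le (G x) i)

lemma memLp_fderiv_slp_of_isH1Loc (hu : IsH1Loc u G) (hd : IsDensity ρ g)
    (hG : ∀ᵐ x ∂volume.restrict lowerHalfSpace, G x = gradC (slp g) x) (i : Fin 3) :
    MemLp (fun x => fderiv ℝ (slp g) x (EuclideanSpace.single i 1)) 2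
      (volume.restrict lowerHalfSpace) := by
  refine hd.memLp_fderiv_slp ((memLp_component (hu.memLp_grad (2 * ρ)) i).ae_eq ?_)
  filter_upwards [ae_mono (Measure.restrict_mono inter_subset_left le_rfl) hG] with x hx
  rw [hx, gradC_apply]

/-- The trace of a decaying harmonic function is the boundary potential of its Neumann data. -/
theorem trace_ae_eq_slp
    (hu : IsH1Loc u G) (hf : IsTrace u G f) (hg : IsNormalDerivative G g) (hd : IsDensity ρ g)
    (h0 : Tendsto u (cocompact E3 ⊓ ae (volume.restrict lowerHalfSpace)) (𝓝 0)) :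
    ∀ᵐ y ∂surfaceMeasure, f y = slp g y := by
  have hS := ae_eq_slp hu hf hg hd h0
  have hG := ae_eq_gradC_slp hu hf hg hd h0
  have hSL : ∀ r : ℝ, MemLp (slp g) 2 (volume.restrict (lowerHalfSpace ∩ Metric.ball 0 r)) :=
    fun r => (hu.memLp r).ae_eq
      (ae_mono (Measure.restrict_mono inter_subset_left le_rfl) hS)
  have hDL := memLp_fderiv_slp_of_isH1Loc hu hd hG 2
  have key : ∀ φ : E3 → ℝ, IsTestFunction univ φ →
      ∫ y, φ y • f y ∂surfaceMeasure = ∫ y, φ y • slp g y ∂surfaceMeasure := by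
    intro φ hφ
    have hφ2 := hφ.partialDeriv 2
    have hdφ : Differentiable ℝ φ := hφ.smooth.differentiable (by simp)
    have hlhs : (∫ x in lowerHalfSpace, partialDeriv 2 φ x • slp g x) +
        (∫ x in lowerHalfSpace, φ x • fderiv ℝ (slp g) x outwardNormal) =
        ∫ y, φ y • f y ∂surfaceMeasure := by
      have h := hf.gaussGreen φ hφ 2
      have e1 : ∫ x in lowerHalfSpace, partialDeriv 2 φ x • u x =
          ∫ x in lowerHalfSpace, partialDeriv 2 φ x • slp g x := integral_congr_ae <| by
        filter_upwards [hS] with x hx; rw [hx]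
      have e2 : ∫ x in lowerHalfSpace, φ x • G x 2 =
          ∫ x in lowerHalfSpace, φ x • fderiv ℝ (slp g) x outwardNormal := integral_congr_ae <| by
        filter_upwards [hG] with x hx; rw [hx]; rfl
      rw [e1, e2] at h
      rw [h]
      simp [outwardNormal]
    obtain ⟨r, hr⟩ := hφ2.compact.isCompact.isBounded.subset_ball (0 : E3)
    have hred : ∀ w : E3 → ℂ, ∫ x in lowerHalfSpace, partialDeriv 2 φ x • w x =
        ∫ x in lowerHalfSpace ∩ Metric.ball 0 r, partialDeriv 2 φ x • w x := fun w =>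
      setIntegral_eq_of_subset_of_forall_sdiff_eq_zero measurableSet_lowerHalfSpace
        inter_subset_left fun x hx => by
          rw [image_eq_zero_of_notMem_tsupport fun h => hx.2 ⟨hx.1, hr h⟩, zero_smul]
    -- The divergence theorem holds for the smooth approximations. The interior terms pass to the
    -- limit by weak `L²` convergence and the boundary term by the majorant `riesz`; comparison with
    -- `hlhs` identifies `f`.
    have hstep : ∀ n, (∫ x in lowerHalfSpace, partialDeriv 2 φ x • slpApprox n g x) +
        (∫ x in lowerHalfSpace, φ x • fderiv ℝ (slpApprox n g) x outwardNormal) =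
        ∫ y, φ y • slpApprox n g y ∂surfaceMeasure := by
      intro n
      have hV := hd.slpApprox_contDiff n
      have hdV : Differentiable ℝ (slpApprox n g) := hV.differentiable (by simp)
      rw [← integral_lowerHalfSpace_fderiv_two (ψ := fun x => φ x • slpApprox n g x)
        ((hφ.smooth.smul hV).of_le (by simp)) hφ.compact.smul_right, ← integral_add]
      · refine integral_congr_ae (Eventually.of_forall fun x => ?_)
        simp only
        rw [fderiv_fun_smul (hdφ x) (hdV x)]
        simp [partialDeriv, outwardNormal, add_comm]
      · exact ((hφ2.smooth.continuous.smul hV.continuous).integrable_of_hasCompactSupport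
          hφ2.compact.smul_right).integrableOn
      · exact ((hφ.smooth.continuous.smul ((hV.continuous_fderiv (by simp)).clm_apply
          continuous_const)).integrable_of_hasCompactSupport hφ.compact.smul_right).integrableOn
    have hlim1 : Tendsto (fun n => ∫ x in lowerHalfSpace, partialDeriv 2 φ x • slpApprox n g x)
        atTop (𝓝 (∫ x in lowerHalfSpace, partialDeriv 2 φ x • slp g x)) := by
      simp only [hred]
      obtain ⟨C, hC, hb⟩ := hd.exists_eLpNorm_slpApprox_le (hSL (r + 1))
      refine tendsto_integral_smul_of_bounded
        ((hφ2.smooth.continuous.memLp_of_hasCompactSupport hφ2.compact).restrict _)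
        (fun n => (hd.slpApprox_contDiff n).continuous.aestronglyMeasurable) hC hb ?_
      filter_upwards [ae_restrict_mem (measurableSet_lowerHalfSpace.inter measurableSet_ball)]
        with x hx using hd.tendsto_slpApprox hx.1
    have hlim2 : Tendsto (fun n => ∫ x in lowerHalfSpace,
        φ x • fderiv ℝ (slpApprox n g) x outwardNormal)
        atTop (𝓝 (∫ x in lowerHalfSpace, φ x • fderiv ℝ (slp g) x outwardNormal)) := by
      obtain ⟨C, hC, hb⟩ := hd.exists_eLpNorm_fderiv_slpApprox_le hDL
      refine tendsto_integral_smul_of_bounded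
        ((hφ.smooth.continuous.memLp_of_hasCompactSupport hφ.compact).restrict _)
        (fun n => (((hd.slpApprox_contDiff n).continuous_fderiv (by simp)).clm_apply
          continuous_const).aestronglyMeasurable) hC hb ?_
      filter_upwards [ae_restrict_mem measurableSet_lowerHalfSpace]
        with x hx using hd.tendsto_fderiv_slpApprox _ hx
    have hlim3 : Tendsto (fun n => ∫ y, φ y • slpApprox n g y ∂surfaceMeasure)
        atTop (𝓝 (∫ y, φ y • slp g y ∂surfaceMeasure)) := by
      obtain ⟨B, hB⟩ := hφ.compact.exists_bound_of_continuous hφ.smooth.continuous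
      obtain ⟨m, hm⟩ := hφ.compact.isCompact.isBounded.subset_ball (0 : E3)
      refine tendsto_integral_of_dominated_convergence
        ((Metric.ball (0 : E3) m).indicator fun y => B * (2 * riesz g y))
        (fun n => (hφ.smooth.continuous.smul
          (hd.slpApprox_contDiff n).continuous).aestronglyMeasurable)
        ((integrable_indicator_iff measurableSet_ball).2
          (((integrableOn_riesz hd.int m).const_mul 2).const_mul B)) (fun n => ?_) ?_
      · filter_upwards [ae_surfaceMeasure_mem_plane, ae_integrable_riesz hd.int] with y hy hi
        by_cases hym : y ∈ Metric.ball (0 : E3) m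
        · rw [indicator_of_mem hym, norm_smul]
          gcongr
          · exact (norm_nonneg _).trans (hB y)
          · exact hB y
          · exact norm_slpApprox_le_riesz n hy hi
        · rw [indicator_of_notMem hym, image_eq_zero_of_notMem_tsupport fun h => hym (hm h)]
          simp
      · filter_upwards [ae_surfaceMeasure_mem_plane, ae_integrable_riesz hd.int] with y hy hi
        exact (hd.tendsto_slpApprox_plane hy hi).const_smul _
    rw [← hlhs]
    refine tendsto_nhds_unique ((hlim1.add hlim2).congr hstep) hlim3
  have hfl := memLp_two_locallyIntegrable hf.memLp
  have hsl := hd.locallyIntegrable_slp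
  have := ae_eq_zero_of_integral_contDiff_smul_eq_zero (hfl.sub hsl) fun φ h1 h2 => by
    have hφ : IsTestFunction univ φ := ⟨h1, h2, subset_univ _⟩
    simp only [Pi.sub_apply, smul_sub]
    rw [integral_sub, key φ hφ, sub_self]
    · exact hfl.integrable_smul_left_of_hasCompactSupport h1.continuous h2
    · exact hsl.integrable_smul_left_of_hasCompactSupport h1.continuous h2
  filter_upwards [this] with y hy using sub_eq_zero.1 hy

/-! ### Real densities and the energy identity. -/

/-- A real density whose single layer potential has finite Dirichlet energy and satisfies Green's
formula. -/
structure IsNeumannPotential (ρ : ℝ) (a : E3 → ℝ) : Prop where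
  dens : IsDensity ρ a
  grad_memLp : ∀ i : Fin 3, MemLp (fun x => fderiv ℝ (slp a) x (EuclideanSpace.single i 1)) 2
    (volume.restrict lowerHalfSpace)
  green : ∀ φ : E3 → ℝ, IsTestFunction univ φ →
    ∫ x in lowerHalfSpace, ∑ i, partialDeriv i φ x * fderiv ℝ (slp a) x (EuclideanSpace.single i 1)
      = ∫ y, φ y * a y ∂surfaceMeasure

/-- Together with the next lemmas, this transfers statements about the complex flux to its real and
imaginary parts, for which the energy argument is carried out. -/
lemma IsDensity.comp_clm {E F : Type*} [NormedAddCommGroup E] [NormedSpace ℝ E]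
    [NormedAddCommGroup F] [NormedSpace ℝ F] {g : E3 → E} (hd : IsDensity ρ g) (L : E →L[ℝ] F) :
    IsDensity ρ fun y => L (g y) where
  pos := hd.pos
  int := L.integrable_comp hd.int
  supp := by
    filter_upwards [hd.supp] with y hy h
    rw [hy h, map_zero]

lemma IsDensity.slpReg_comp_clm {E F : Type*} [NormedAddCommGroup E] [NormedSpace ℝ E]
    [CompleteSpace E] [NormedAddCommGroup F] [NormedSpace ℝ F] [CompleteSpace F] {g : E3 → E}
    (hd : IsDensity ρ g) (L : E →L[ℝ] F) {ε : ℝ} (hε : 0 < ε) (x : E3) :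
    slpReg ε (fun y => L (g y)) x = L (slpReg ε g x) := by
  rw [slpReg, slpReg, ← L.integral_comp_comm
    (integrable_kernel_smul hd.int (two_newt_contDiff ε).continuous (abs_two_newt_le hε) x)]
  simp

lemma IsDensity.fderiv_slp_comp_clm {E F : Type*} [NormedAddCommGroup E] [NormedSpace ℝ E]
    [CompleteSpace E] [NormedAddCommGroup F] [NormedSpace ℝ F] [CompleteSpace F] {g : E3 → E}
    (hd : IsDensity ρ g) (L : E →L[ℝ] F) {x : E3} (hx : x ∈ lowerHalfSpace) (v : E3) :
    fderiv ℝ (slp fun y => L (g y)) x v = L (fderiv ℝ (slp g) x v) := by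
  have hx' : x 2 < 0 := hx
  have hε : 0 < -(x 2) / 2 := by linarith
  rw [fderiv_slp_eq hε _ (by linarith), fderiv_slp_eq hε _ (by linarith)]
  have : slpReg (-(x 2) / 2) (fun y => L (g y)) = L ∘ slpReg (-(x 2) / 2) g := by
    ext1 z; exact hd.slpReg_comp_clm L hε z
  rw [this, (L.hasFDerivAt.comp x
    ((hd.slpReg_contDiff hε).differentiable (by simp) x).hasFDerivAt).fderiv]
  rfl

lemma ae_slp_comp_clm {E F : Type*} [NormedAddCommGroup E] [NormedSpace ℝ E]
    [CompleteSpace E] [NormedAddCommGroup F] [NormedSpace ℝ F] [CompleteSpace F] {g : E3 → E}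
    (hg : Integrable g surfaceMeasure) (L : E →L[ℝ] F) :
    ∀ᵐ y ∂surfaceMeasure, slp (fun z => L (g z)) y = L (slp g y) := by
  filter_upwards [ae_integrable_riesz hg] with y hi
  have h : Integrable (fun z => (1 / (2 * Real.pi * ‖y - z‖)) • g z) surfaceMeasure := by
    refine hi.mono' (((by fun_prop : Measurable fun z : E3 =>
      1 / (2 * Real.pi * ‖y - z‖)).aestronglyMeasurable).smul hg.1) (Eventually.of_forall fun z => ?_)
    rw [norm_smul, Real.norm_of_nonneg (by have := Real.pi_pos; positivity)]
    gcongr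
    rw [one_div, mul_inv]
    have := Real.pi_gt_three
    exact mul_le_of_le_one_left (by positivity) (inv_le_one_of_one_le₀ (by linarith))
  rw [slp, slp, ← L.integral_comp_comm h]
  simp

lemma isNeumannPotential_comp_clm (hu : IsH1Loc u G) (hg : IsNormalDerivative G g)
    (hd : IsDensity ρ g) (hG : ∀ᵐ x ∂volume.restrict lowerHalfSpace, G x = gradC (slp g) x)
    (L : ℂ →L[ℝ] ℝ) : IsNeumannPotential ρ fun y => L (g y) where
  dens := hd.comp_clm L
  grad_memLp := by
    intro i
    refine (L.comp_memLp' (memLp_fderiv_slp_of_isH1Loc hu hd hG i)).ae_eq ?_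
    filter_upwards [ae_restrict_mem measurableSet_lowerHalfSpace] with x hx
    rw [hd.fderiv_slp_comp_clm L hx]
    rfl
  green := by
    intro φ hφ
    have h := congrArg L (hg.green φ hφ)
    rw [← L.integral_comp_comm, ← L.integral_comp_comm] at h
    · simp only [map_sum, map_smul, smul_eq_mul] at h
      rw [← h]
      refine integral_congr_ae ?_
      filter_upwards [hG, ae_restrict_mem measurableSet_lowerHalfSpace] with x hx hxΩ
      refine Finset.sum_congr rfl fun i _ => ?_
      rw [hd.fderiv_slp_comp_clm L hxΩ, hx, gradC_apply]
    · obtain ⟨B, hB⟩ := hφ.compact.exists_bound_of_continuous hφ.smooth.continuous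
      exact hd.int.bdd_smul B hφ.smooth.continuous.aestronglyMeasurable (Eventually.of_forall hB)
    · refine integrable_finsetSum _ fun i _ => ?_
      exact integrable_smul_of_memLp_ball (hφ.partialDeriv i).smooth.continuous
        (hφ.partialDeriv i).compact fun r => memLp_component (hu.memLp_grad r) i

end TraceAndEnergy

/-- A smooth bounded truncation at height comparable to `N`. -/
def truncation (N s : ℝ) : ℝ := N * Real.arctan (s / N)

lemma truncation_contDiff (N : ℝ) : ContDiff ℝ ∞ (truncation N) :=
  contDiff_const.mul (Real.contDiff_arctan.comp (contDiff_id.div_const N))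

lemma truncation_zero (N : ℝ) : truncation N 0 = 0 := by simp [truncation]

lemma hasDerivAt_truncation {N : ℝ} (hN : N ≠ 0) (s : ℝ) :
    HasDerivAt (truncation N) (1 / (1 + (s / N) ^ 2)) s := by
  have h := (((hasDerivAt_id s).div_const N).arctan).const_mul N
  refine h.congr_deriv ?_
  simp only [id]
  field_simp

lemma partialDeriv_truncation {N : ℝ} (hN : N ≠ 0) {V : E3 → ℝ} (hV : ContDiff ℝ ∞ V) (i : Fin 3)
    (x : E3) : partialDeriv i (fun x => truncation N (V x)) x =
      1 / (1 + (V x / N) ^ 2) * fderiv ℝ V x (EuclideanSpace.single i 1) := by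
  have h1 := (hasDerivAt_truncation hN (V x)).comp_hasFDerivAt x
    (hV.differentiable (by simp) x).hasFDerivAt
  change fderiv ℝ (truncation N ∘ V) x (EuclideanSpace.single i 1) = _
  rw [h1.fderiv, _root_.smul_apply, smul_eq_mul]

lemma abs_truncation_le_const {N : ℝ} (hN : 0 < N) (s : ℝ) : |truncation N s| ≤ 2 * N := by
  rw [truncation, abs_mul, abs_of_pos hN, mul_comm]
  gcongr
  have h1 := Real.neg_pi_div_two_lt_arctan (s / N)
  have h2 := Real.arctan_lt_pi_div_two (s / N)
  have h3 := Real.pi_lt_four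
  rw [abs_le]
  constructor <;> linarith

lemma abs_truncation_le {N : ℝ} (hN : 0 < N) (s : ℝ) : |truncation N s| ≤ |s| := by
  have h : ∀ x ∈ (univ : Set ℝ), ‖1 / (1 + (x / N) ^ 2)‖ ≤ 1 := fun x _ => by
    rw [Real.norm_of_nonneg (by positivity), div_le_one (by positivity)]
    nlinarith [sq_nonneg (x / N)]
  have := convex_univ.norm_image_sub_le_of_norm_hasDerivWithin_le
    (fun x _ => (hasDerivAt_truncation hN.ne' x).hasDerivWithinAt) h (mem_univ 0) (mem_univ s)
  simpa [truncation_zero] using this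

lemma tendsto_truncation (s : ℝ) :
    Tendsto (fun n : ℕ => truncation ((n : ℝ) + 1) s) atTop (𝓝 s) := by
  have h1 : HasDerivAt (fun t : ℝ => Real.arctan (s * t)) s 0 := by
    have h := ((hasDerivAt_id (0 : ℝ)).const_mul s).arctan
    refine h.congr_deriv ?_
    simp
  have h2 := (hasDerivAt_iff_tendsto_slope_zero.1 h1).comp
    (tendsto_nhdsWithin_iff.2 ⟨tendsto_scale, Eventually.of_forall fun n => (scale_pos n).ne'⟩)
  refine h2.congr fun n => ?_
  simp [truncation, scale, div_eq_mul_inv]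

/-- The energy identity for single layer potentials. -/
theorem IsNeumannPotential.energy_identity {a : E3 → ℝ} {ρ : ℝ} (h : IsNeumannPotential ρ a)
    (hint : Integrable (fun y => slp a y * a y) surfaceMeasure) :
    ∑ i, ∫ x in lowerHalfSpace, (fderiv ℝ (slp a) x (EuclideanSpace.single i 1)) ^ 2
      = ∫ y, slp a y * a y ∂surfaceMeasure := by
  have hd := h.dens
  set D : Fin 3 → E3 → ℝ := fun i x => fderiv ℝ (slp a) x (EuclideanSpace.single i 1)
  have hD : ∀ i, MemLp (D i) 2 (volume.restrict lowerHalfSpace) := h.grad_memLp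
  have hVm : AEStronglyMeasurable (slp a) (volume.restrict lowerHalfSpace) :=
    (hd.slp_contDiffOn (n := 1)).continuousOn.aestronglyMeasurable measurableSet_lowerHalfSpace
  have hT'1 : ∀ N s : ℝ, |1 / (1 + (s / N) ^ 2)| ≤ 1 := fun N s => by
    rw [abs_of_nonneg (by positivity), div_le_one (by positivity)]
    nlinarith [sq_nonneg (s / N)]
  have hT'c : ∀ N : ℝ, Continuous fun s : ℝ => 1 / (1 + (s / N) ^ 2) := fun N =>
    continuous_const.div (by fun_prop) fun s => by positivity
  -- Green's formula is tested with the truncation of `slpApprox n a`. Its boundedness in `n` allows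
  -- the limit on the plane although `a` is only integrable.
  have step : ∀ N : ℝ, 0 < N →
      ∑ i, ∫ x in lowerHalfSpace, D i x • (1 / (1 + (slp a x / N) ^ 2) * D i x) =
        ∫ y, truncation N (slp a y) * a y ∂surfaceMeasure := by
    intro N hN
    have htest : ∀ n, IsTestFunction univ fun x => truncation N (slpApprox n a x) := fun n =>
      ⟨(truncation_contDiff N).comp (hd.slpApprox_contDiff n),
        HasCompactSupport.comp_left (g := truncation N) (hd.slpApprox_hasCompactSupport n)
          (truncation_zero N), subset_univ _⟩
    have hcont : ∀ n i, Continuous fun x => 1 / (1 + (slpApprox n a x / N) ^ 2) *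
          fderiv ℝ (slpApprox n a) x (EuclideanSpace.single i 1) := fun n i =>
      ((hT'c N).comp (hd.slpApprox_contDiff n).continuous).mul
        (((hd.slpApprox_contDiff n).continuous_fderiv (by simp)).clm_apply continuous_const)
    have hgreen : ∀ n, ∑ i, ∫ x in lowerHalfSpace, D i x • (1 / (1 + (slpApprox n a x / N) ^ 2) *
          fderiv ℝ (slpApprox n a) x (EuclideanSpace.single i 1)) =
        ∫ y, truncation N (slpApprox n a y) * a y ∂surfaceMeasure := by
      intro n
      rw [← h.green _ (htest n), ← integral_finsetSum]
      · refine integral_congr_ae (Eventually.of_forall fun x => ?_)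
        refine Finset.sum_congr rfl fun i _ => ?_
        rw [partialDeriv_truncation hN.ne' (hd.slpApprox_contDiff n), smul_eq_mul, mul_comm]
      · intro i _
        have hcs : HasCompactSupport fun x => 1 / (1 + (slpApprox n a x / N) ^ 2) *
            fderiv ℝ (slpApprox n a) x (EuclideanSpace.single i 1) :=
          ((hd.slpApprox_hasCompactSupport n).fderiv_apply (𝕜 := ℝ) _).mul_left
        exact memLp_one_iff_integrable.1 (MemLp.smul
          (((hcont n i).memLp_of_hasCompactSupport (p := 2) hcs).restrict _) (hD i))
    have hl : Tendsto (fun n => ∑ i, ∫ x in lowerHalfSpace,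
        D i x • (1 / (1 + (slpApprox n a x / N) ^ 2) *
          fderiv ℝ (slpApprox n a) x (EuclideanSpace.single i 1))) atTop
        (𝓝 (∑ i, ∫ x in lowerHalfSpace, D i x • (1 / (1 + (slp a x / N) ^ 2) * D i x))) := by
      refine tendsto_finsetSum _ fun i _ => ?_
      obtain ⟨C, hC, hb⟩ := hd.exists_eLpNorm_fderiv_slpApprox_le (hD i)
      refine tendsto_integral_smul_of_bounded (hD i)
        (fun n => (hcont n i).aestronglyMeasurable) hC (fun n => ?_) ?_
      · refine (eLpNorm_mono fun x => ?_).trans (hb n)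
        rw [norm_mul]
        exact mul_le_of_le_one_left (norm_nonneg _) (hT'1 _ _)
      · filter_upwards [ae_restrict_mem measurableSet_lowerHalfSpace] with x hx
        exact (((hT'c N).tendsto _).comp (hd.tendsto_slpApprox hx)).mul
          (hd.tendsto_fderiv_slpApprox _ hx)
    have hr : Tendsto (fun n => ∫ y, truncation N (slpApprox n a y) * a y ∂surfaceMeasure) atTop
        (𝓝 (∫ y, truncation N (slp a y) * a y ∂surfaceMeasure)) := by
      refine tendsto_integral_of_dominated_convergence (fun y => 2 * N * ‖a y‖) (fun n => ?_)
        (hd.int.norm.const_mul _) (fun n => Eventually.of_forall fun y => ?_) ?_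
      · exact (htest n).smooth.continuous.aestronglyMeasurable.mul hd.int.1
      · rw [norm_mul]
        gcongr
        exact abs_truncation_le_const hN _
      · filter_upwards [ae_surfaceMeasure_mem_plane, ae_integrable_riesz hd.int] with y hy hi
        exact (((truncation_contDiff N).continuous.tendsto _).comp
          (hd.tendsto_slpApprox_plane hy hi)).mul_const _
    exact tendsto_nhds_unique (hl.congr hgreen) hr
  -- The truncation is now removed: its derivative tends to 1 and is at most 1, and `|truncation N
  -- s| ≤ |s|` lets `hint` dominate the boundary integral.
  have hl : Tendsto (fun n : ℕ => ∑ i, ∫ x in lowerHalfSpace,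
      D i x • (1 / (1 + (slp a x / ((n : ℝ) + 1)) ^ 2) * D i x)) atTop
      (𝓝 (∑ i, ∫ x in lowerHalfSpace, D i x ^ 2)) := by
    refine tendsto_finsetSum _ fun i _ => ?_
    refine tendsto_integral_of_dominated_convergence (fun x => D i x ^ 2) (fun n => ?_)
      (hD i).integrable_sq (fun n => Eventually.of_forall fun x => ?_)
      (Eventually.of_forall fun x => ?_)
    · exact (hD i).1.smul (((hT'c _).comp_aestronglyMeasurable hVm).mul (hD i).1)
    · rw [smul_eq_mul, norm_mul, norm_mul, mul_left_comm, ← sq_abs (D i x), ← Real.norm_eq_abs,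
        sq ‖D i x‖]
      exact mul_le_of_le_one_left (by positivity) (hT'1 _ _)
    · have h1 : Tendsto (fun n : ℕ => slp a x / ((n : ℝ) + 1)) atTop (𝓝 0) := by
        have := tendsto_scale.const_mul (slp a x)
        simpa [scale, div_eq_mul_inv] using this
      have h2 : Tendsto (fun n : ℕ => 1 / (1 + (slp a x / ((n : ℝ) + 1)) ^ 2)) atTop (𝓝 1) := by
        have := ((hT'c 1).tendsto 0).comp h1
        simpa [Function.comp_def] using this
      have := (h2.mul_const (D i x)).const_mul (D i x)
      simpa [sq] using this
  have hr : Tendsto (fun n : ℕ => ∫ y, truncation ((n : ℝ) + 1) (slp a y) * a y ∂surfaceMeasure)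
      atTop (𝓝 (∫ y, slp a y * a y ∂surfaceMeasure)) := by
    refine tendsto_integral_of_dominated_convergence (fun y => ‖slp a y * a y‖) (fun n => ?_)
      hint.norm (fun n => Eventually.of_forall fun y => ?_) (Eventually.of_forall fun y => ?_)
    · exact ((truncation_contDiff _).continuous.comp_aestronglyMeasurable
        hd.aestronglyMeasurable_slp).mul hd.int.1
    · rw [norm_mul, norm_mul]
      gcongr
      exact abs_truncation_le (by positivity) _
    · exact (tendsto_truncation _).mul_const _
  exact tendsto_nhds_unique (hl.congr fun n => step _ (by positivity)) hr

/-! ### Disk means and the Dirichlet energy along spreading rays. -/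

lemma lintegral_comp_add_smul {E : Type*} [NormedAddCommGroup E] [NormedSpace ℝ E]
    [FiniteDimensional ℝ E] [MeasurableSpace E] [BorelSpace E] (μ : Measure E) [μ.IsAddHaarMeasure]
    {f : E → ℝ≥0∞} (hf : Measurable f) (c : E) {r : ℝ} (hr : r ≠ 0) :
    ∫⁻ x, f (c + r • x) ∂μ = ENNReal.ofReal |(r ^ Module.finrank ℝ E)⁻¹| * ∫⁻ x, f x ∂μ := by
  have h1 : ∫⁻ x, f (c + r • x) ∂μ = ∫⁻ x, f (c + x) ∂(Measure.map (r • ·) μ) := by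
    have := lintegral_map (μ := μ) (f := fun x => f (c + x)) (hf.comp (measurable_const_add c))
      (measurable_const_smul r)
    exact this.symm
  rw [h1, Measure.map_addHaar_smul μ hr, lintegral_smul_measure, lintegral_add_left_eq_self,
    smul_eq_mul]

lemma abs_clm_apply_le (L : E3 →L[ℝ] ℝ) (w : E3) :
    |L w| ≤ ‖w‖ * √(∑ i, L (EuclideanSpace.single i 1) ^ 2) := by
  have hw : L w = ∑ i, w i * L (EuclideanSpace.single i 1) := by
    conv_lhs => rw [← (EuclideanSpace.basisFun (Fin 3) ℝ).sum_repr w]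
    simp
  apply abs_le_of_sq_le_sq _ (by positivity)
  rw [hw, mul_pow, Real.sq_sqrt (by positivity), EuclideanSpace.real_norm_sq_eq]
  exact Finset.sum_mul_sq_le_sq_mul_sq _ _ _

section Rays

variable {a : E3 → ℝ} {ρ : ℝ}

/-- The squared norm of the gradient of the single layer potential. -/
def gradSq (a : E3 → ℝ) (x : E3) : ℝ := ∑ i, fderiv ℝ (slp a) x (EuclideanSpace.single i 1) ^ 2

lemma gradSq_nonneg (a : E3 → ℝ) (x : E3) : 0 ≤ gradSq a x :=
  Finset.sum_nonneg fun _ _ => sq_nonneg _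

lemma measurable_gradSq (a : E3 → ℝ) : Measurable (gradSq a) :=
  Finset.measurable_sum _ fun _ _ => (measurable_fderiv_apply_const ℝ _ _).pow_const 2

lemma IsDensity.abs_slp_le (hg : IsDensity ρ a) {x : E3} {t : ℝ} (ht : 0 < t) (hx : x 2 ≤ -t) :
    |slp a x| ≤ 2 * t⁻¹ * ∫ y, ‖a y‖ ∂surfaceMeasure := by
  rw [slp_eq_slpReg ht a hx]
  exact hg.norm_slpReg_le ht x

lemma IsDensity.norm_fderiv_slp_le (hg : IsDensity ρ a) {x : E3} {t : ℝ} (ht : 0 < t)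
    (hx : x 2 ≤ -t) :
    ‖fderiv ℝ (slp a) x‖ ≤ 8 * newtC * (∫ y, ‖a y‖ ∂surfaceMeasure) / t ^ 2 := by
  rw [fderiv_slp_eq (half_pos ht) a (by linarith)]
  refine (hg.norm_fderiv_slpReg_le (half_pos ht) x).trans (le_of_eq ?_)
  field_simp
  ring

/-- The expanding downward rays starting from a disk at depth `t`. -/
def ray (q : EuclideanSpace ℝ (Fin 2)) (h t : ℝ) (η : EuclideanSpace ℝ (Fin 2)) (τ : ℝ) : E3 :=
  planeProd (q + (1 + τ) • η, -(t + h * τ))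

lemma ray_apply_two (q : EuclideanSpace ℝ (Fin 2)) (h t : ℝ) (η : EuclideanSpace ℝ (Fin 2)) (τ : ℝ) :
    ray q h t η τ 2 = -(t + h * τ) := rfl

lemma hasDerivAt_ray (q : EuclideanSpace ℝ (Fin 2)) (h t : ℝ) (η : EuclideanSpace ℝ (Fin 2)) (τ : ℝ) :
    HasDerivAt (ray q h t η) (planeProd (η, -h)) τ := by
  have e : ray q h t η = fun τ : ℝ => planeProd (q + η, -t) + τ • planeProd (η, -h) := by
    ext τ i
    fin_cases i <;> simp [ray, planeProd] <;> ring
  rw [e]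
  simpa using ((hasDerivAt_id τ).smul_const (planeProd (η, -h))).const_add (planeProd (q + η, -t))

lemma norm_planeProd_le {η : EuclideanSpace ℝ (Fin 2)} {h : ℝ} (hh : 0 < h) (hη : ‖η‖ ≤ h) :
    ‖planeProd (η, -h)‖ ≤ 2 * h := by
  rw [planeProd_eq]
  refine (norm_add_le _ _).trans ?_
  have h1 : ‖boundaryEmb η‖ = ‖η‖ := by
    have := norm_boundaryEmb_sub η 0
    have h0 : boundaryEmb 0 = 0 := by ext i; fin_cases i <;> simp [boundaryEmb]
    simpa [h0] using this
  rw [h1, norm_smul, outwardNormal]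
  simp only [norm_neg, PiLp.norm_single, norm_one, mul_one, Real.norm_of_nonneg hh.le]
  linarith

/-- The potential tends to 0 along the ray, so its initial value is minus the integral of its
derivative; the direction of the ray has length at most `2h`. -/
lemma IsDensity.abs_slp_ray_le (hg : IsDensity ρ a) (q : EuclideanSpace ℝ (Fin 2)) {h t : ℝ}
    (hh : 0 < h) (ht : 0 < t) {η : EuclideanSpace ℝ (Fin 2)} (hη : ‖η‖ ≤ h) :
    ‖slp a (ray q h t η 0)‖ₑ ≤ ENNReal.ofReal (2 * h) *
      ∫⁻ τ in Ioi (0 : ℝ), ENNReal.ofReal √(gradSq a (ray q h t η τ)) := by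
  have hM : 0 ≤ ∫ y, ‖a y‖ ∂surfaceMeasure := integral_nonneg fun _ => norm_nonneg _
  set M := ∫ y, ‖a y‖ ∂surfaceMeasure
  set w := planeProd (η, -h)
  have hmem : ∀ τ : ℝ, 0 ≤ τ → ray q h t η τ ∈ lowerHalfSpace := fun τ hτ => by
    change ray q h t η τ 2 < 0
    rw [ray_apply_two]
    have : 0 ≤ h * τ := by positivity
    linarith
  have hder : ∀ τ : ℝ, 0 ≤ τ → HasDerivAt (fun τ => slp a (ray q h t η τ))
      (fderiv ℝ (slp a) (ray q h t η τ) w) τ := fun τ hτ =>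
    ((hg.slp_contDiffAt (hmem τ hτ)).differentiableAt (by simp)).hasFDerivAt.comp_hasDerivAt τ
      (hasDerivAt_ray q h t η τ)
  have hint : IntegrableOn (fun τ => fderiv ℝ (slp a) (ray q h t η τ) w) (Ioi 0) := by
    -- This gives `(t + hτ)² ≥ c²(1 + τ²)`, and the depth bound on the gradient becomes an
    -- integrable majorant in `τ`.
    set c := min t h
    have hc : 0 < c := lt_min ht hh
    refine Integrable.mono' (g := fun τ : ℝ => 8 * newtC * M * ‖w‖ / c ^ 2 * (1 + τ ^ 2)⁻¹)
      ((integrable_inv_one_add_sq.const_mul _).integrableOn) ?_ ?_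
    · have hray : Continuous (ray q h t η) :=
        continuous_iff_continuousAt.2 fun τ => (hasDerivAt_ray q h t η τ).continuousAt
      exact ((hg.continuousOn_fderiv_slp w).comp hray.continuousOn
        fun τ (hτ : 0 < τ) => hmem τ hτ.le).aestronglyMeasurable measurableSet_Ioi
    · filter_upwards [ae_restrict_mem measurableSet_Ioi] with τ hτ
      have hτ0 : (0 : ℝ) < τ := hτ
      have h1 : 0 < t + h * τ := by positivity
      have h2 := hg.norm_fderiv_slp_le h1 (x := ray q h t η τ) (by rw [ray_apply_two])
      have h3 : c ^ 2 * (1 + τ ^ 2) ≤ (t + h * τ) ^ 2 := by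
        have ht' : c ^ 2 ≤ t ^ 2 := by gcongr; exact min_le_left _ _
        have hh' : c ^ 2 ≤ h ^ 2 := by gcongr; exact min_le_right _ _
        have h4 : c ^ 2 * τ ^ 2 ≤ h ^ 2 * τ ^ 2 := by gcongr
        have h5 : 0 ≤ t * (h * τ) := by positivity
        nlinarith
      have hC := newtC_pos
      calc _ ≤ ‖fderiv ℝ (slp a) (ray q h t η τ)‖ * ‖w‖ := ContinuousLinearMap.le_opNorm _ _
        _ ≤ 8 * newtC * M / (c ^ 2 * (1 + τ ^ 2)) * ‖w‖ := by
            gcongr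
            refine h2.trans ?_
            gcongr
        _ = _ := by field_simp
  have hlim : Tendsto (fun τ => slp a (ray q h t η τ)) atTop (𝓝 0) := by
    have h1 : Tendsto (fun τ : ℝ => 2 * (t + h * τ)⁻¹ * M) atTop (𝓝 0) := by
      have h2 : Tendsto (fun τ : ℝ => t + h * τ) atTop atTop :=
        tendsto_atTop_add_const_left _ _ (tendsto_id.const_mul_atTop hh)
      simpa using (h2.inv_tendsto_atTop.const_mul 2).mul_const M
    refine squeeze_zero_norm' ?_ h1
    filter_upwards [eventually_ge_atTop 0] with τ hτ
    exact hg.abs_slp_le (by positivity) (by rw [ray_apply_two])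
  have hftc := integral_Ioi_of_hasDerivAt_of_tendsto (hder 0 le_rfl).continuousAt.continuousWithinAt
    (fun τ (hτ : 0 < τ) => hder τ hτ.le) hint hlim
  have e : ‖slp a (ray q h t η 0)‖ₑ = ‖∫ τ in Ioi (0 : ℝ), fderiv ℝ (slp a) (ray q h t η τ) w‖ₑ := by
    rw [hftc, zero_sub, enorm_neg]
  rw [e]
  refine (enorm_integral_le_lintegral_enorm _).trans ?_
  have hray : Continuous (ray q h t η) :=
    continuous_iff_continuousAt.2 fun τ => (hasDerivAt_ray q h t η τ).continuousAt
  have hms : Measurable fun τ => ENNReal.ofReal √(gradSq a (ray q h t η τ)) :=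
    ((measurable_gradSq a).comp hray.measurable).sqrt.ennreal_ofReal
  rw [← lintegral_const_mul _ hms]
  refine lintegral_mono fun τ => ?_
  rw [← ENNReal.ofReal_mul (by positivity), ← ofReal_norm, Real.norm_eq_abs]
  refine ENNReal.ofReal_le_ofReal ((abs_clm_apply_le _ _).trans ?_)
  gcongr
  · exact norm_planeProd_le hh hη
  · exact le_of_eq rfl

lemma ray_continuous (q : EuclideanSpace ℝ (Fin 2)) (h t : ℝ) :
    Continuous fun r : EuclideanSpace ℝ (Fin 2) × ℝ => ray q h t r.1 r.2 := by
  unfold ray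
  exact planeProd_continuous.comp (by fun_prop)

/-- The weighted energy along the rays is bounded by the Dirichlet energy. -/
lemma lintegral_rays_le (a : E3 → ℝ) (q : EuclideanSpace ℝ (Fin 2)) {h t : ℝ} (hh : 0 < h)
    (ht : 0 ≤ t) :
    ∫⁻ τ in Ioi (0 : ℝ), ∫⁻ η in Metric.ball (0 : EuclideanSpace ℝ (Fin 2)) h,
        ENNReal.ofReal ((1 + τ) ^ 2) * ENNReal.ofReal (gradSq a (ray q h t η τ)) ≤
      ENNReal.ofReal h⁻¹ * ∫⁻ x in lowerHalfSpace, ENNReal.ofReal (gradSq a x) := by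
  have hm : Measurable fun x => ENNReal.ofReal (gradSq a x) := (measurable_gradSq a).ennreal_ofReal
  set Ψ : ℝ → ℝ≥0∞ := fun s => ∫⁻ y, ENNReal.ofReal (gradSq a (planeProd (y, s)))
  have hΨ : Measurable Ψ := (hm.comp planeProd_continuous.measurable).lintegral_prod_left'
  have h1 : ∀ τ ∈ Ioi (0 : ℝ), ∫⁻ η in Metric.ball (0 : EuclideanSpace ℝ (Fin 2)) h,
      ENNReal.ofReal ((1 + τ) ^ 2) * ENNReal.ofReal (gradSq a (ray q h t η τ)) ≤
        (Iio (0 : ℝ)).indicator Ψ (-t + (-h) • τ) := by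
    intro τ hτ
    have hτ0 : (0 : ℝ) < τ := hτ
    have e1 : -t + (-h) • τ = -(t + h * τ) := by rw [smul_eq_mul]; ring
    have hneg : -(t + h * τ) ∈ Iio (0 : ℝ) := by
      have : 0 < h * τ := by positivity
      simp only [mem_Iio]; linarith
    rw [e1, indicator_of_mem hneg]
    have hms : Measurable fun y : EuclideanSpace ℝ (Fin 2) =>
        ENNReal.ofReal (gradSq a (planeProd (y, -(t + h * τ)))) :=
      hm.comp (planeProd_continuous.measurable.comp (by fun_prop))
    refine (setLIntegral_le_lintegral _ _).trans ?_
    have h2 := lintegral_comp_add_smul volume hms q (r := 1 + τ) (by positivity)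
    rw [lintegral_const_mul]
    · have h3 : ∫⁻ η, ENNReal.ofReal (gradSq a (ray q h t η τ)) = _ := h2
      rw [h3, ← mul_assoc, ← ENNReal.ofReal_mul (by positivity)]
      -- The weight is exactly the Jacobian of the planar dilation by `1 + τ`, so the slice becomes
      -- a plain integral over a horizontal plane.
      have : (1 + τ) ^ 2 * |((1 + τ) ^ Module.finrank ℝ (EuclideanSpace ℝ (Fin 2)))⁻¹| = 1 := by
        simp only [finrank_euclideanSpace, Fintype.card_fin]
        rw [abs_of_pos (by positivity)]
        field_simp
      rw [this, ENNReal.ofReal_one, one_mul]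
    · exact hms.comp (by fun_prop : Measurable fun η : EuclideanSpace ℝ (Fin 2) => q + (1 + τ) • η)
  refine (setLIntegral_mono (((hΨ.indicator measurableSet_Iio)).comp (by fun_prop)) h1).trans ?_
  refine (setLIntegral_le_lintegral _ _).trans (le_of_eq ?_)
  -- The substitution `s = -t - hτ` in depth produces the factor `h⁻¹`.
  have h2 := lintegral_comp_add_smul volume (hΨ.indicator (measurableSet_Iio (a := (0 : ℝ)))) (-t)
    (neg_ne_zero.2 hh.ne')
  refine h2.trans ?_
  rw [lintegral_indicator measurableSet_Iio, setLIntegral_lowerHalfSpace_eq hm]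
  congr 2
  simp [abs_of_pos hh]

/-- Cauchy-Schwarz with the weights `(1 + τ)⁻¹` and `1 + τ`. The first has squared integral equal to
the area of the disk, because `∫ (1 + τ)⁻² dτ = 1`; the second is the weighted energy of
`lintegral_rays_le`. -/
lemma IsDensity.lintegral_slp_disk_le (hg : IsDensity ρ a) (q : EuclideanSpace ℝ (Fin 2)) {h t : ℝ}
    (hh : 0 < h) (ht : 0 < t) :
    ∫⁻ η in Metric.ball (0 : EuclideanSpace ℝ (Fin 2)) h, ‖slp a (ray q h t η 0)‖ₑ ≤
      ENNReal.ofReal (2 * h) * (ENNReal.ofReal (Real.pi * h ^ 2) ^ (1 / 2 : ℝ) *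
        (ENNReal.ofReal h⁻¹ * ∫⁻ x in lowerHalfSpace, ENNReal.ofReal (gradSq a x)) ^ (1 / 2 : ℝ)) := by
  have hm : Measurable fun x => ENNReal.ofReal (gradSq a x) := (measurable_gradSq a).ennreal_ofReal
  set B := Metric.ball (0 : EuclideanSpace ℝ (Fin 2)) h
  set ν := (volume.restrict B).prod (volume.restrict (Ioi (0 : ℝ)))
  set f : EuclideanSpace ℝ (Fin 2) × ℝ → ℝ≥0∞ := fun r => ENNReal.ofReal (1 + r.2)⁻¹
  set k : EuclideanSpace ℝ (Fin 2) × ℝ → ℝ≥0∞ := fun r =>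
    ENNReal.ofReal (1 + r.2) * ENNReal.ofReal √(gradSq a (ray q h t r.1 r.2))
  have hf : Measurable f := by fun_prop
  have hk : Measurable k :=
    ((measurable_const.add measurable_snd).ennreal_ofReal).mul
      ((((measurable_gradSq a).comp (ray_continuous q h t).measurable).sqrt).ennreal_ofReal)
  have hS : Measurable fun r : EuclideanSpace ℝ (Fin 2) × ℝ =>
      ENNReal.ofReal √(gradSq a (ray q h t r.1 r.2)) :=
    ((measurable_gradSq a).comp (ray_continuous q h t).measurable).sqrt.ennreal_ofReal
  have hpos : ∀ᵐ r ∂ν, 0 < r.2 := by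
    have h1 : ∀ᵐ τ ∂volume.restrict (Ioi (0 : ℝ)), 0 < τ := ae_restrict_mem measurableSet_Ioi
    exact (Measure.quasiMeasurePreserving_snd (μ := volume.restrict B)).ae h1
  have hfv : ∫⁻ r, f r ^ (2 : ℝ) ∂ν = ENNReal.ofReal (Real.pi * h ^ 2) := by
    have e : ∀ τ ∈ Ioi (0 : ℝ), ENNReal.ofReal (1 + τ)⁻¹ ^ (2 : ℝ) =
        ENNReal.ofReal ((1 + τ) ^ (-2 : ℝ)) := by
      intro τ hτ
      have hτ0 : (0 : ℝ) < τ := hτ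
      rw [ENNReal.ofReal_rpow_of_pos (by positivity), Real.inv_rpow (by positivity),
        Real.rpow_neg (by positivity)]
    have hI : ∫⁻ τ in Ioi (0 : ℝ), ENNReal.ofReal (1 + τ)⁻¹ ^ (2 : ℝ) = 1 := by
      rw [setLIntegral_congr_fun measurableSet_Ioi e]
      have hder : ∀ τ ∈ Ici (0 : ℝ), HasDerivAt (fun τ : ℝ => -(1 + τ)⁻¹) ((1 + τ) ^ (-2 : ℝ)) τ := by
        intro τ hτ
        have hτ0 : (0 : ℝ) ≤ τ := hτ
        have h1 := (((hasDerivAt_id τ).const_add 1).inv (by simp only [id]; positivity)).neg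
        refine h1.congr_deriv ?_
        rw [Real.rpow_neg (by positivity), Real.rpow_two]
        simp [div_eq_mul_inv]
      have hl : Tendsto (fun τ : ℝ => -(1 + τ)⁻¹) atTop (𝓝 0) := by
        have : Tendsto (fun τ : ℝ => 1 + τ) atTop atTop :=
          tendsto_atTop_add_const_left _ _ tendsto_id
        simpa using this.inv_tendsto_atTop.neg
      have hnn : ∀ τ ∈ Ioi (0 : ℝ), (0 : ℝ) ≤ (1 + τ) ^ (-2 : ℝ) := fun τ hτ => by
        have hτ0 : (0 : ℝ) < τ := hτ
        positivity
      rw [← ofReal_integral_eq_lintegral_ofReal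
        (integrableOn_Ioi_deriv_of_nonneg' hder hnn hl)
        ((ae_restrict_iff' measurableSet_Ioi).2 (Eventually.of_forall hnn)),
        integral_Ioi_of_hasDerivAt_of_nonneg' hder hnn hl]
      simp
    rw [lintegral_prod _ (hf.pow_const _).aemeasurable]
    simp only [f, hI, lintegral_const, one_mul, Measure.restrict_apply_univ]
    rw [EuclideanSpace.volume_ball_fin_two, ← ENNReal.ofReal_pow hh.le,
      ← ENNReal.ofReal_mul (by positivity), mul_comm]
  have hkv : ∫⁻ r, k r ^ (2 : ℝ) ∂ν ≤
      ENNReal.ofReal h⁻¹ * ∫⁻ x in lowerHalfSpace, ENNReal.ofReal (gradSq a x) := by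
    rw [lintegral_prod_symm _ (hk.pow_const _).aemeasurable]
    refine le_trans (lintegral_mono_ae ?_) (lintegral_rays_le a q hh ht.le)
    filter_upwards [ae_restrict_mem measurableSet_Ioi] with τ hτ
    have hτ0 : (0 : ℝ) < τ := hτ
    refine lintegral_mono fun η => le_of_eq ?_
    simp only [k]
    rw [ENNReal.rpow_two, mul_pow, ← ENNReal.ofReal_pow (by positivity),
      ← ENNReal.ofReal_pow (by positivity), Real.sq_sqrt (gradSq_nonneg _ _)]
  calc ∫⁻ η in B, ‖slp a (ray q h t η 0)‖ₑ
      ≤ ∫⁻ η in B, ENNReal.ofReal (2 * h) *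
          ∫⁻ τ in Ioi (0 : ℝ), ENNReal.ofReal √(gradSq a (ray q h t η τ)) := by
        refine setLIntegral_mono' measurableSet_ball fun η hη => ?_
        exact hg.abs_slp_ray_le q hh ht (by simpa [B] using (mem_ball_zero_iff.1 hη).le)
    _ = ENNReal.ofReal (2 * h) * ∫⁻ r, ENNReal.ofReal √(gradSq a (ray q h t r.1 r.2)) ∂ν := by
        rw [lintegral_const_mul _ hS.lintegral_prod_right', lintegral_prod _ hS.aemeasurable]
    _ = ENNReal.ofReal (2 * h) * ∫⁻ r, (f * k) r ∂ν := by
        congr 1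
        refine lintegral_congr_ae ?_
        filter_upwards [hpos] with r hr
        simp only [Pi.mul_apply, f, k]
        rw [← mul_assoc, ← ENNReal.ofReal_mul (by positivity),
          inv_mul_cancel₀ (by positivity), ENNReal.ofReal_one, one_mul]
    _ ≤ _ := by
        gcongr
        refine (ENNReal.lintegral_mul_le_Lp_mul_Lq ν Real.HolderConjugate.two_two
          hf.aemeasurable hk.aemeasurable).trans ?_
        rw [hfv]
        gcongr

lemma ray_zero (q : EuclideanSpace ℝ (Fin 2)) (h t : ℝ) (η : EuclideanSpace ℝ (Fin 2)) :
    ray q h t η 0 = boundaryEmb (q + η) - t • outwardNormal := by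
  rw [ray, planeProd_eq]
  simp [sub_eq_add_neg]

/-- The mean of the boundary values over a disk is controlled by the Dirichlet energy. -/
theorem IsNeumannPotential.sq_integral_electrode_le (ha : IsNeumannPotential ρ a) {p : E3}
    (hp : p 2 = 0) {h : ℝ} (hh : 0 < h) :
    (∫ y in electrode p h, slp a y ∂surfaceMeasure) ^ 2 ≤
      4 * Real.pi * h ^ 3 * ∫ x in lowerHalfSpace, gradSq a x := by
  have hg := ha.dens
  obtain ⟨q, rfl⟩ := exists_boundaryEmb hp
  have hpre : boundaryEmb ⁻¹' electrode (boundaryEmb q) h = Metric.ball q h := by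
    ext y
    simp [electrode, boundaryEmb_apply_two, norm_boundaryEmb_sub, dist_eq_norm]
  have hgi : IntegrableOn (gradSq a) lowerHalfSpace :=
    integrable_finsetSum _ fun i _ => (ha.grad_memLp i).integrable_sq
  have hA : 0 ≤ ∫ x in lowerHalfSpace, gradSq a x := integral_nonneg (gradSq_nonneg a)
  set A := ∫ x in lowerHalfSpace, gradSq a x
  have hAe : ∫⁻ x in lowerHalfSpace, ENNReal.ofReal (gradSq a x) = ENNReal.ofReal A :=
    (ofReal_integral_eq_lintegral_ofReal hgi (Eventually.of_forall (gradSq_nonneg a))).symm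
  -- The ray estimate holds at each positive depth with a bound independent of the depth; the
  -- boundary values follow by dominated convergence with majorant `riesz a`.
  have hn : ∀ n, |∫ y in electrode (boundaryEmb q) h,
      slp a (y - scale n • outwardNormal) ∂surfaceMeasure| ≤ √(4 * Real.pi * h ^ 3 * A) := by
    intro n
    rw [surfaceMeasure, boundaryEmb_measurableEmbedding.setIntegral_map, hpre]
    have hshift : ∫ y in Metric.ball q h, slp a (boundaryEmb y - scale n • outwardNormal) =
        ∫ η in Metric.ball 0 h, slp a (ray q h (scale n) η 0) := by
      have hmp := (measurePreserving_add_left (volume : Measure (EuclideanSpace ℝ (Fin 2)))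
        q).restrict_preimage (measurableSet_ball (x := q) (ε := h))
      rw [← hmp.integral_comp (measurableEmbedding_addLeft q)]
      have : (fun x => q + x) ⁻¹' Metric.ball q h = Metric.ball 0 h := by
        ext y; simp [dist_eq_norm]
      rw [this]
      simp only [ray_zero]
    rw [hshift, ← Real.norm_eq_abs, ← ENNReal.ofReal_le_ofReal_iff (by positivity), ofReal_norm]
    refine (enorm_integral_le_lintegral_enorm _).trans
      ((hg.lintegral_slp_disk_le q hh (scale_pos n)).trans (le_of_eq ?_))
    rw [hAe, ← ENNReal.ofReal_mul (by positivity), ENNReal.ofReal_rpow_of_nonneg (by positivity)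
      (by norm_num), ENNReal.ofReal_rpow_of_nonneg (by positivity) (by norm_num),
      ← ENNReal.ofReal_mul (by positivity), ← ENNReal.ofReal_mul (by positivity),
      ← Real.sqrt_eq_rpow, ← Real.sqrt_eq_rpow, ← Real.sqrt_mul (by positivity)]
    congr 1
    rw [show (2 * h) = √((2 * h) ^ 2) by rw [Real.sqrt_sq (by positivity)],
      ← Real.sqrt_mul (by positivity)]
    congr 1
    field_simp
    ring
  have hball : electrode (boundaryEmb q) h ⊆ Metric.ball 0 (‖boundaryEmb q‖ + h) := fun y hy => by
    rw [mem_ball_zero_iff]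
    have := norm_le_norm_add_norm_sub (boundaryEmb q) y
    rw [norm_sub_rev] at this
    linarith [hy.2]
  have hlim : Tendsto (fun n => ∫ y in electrode (boundaryEmb q) h,
      slp a (y - scale n • outwardNormal) ∂surfaceMeasure) atTop
      (𝓝 (∫ y in electrode (boundaryEmb q) h, slp a y ∂surfaceMeasure)) := by
    refine tendsto_integral_of_dominated_convergence (riesz a) (fun n => ?_)
      ((integrableOn_riesz hg.int _).mono_set hball) (fun n => ?_) ?_
    · have hcont : Continuous fun y => slpReg (scale n) a (y - scale n • outwardNormal) :=
        (hg.slpReg_contDiff (scale_pos n)).continuous.comp (by fun_prop)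
      refine hcont.aestronglyMeasurable.congr ?_
      filter_upwards [ae_restrict_of_ae ae_surfaceMeasure_mem_plane] with y hy
      rw [slp_eq_slpReg (scale_pos n)]
      rw [sub_smul_outwardNormal_two, hy]; linarith
    · filter_upwards [ae_restrict_of_ae ae_surfaceMeasure_mem_plane,
        ae_restrict_of_ae (ae_integrable_riesz hg.int)] with y hy hi
      rw [slp_eq_slpReg (scale_pos n) a (by rw [sub_smul_outwardNormal_two, hy]; linarith)]
      exact norm_slpReg_sub_le_riesz (scale_pos n) hy hi _
    · filter_upwards [ae_restrict_of_ae ae_surfaceMeasure_mem_plane,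
        ae_restrict_of_ae (ae_integrable_riesz hg.int)] with y hy hi
      exact tendsto_slp_sub_scale hg.int hy hi
  have habs := le_of_tendsto hlim.abs (Eventually.of_forall hn)
  calc _ = |∫ y in electrode (boundaryEmb q) h, slp a y ∂surfaceMeasure| ^ 2 := (sq_abs _).symm
    _ ≤ √(4 * Real.pi * h ^ 3 * A) ^ 2 := by gcongr
    _ = _ := Real.sq_sqrt (by positivity)

end Rays

/-! ### The impedance condition and the energy bound. -/

section Energy

/-- On an electrode, either the impedance vanishes and the potential is constant, or the flux is
square integrable. -/
lemma integrable_re_mul_of_impedance {α : Type*} [MeasurableSpace α] {μ : Measure α}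
    [IsFiniteMeasure μ] {f g : α → ℂ} (hf : MemLp f 2 μ) (hg : Integrable g μ) {z P : ℂ}
    (h : ∀ᵐ y ∂μ, f y + z * g y = P) (L : ℂ →L[ℝ] ℝ) :
    Integrable (fun y => L (f y) * L (g y)) μ := by
  by_cases hz : z = 0
  · refine ((L.integrable_comp hg).const_mul (L P)).congr ?_
    filter_upwards [h] with y hy
    rw [← hy, hz, zero_mul, add_zero]
  · have h2 : MemLp g 2 μ := by
      refine (((memLp_const P).sub hf).const_mul z⁻¹).ae_eq ?_
      filter_upwards [h] with y hy
      simp only [Pi.sub_apply, ← hy]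
      field_simp
      ring
    exact (L.comp_memLp' hf).integrable_mul (L.comp_memLp' h2)

/-- The left side is the integral of `Re(P ḡ) - Re z · |g|²`. Replacing `|g|²` by a lower bound with
integral `1/m`, as for the constant flux `s/m`, leaves `s Re P - Re z / m`, which is `s/m` times the
integral of `Re f`. -/
lemma integral_power_le {α : Type*} [MeasurableSpace α] {μ : Measure α}
    [IsFiniteMeasure μ] {f g : α → ℂ} (hf : MemLp f 2 μ) (hg : Integrable g μ) {z P : ℂ}
    (hz : 0 ≤ z.re) (h : ∀ᵐ y ∂μ, f y + z * g y = P) {s m : ℝ} (hs : s ^ 2 = 1)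
    (hgs : ∫ y, g y ∂μ = s) (hm : μ.real univ = m) (hm0 : 0 < m) :
    (∫ y, (f y).re * (g y).re ∂μ) + ∫ y, (f y).im * (g y).im ∂μ ≤
      s * (∫ y, (f y).re ∂μ) / m := by
  have h1 := integrable_re_mul_of_impedance hf hg h Complex.reCLM
  have h2 := integrable_re_mul_of_impedance hf hg h Complex.imCLM
  simp only [Complex.reCLM_apply, Complex.imCLM_apply] at h1 h2
  have hre : Integrable (fun y => (g y).re) μ := hg.re
  have him : Integrable (fun y => (g y).im) μ := hg.im
  have e1 : ∫ y, (g y).re ∂μ = s := by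
    have := Complex.reCLM.integral_comp_comm hg
    simpa [hgs] using this
  have e2 : ∫ y, (g y).im ∂μ = 0 := by
    have := Complex.imCLM.integral_comp_comm hg
    simpa [hgs] using this
  have lin : ∀ c d e : ℝ, Integrable (fun y => c + d * (g y).re + e * (g y).im) μ ∧
      ∫ y, (c + d * (g y).re + e * (g y).im) ∂μ = c * m + d * s := fun c d e => by
    have i1 : Integrable (fun y => d * (g y).re) μ := hre.const_mul _
    have i2 : Integrable (fun y => e * (g y).im) μ := him.const_mul _
    have i3 : Integrable (fun y => c + d * (g y).re) μ := (integrable_const c).add i1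
    refine ⟨i3.add i2, ?_⟩
    rw [integral_add i3 i2, integral_add (integrable_const c) i1, integral_const_mul,
      integral_const_mul, e1, e2, integral_const, hm, smul_eq_mul]
    ring
  have hfr : ∫ y, (f y).re ∂μ = P.re * m - z.re * s := by
    have e : ∫ y, (f y).re ∂μ = ∫ y, (P.re + -z.re * (g y).re + z.im * (g y).im) ∂μ := by
      refine integral_congr_ae ?_
      filter_upwards [h] with y hy
      rw [← hy]; simp; ring
    rw [e, (lin _ _ _).2]
    ring
  rw [← integral_add h1 h2, hfr]
  obtain ⟨hb, hbv⟩ := lin (z.re * (1 / m) ^ 2) (P.re - z.re * (2 * s / m)) P.im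
  refine (integral_mono_ae (h1.add h2) hb ?_).trans (le_of_eq ?_)
  · filter_upwards [h] with y hy
    have hy1 : (f y).re = P.re - (z.re * (g y).re - z.im * (g y).im) := by rw [← hy]; simp
    have hy2 : (f y).im = P.im - (z.re * (g y).im + z.im * (g y).re) := by rw [← hy]; simp
    -- This is `|g - s/m|² ≥ 0`. The bound is affine in `g`, so no square integrability of `g` is
    -- needed, which is not assumed when `z = 0`.
    have key : 2 * s / m * (g y).re - (1 / m) ^ 2 ≤ (g y).re ^ 2 + (g y).im ^ 2 := by
      have h3 := sq_nonneg ((g y).re - s / m)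
      have h4 : (s / m) ^ 2 = (1 / m) ^ 2 := by rw [div_pow, div_pow, hs, one_pow]
      have h5 : 2 * s / m * (g y).re = 2 * (g y).re * (s / m) := by ring
      nlinarith [sq_nonneg (g y).im]
    have := mul_le_mul_of_nonneg_left key hz
    simp only [Pi.add_apply, hy1, hy2]
    nlinarith
  · rw [hbv]
    have : s * (P.re * m - z.re * s) / m = s * P.re - s ^ 2 * z.re / m := by field_simp
    rw [this]
    have h6 : (P.re - z.re * (2 * s / m)) * s = P.re * s - z.re * (2 * s ^ 2 / m) := by ring
    rw [h6, hs]
    field_simp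
    ring

lemma electrode_subset_ball (p : E3) (h : ℝ) : electrode p h ⊆ Metric.ball 0 (‖p‖ + h) :=
  fun y hy => by
    rw [mem_ball_zero_iff]
    have := norm_le_norm_add_norm_sub p y
    rw [norm_sub_rev] at this
    linarith [hy.2]

variable {pPlus pMinus : E3} {h : ℝ} {g : E3 → ℂ}

lemma exists_isDensity (hh : 0 < h) (hg : LocallyIntegrable g surfaceMeasure)
    (h0 : ∀ᵐ y ∂surfaceMeasure, y ∉ electrode pPlus h ∪ electrode pMinus h → g y = 0) :
    ∃ ρ, IsDensity ρ g := by
  have hsub : electrode pPlus h ∪ electrode pMinus h ⊆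
      Metric.closedBall 0 (‖pPlus‖ + ‖pMinus‖ + h) := by
    rintro y (hy | hy)
    · have := electrode_subset_ball _ _ hy
      rw [mem_ball_zero_iff] at this
      rw [mem_closedBall_zero_iff]
      linarith [norm_nonneg pMinus]
    · have := electrode_subset_ball _ _ hy
      rw [mem_ball_zero_iff] at this
      rw [mem_closedBall_zero_iff]
      linarith [norm_nonneg pPlus]
  refine ⟨‖pPlus‖ + ‖pMinus‖ + h, by positivity, ?_, ?_⟩
  · refine (integrableOn_iff_integrable_of_support_subset (s := electrode pPlus h ∪ electrode pMinus h)
      (f := (electrode pPlus h ∪ electrode pMinus h).indicator g)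
      support_indicator_subset).1 ?_ |>.congr ?_
    · have := (hg.integrableOn_isCompact (isCompact_closedBall (0 : E3)
        (‖pPlus‖ + ‖pMinus‖ + h))).mono_set hsub
      exact this.congr_fun_ae (by
        filter_upwards [ae_restrict_mem ((measurableSet_electrode pPlus h).union
          (measurableSet_electrode pMinus h))] with y hy
        rw [indicator_of_mem hy])
    · filter_upwards [h0] with y hy
      by_cases hy' : y ∈ electrode pPlus h ∪ electrode pMinus h
      · rw [indicator_of_mem hy']
      · rw [indicator_of_notMem hy', hy hy']
  · filter_upwards [h0] with y hy hlt
    refine hy fun hmem => ?_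
    have := hsub hmem
    rw [mem_closedBall_zero_iff] at this
    linarith

lemma integral_eq_add_of_ae_eq_zero {F : Type*} [NormedAddCommGroup F] [NormedSpace ℝ F]
    {φ : E3 → F}
    (hd : Disjoint (electrode pPlus h) (electrode pMinus h))
    (hP : IntegrableOn φ (electrode pPlus h) surfaceMeasure)
    (hM : IntegrableOn φ (electrode pMinus h) surfaceMeasure)
    (h0 : ∀ᵐ y ∂surfaceMeasure, y ∉ electrode pPlus h ∪ electrode pMinus h → φ y = 0) :
    Integrable φ surfaceMeasure ∧ ∫ y, φ y ∂surfaceMeasure =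
      (∫ y in electrode pPlus h, φ y ∂surfaceMeasure) +
        ∫ y in electrode pMinus h, φ y ∂surfaceMeasure := by
  constructor
  · refine ((integrable_indicator_iff ((measurableSet_electrode pPlus h).union
      (measurableSet_electrode pMinus h))).2 (hP.union hM)).congr ?_
    filter_upwards [h0] with y hy
    by_cases hy' : y ∈ electrode pPlus h ∪ electrode pMinus h
    · rw [indicator_of_mem hy']
    · rw [indicator_of_notMem hy', hy hy']
  · rw [← setIntegral_union hd (measurableSet_electrode pMinus h) hP hM]
    exact (setIntegral_eq_integral_of_ae_compl_eq_zero h0).symm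

lemma memLp_electrode {f : E3 → ℂ}
    (hf : ∀ r : ℝ, MemLp f 2 (surfaceMeasure.restrict (Metric.ball 0 r))) (p : E3) (h : ℝ) :
    MemLp f 2 (surfaceMeasure.restrict (electrode p h)) :=
  (hf _).mono_measure (Measure.restrict_mono (electrode_subset_ball p h) le_rfl)

lemma measureReal_electrode {p : E3} (hp : p 2 = 0) (hh : 0 < h) :
    (surfaceMeasure.restrict (electrode p h)).real univ = Real.pi * h ^ 2 := by
  rw [Measure.real, Measure.restrict_apply_univ, surfaceMeasure_electrode hp hh.le,
    ENNReal.toReal_ofReal (by positivity)]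

/-- The Dirichlet energy of a solution of the complete electrode model is at most of order `1/h`. -/
theorem energy_le {zPlus zMinus PPlus PMinus : ℂ} {f : E3 → ℂ} {ρ : ℝ} (hpP : pPlus 2 = 0)
    (hpM : pMinus 2 = 0) (hh : 0 < h)
    (hd : Disjoint (electrode pPlus h) (electrode pMinus h))
    (hzP : 0 ≤ zPlus.re) (hzM : 0 ≤ zMinus.re)
    (hf : ∀ r : ℝ, MemLp f 2 (surfaceMeasure.restrict (Metric.ball 0 r)))
    (hfg : ∀ᵐ y ∂surfaceMeasure, f y = slp g y)
    (hre : IsNeumannPotential ρ fun y => (g y).re) (him : IsNeumannPotential ρ fun y => (g y).im)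
    (hg : Integrable g surfaceMeasure)
    (hP : ∀ᵐ y ∂surfaceMeasure, y ∈ electrode pPlus h → f y + zPlus * g y = PPlus)
    (hM : ∀ᵐ y ∂surfaceMeasure, y ∈ electrode pMinus h → f y + zMinus * g y = PMinus)
    (hIP : (∫ y in electrode pPlus h, g y ∂surfaceMeasure) = 1)
    (hIM : (∫ y in electrode pMinus h, g y ∂surfaceMeasure) = -1)
    (h0 : ∀ᵐ y ∂surfaceMeasure, y ∉ electrode pPlus h ∪ electrode pMinus h → g y = 0) :
    (∫ x in lowerHalfSpace, gradSq (fun y => (g y).re) x) +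
      ∫ x in lowerHalfSpace, gradSq (fun y => (g y).im) x ≤ 16 / (Real.pi * h) := by
  set a := fun y => (g y).re
  set b := fun y => (g y).im
  have hsa : ∀ᵐ y ∂surfaceMeasure, slp a y = (f y).re := by
    filter_upwards [hfg, ae_slp_comp_clm hg Complex.reCLM] with y h1 h2
    rw [h1]; exact h2
  have hsb : ∀ᵐ y ∂surfaceMeasure, slp b y = (f y).im := by
    filter_upwards [hfg, ae_slp_comp_clm hg Complex.imCLM] with y h1 h2
    rw [h1]; exact h2
  have hP' : ∀ᵐ y ∂surfaceMeasure.restrict (electrode pPlus h), f y + zPlus * g y = PPlus :=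
    (ae_restrict_iff' (measurableSet_electrode _ _)).2 hP
  have hM' : ∀ᵐ y ∂surfaceMeasure.restrict (electrode pMinus h), f y + zMinus * g y = PMinus :=
    (ae_restrict_iff' (measurableSet_electrode _ _)).2 hM
  have hfin : ∀ {p : E3}, p 2 = 0 → IsFiniteMeasure (surfaceMeasure.restrict (electrode p h)) :=
    fun hp => ⟨by
      rw [Measure.restrict_apply_univ, surfaceMeasure_electrode hp hh.le]
      exact ENNReal.ofReal_lt_top⟩
  have := hfin hpP
  have := hfin hpM
  have hfP := memLp_electrode hf pPlus h
  have hfM := memLp_electrode hf pMinus h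
  have hm0 : 0 < Real.pi * h ^ 2 := by positivity
  have pP := integral_power_le hfP hg.integrableOn hzP hP' (s := 1) (by norm_num)
    (by rw [hIP]; norm_num) (measureReal_electrode hpP hh) hm0
  have pM := integral_power_le hfM hg.integrableOn hzM hM' (s := -1) (by norm_num)
    (by rw [hIM]; norm_num) (measureReal_electrode hpM hh) hm0
  have split : ∀ L : ℂ →L[ℝ] ℝ, _ := fun L => integral_eq_add_of_ae_eq_zero
    (φ := fun y => L (f y) * L (g y)) hd
    (integrable_re_mul_of_impedance hfP hg.integrableOn hP' L)
    (integrable_re_mul_of_impedance hfM hg.integrableOn hM' L) (by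
      filter_upwards [h0] with y hy hy'
      rw [hy hy', map_zero, mul_zero])
  have sa := split Complex.reCLM
  have sb := split Complex.imCLM
  simp only [Complex.reCLM_apply, Complex.imCLM_apply] at sa sb
  have ea : (fun y => (f y).re * (g y).re) =ᵐ[surfaceMeasure] fun y => slp a y * a y := by
    filter_upwards [hsa] with y hy; rw [hy]
  have eb : (fun y => (f y).im * (g y).im) =ᵐ[surfaceMeasure] fun y => slp b y * b y := by
    filter_upwards [hsb] with y hy; rw [hy]
  have hsum : ∀ {c : E3 → ℝ}, IsNeumannPotential ρ c →
      ∫ x in lowerHalfSpace, gradSq c x =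
        ∑ i, ∫ x in lowerHalfSpace, (fderiv ℝ (slp c) x (EuclideanSpace.single i 1)) ^ 2 :=
    fun hc => integral_finsetSum _ fun i _ => (hc.grad_memLp i).integrable_sq
  have ia := hre.energy_identity (sa.1.congr ea)
  have ib := him.energy_identity (sb.1.congr eb)
  rw [← hsum hre, ← integral_congr_ae ea, sa.2] at ia
  rw [← hsum him, ← integral_congr_ae eb, sb.2] at ib
  have rP := hre.sq_integral_electrode_le hpP hh
  have rM := hre.sq_integral_electrode_le hpM hh
  rw [integral_congr_ae (ae_restrict_of_ae hsa)] at rP rM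
  have hA : 0 ≤ ∫ x in lowerHalfSpace, gradSq a x := integral_nonneg (gradSq_nonneg a)
  have hB : 0 ≤ ∫ x in lowerHalfSpace, gradSq b x := integral_nonneg (gradSq_nonneg b)
  set A := ∫ x in lowerHalfSpace, gradSq a x
  set B := ∫ x in lowerHalfSpace, gradSq b x
  set X := ∫ y in electrode pPlus h, (f y).re ∂surfaceMeasure
  set Y := ∫ y in electrode pMinus h, (f y).re ∂surfaceMeasure
  -- The energy identities for the real and imaginary parts are summed; only in the sum do the power
  -- bounds on the two electrodes apply.
  have hT : A + B ≤ (X - Y) / (Real.pi * h ^ 2) := by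
    have : (X - Y) / (Real.pi * h ^ 2) = 1 * X / (Real.pi * h ^ 2) + -1 * Y / (Real.pi * h ^ 2) := by
      ring
    rw [this]; linarith
  rw [le_div_iff₀ hm0] at hT
  -- From `(X - Y)² ≤ 2X² + 2Y²` and the disk estimate on each electrode. Squaring `hT` then gives a
  -- quadratic inequality for `A + B`, divided through when `A + B` is nonzero.
  have hXY : (X - Y) ^ 2 ≤ 16 * Real.pi * h ^ 3 * (A + B) := by
    have h1 : 0 ≤ Real.pi * h ^ 3 * B := by positivity
    nlinarith [sq_nonneg (X + Y)]
  rcases (add_nonneg hA hB).eq_or_lt with hT0 | hT0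
  · rw [← hT0]; positivity
  · have h1 : ((A + B) * (Real.pi * h ^ 2)) ^ 2 ≤ (X - Y) ^ 2 := by gcongr
    rw [le_div_iff₀ (by positivity)]
    have h2 := h1.trans hXY
    have h3 : 0 < Real.pi * h ^ 3 * (A + B) := by positivity
    refine le_of_mul_le_mul_left (h2.trans' (le_of_eq ?_) |>.trans (le_of_eq ?_)) h3
    · ring
    · ring

end Energy

/-! ### Comparison of the flux with a pair of point charges. -/

section PointCharges

/-- All cutoffs are rescaled translates of one bump with radii 1 and `3/2`, so the constant does not
depend on `p` or `r`. -/
lemma exists_cutoff : ∃ C : ℝ, 0 < C ∧ ∀ (p : E3) (r : ℝ), 0 < r → ∃ χ : E3 → ℝ,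
    ContDiff ℝ ∞ χ ∧ (∀ x, |χ x| ≤ 1) ∧ (∀ x, ‖x - p‖ ≤ r → χ x = 1) ∧
    (∀ x, 3 / 2 * r ≤ ‖x - p‖ → χ x = 0) ∧ ∀ x, ‖fderiv ℝ χ x‖ ≤ C / r := by
  let b : ContDiffBump (0 : E3) := ⟨1, 3 / 2, one_pos, by norm_num⟩
  have hb : ContDiff ℝ ∞ b := b.contDiff
  obtain ⟨C, hC⟩ := (b.hasCompactSupport.fderiv (𝕜 := ℝ)).exists_bound_of_continuous
    (hb.continuous_fderiv (by simp))
  refine ⟨|C| + 1, by positivity, fun p r hr => ⟨fun x => b (r⁻¹ • (x - p)),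
    hb.comp (by fun_prop), fun x => ?_, fun x hx => ?_, fun x hx => ?_, fun x => ?_⟩⟩
  · rw [abs_of_nonneg b.nonneg]; exact b.le_one
  · apply b.one_of_mem_closedBall
    rw [mem_closedBall_zero_iff, norm_smul, norm_inv, Real.norm_of_nonneg hr.le]
    change r⁻¹ * _ ≤ 1
    rw [inv_mul_le_iff₀ hr]; linarith
  · apply b.zero_of_le_dist
    rw [dist_zero_right, norm_smul, norm_inv, Real.norm_of_nonneg hr.le]
    change 3 / 2 ≤ r⁻¹ * _
    rw [le_inv_mul_iff₀ hr]; linarith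
  · have h1 : HasFDerivAt (fun x : E3 => r⁻¹ • (x - p)) (r⁻¹ • ContinuousLinearMap.id ℝ E3) x :=
      ((hasFDerivAt_id x).sub_const p).const_smul r⁻¹
    have h2 := ((hb.differentiable (by simp) (r⁻¹ • (x - p))).hasFDerivAt).comp x h1
    have h3 : fderiv ℝ (fun x => b (r⁻¹ • (x - p))) x = _ := h2.fderiv
    rw [h3]
    refine (ContinuousLinearMap.opNorm_comp_le _ _).trans ?_
    have h4 : ‖r⁻¹ • ContinuousLinearMap.id ℝ E3‖ ≤ r⁻¹ := by
      refine (ContinuousLinearMap.opNorm_smul_le _ _).trans ?_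
      rw [norm_inv, Real.norm_of_nonneg hr.le]
      exact mul_le_of_le_one_right (by positivity) ContinuousLinearMap.norm_id_le
    rw [div_eq_mul_inv]
    gcongr
    exact (hC _).trans ((le_abs_self C).trans (by linarith))

/-- Localization of the increment `k - k p` to a ball around `p`. -/
lemma exists_localization : ∃ C : ℝ, 0 < C ∧ ∀ (p : E3) (r M : ℝ) (k : E3 → ℝ), 0 < r →
    ContDiff ℝ ∞ k → (∀ y, ‖y - p‖ ≤ 3 / 2 * r → ‖fderiv ℝ k y‖ ≤ M) → ∃ Ψ : E3 → ℝ,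
      IsTestFunction univ Ψ ∧ (∀ y, ‖y - p‖ ≤ r → Ψ y = k y - k p) ∧
      (∀ y, 3 / 2 * r ≤ ‖y - p‖ → Ψ y = 0) ∧
      ∀ y, ‖fderiv ℝ Ψ y‖ ≤ (Metric.closedBall p (3 / 2 * r)).indicator (fun _ => C * M) y := by
  obtain ⟨C, hC, hχ⟩ := exists_cutoff
  refine ⟨3 / 2 * C + 1, by positivity, fun p r M k hr hk hM => ?_⟩
  obtain ⟨χ, h1, h2, h3, h4, h5⟩ := hχ p r hr
  have hs : ContDiff ℝ ∞ fun y => χ y * (k y - k p) := h1.mul (hk.sub contDiff_const)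
  have hz : ∀ y, 3 / 2 * r ≤ ‖y - p‖ → χ y * (k y - k p) = 0 := fun y hy => by
    rw [h4 y hy, zero_mul]
  refine ⟨fun y => χ y * (k y - k p), ⟨hs, ?_, subset_univ _⟩, fun y hy => ?_, hz, fun y => ?_⟩
  · refine HasCompactSupport.intro (isCompact_closedBall p (3 / 2 * r)) fun y hy => hz y ?_
    rw [Metric.mem_closedBall, dist_eq_norm, not_le] at hy
    exact hy.le
  · change χ y * _ = _
    rw [h3 y hy, one_mul]
  · by_cases hy : y ∈ Metric.closedBall p (3 / 2 * r)
    · rw [indicator_of_mem hy]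
      rw [Metric.mem_closedBall, dist_eq_norm] at hy
      have hM0 : 0 ≤ M := (norm_nonneg _).trans (hM y hy)
      -- The increment is `O(Mr)`, which compensates the gradient `C / r` of the cutoff.
      have hinc : |k y - k p| ≤ M * (3 / 2 * r) := by
        have := (convex_closedBall p (3 / 2 * r)).norm_image_sub_le_of_norm_fderiv_le (𝕜 := ℝ)
          (f := k) (C := M) (fun z _ => hk.differentiable (by simp) z)
          (fun z hz => hM z (by rwa [Metric.mem_closedBall, dist_eq_norm] at hz))
          (Metric.mem_closedBall_self (by positivity))
          (by rwa [Metric.mem_closedBall, dist_eq_norm] : y ∈ _)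
        rw [← Real.norm_eq_abs]
        exact this.trans (by gcongr)
      have hd := ((h1.differentiable (by simp) y).hasFDerivAt.mul
        ((hk.differentiable (by simp) y).hasFDerivAt.sub_const (k p))).fderiv
      have hd' : fderiv ℝ (fun y => χ y * (k y - k p)) y = _ := hd
      rw [hd']
      refine (norm_add_le _ _).trans ?_
      have e1 : ‖χ y • fderiv ℝ k y‖ ≤ 1 * M := by
        refine (ContinuousLinearMap.opNorm_smul_le _ _).trans ?_
        gcongr
        · exact h2 y
        · exact hM y hy
      have e2 : ‖(k y - k p) • fderiv ℝ χ y‖ ≤ M * (3 / 2 * r) * (C / r) := by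
        refine (ContinuousLinearMap.opNorm_smul_le _ _).trans ?_
        gcongr
        · exact hinc
        · exact h5 y
      have e3 : M * (3 / 2 * r) * (C / r) = 3 / 2 * C * M := by field_simp
      linarith
    · rw [indicator_of_notMem hy]
      have : (fun y => χ y * (k y - k p)) =ᶠ[𝓝 y] fun _ => 0 := by
        filter_upwards [Metric.isClosed_closedBall.isOpen_compl.mem_nhds hy] with z hz'
        rw [mem_compl_iff, Metric.mem_closedBall, dist_eq_norm, not_le] at hz'
        exact hz z hz'.le
      rw [this.fderiv_eq]
      simp

variable {a : E3 → ℝ} {ρ h : ℝ}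

/-- Green's formula turns the boundary integral into a Dirichlet pairing. The gradient of `Ψ` is
`O(M)` on a ball of volume `O(h³)` and the energy is `O(1/h)`, so the pairing is of order `M √(h³ /
h) = Mh`. -/
lemma IsNeumannPotential.abs_integral_test_le (ha : IsNeumannPotential ρ a) (hh : 0 < h)
    (hE : ∫ x in lowerHalfSpace, gradSq a x ≤ 16 / (Real.pi * h)) {Ψ : E3 → ℝ}
    (hΨ : IsTestFunction univ Ψ) {p : E3} {s K M : ℝ} (hs : s ≤ 6 * h) (hM : 0 < M)
    (hb : ∀ y, ‖fderiv ℝ Ψ y‖ ≤ (Metric.closedBall p s).indicator (fun _ => K * M) y) :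
    |∫ y, Ψ y * a y ∂surfaceMeasure| ≤ (432 * Real.pi * K ^ 2 + 8) * h * M := by
  rw [← ha.green Ψ hΨ, ← Real.norm_eq_abs]
  set S := Metric.closedBall p s
  have hSm : MeasurableSet S := Metric.isClosed_closedBall.measurableSet
  have hSv : (volume S).toReal ≤ 288 * Real.pi * h ^ 3 := by
    have h1 : volume S ≤ volume (Metric.closedBall p (6 * h)) :=
      measure_mono (Metric.closedBall_subset_closedBall hs)
    have h2 : volume (Metric.closedBall p (6 * h)) = ENNReal.ofReal (288 * Real.pi * h ^ 3) := by
      rw [EuclideanSpace.volume_closedBall_fin_three, ← ENNReal.ofReal_pow (by positivity),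
        ← ENNReal.ofReal_mul (by positivity)]
      congr 1; ring
    rw [h2] at h1
    exact ENNReal.toReal_le_of_le_ofReal (by positivity) h1
  have hSf : volume S ≠ ⊤ := measure_closedBall_lt_top.ne
  have hgi : IntegrableOn (gradSq a) lowerHalfSpace :=
    integrable_finsetSum _ fun i _ => (ha.grad_memLp i).integrable_sq
  -- The weight in Young's inequality that makes both halves of order `hM`.
  set c : ℝ := 1 / (h ^ 2 * M)
  have hc : 0 < c := by positivity
  have hind : Integrable (S.indicator fun _ : E3 => (K * M) ^ 2) volume :=
    (integrableOn_const hSf (by finiteness)).integrable_indicator hSm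
  have hbi : Integrable (fun x => 3 * c / 2 * S.indicator (fun _ => (K * M) ^ 2) x +
      1 / (2 * c) * gradSq a x) (volume.restrict lowerHalfSpace) :=
    (hind.restrict.const_mul _).add (hgi.const_mul _)
  refine (norm_integral_le_of_norm_le hbi (Eventually.of_forall fun x => ?_)).trans ?_
  · have hi : ∀ i : Fin 3, |partialDeriv i Ψ x * fderiv ℝ (slp a) x (EuclideanSpace.single i 1)| ≤
        c / 2 * S.indicator (fun _ => (K * M) ^ 2) x +
          1 / (2 * c) * fderiv ℝ (slp a) x (EuclideanSpace.single i 1) ^ 2 := by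
      intro i
      set D := fderiv ℝ (slp a) x (EuclideanSpace.single i 1)
      have h1 : partialDeriv i Ψ x ^ 2 ≤ S.indicator (fun _ => (K * M) ^ 2) x := by
        have h2 : |partialDeriv i Ψ x| ≤ S.indicator (fun _ => K * M) x := by
          refine le_trans ?_ (hb x)
          have := (fderiv ℝ Ψ x).le_opNorm (EuclideanSpace.single i 1)
          simpa [partialDeriv] using this
        rw [← sq_abs]
        by_cases hx : x ∈ S
        · rw [indicator_of_mem hx] at h2 ⊢
          gcongr
        · rw [indicator_of_notMem hx] at h2 ⊢
          have := abs_nonneg (partialDeriv i Ψ x)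
          have h3 : |partialDeriv i Ψ x| = 0 := le_antisymm h2 this
          rw [h3]; norm_num
      have h3 : |partialDeriv i Ψ x * D| ≤ c / 2 * partialDeriv i Ψ x ^ 2 + 1 / (2 * c) * D ^ 2 := by
        have e : c / 2 * partialDeriv i Ψ x ^ 2 + 1 / (2 * c) * D ^ 2 -
            |partialDeriv i Ψ x| * |D| = 1 / (2 * c) * (c * |partialDeriv i Ψ x| - |D|) ^ 2 := by
          rw [← sq_abs (partialDeriv i Ψ x), ← sq_abs D]
          field_simp
          ring
        have : 0 ≤ 1 / (2 * c) * (c * |partialDeriv i Ψ x| - |D|) ^ 2 := by positivity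
        rw [abs_mul]; linarith
      refine h3.trans ?_
      gcongr
    refine (Finset.abs_sum_le_sum_abs _ _).trans ((Finset.sum_le_sum fun i _ => hi i).trans
      (le_of_eq ?_))
    rw [gradSq, Finset.sum_add_distrib, Finset.sum_const, Finset.card_fin, nsmul_eq_mul,
      ← Finset.mul_sum]
    push_cast
    ring
  · rw [integral_add (hind.restrict.const_mul _) (hgi.const_mul _), integral_const_mul,
      integral_const_mul]
    have h1 : ∫ x in lowerHalfSpace, S.indicator (fun _ => (K * M) ^ 2) x ≤
        288 * Real.pi * h ^ 3 * (K * M) ^ 2 := by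
      refine (setIntegral_le_integral hind (Eventually.of_forall fun x =>
        indicator_nonneg (fun _ _ => sq_nonneg _) x)).trans ?_
      rw [integral_indicator hSm, setIntegral_const, smul_eq_mul]
      exact mul_le_mul_of_nonneg_right hSv (sq_nonneg _)
    calc _ ≤ 3 * c / 2 * (288 * Real.pi * h ^ 3 * (K * M) ^ 2) + 1 / (2 * c) * (16 / (Real.pi * h)) := by
          gcongr
      _ = 432 * Real.pi * K ^ 2 * h * M + 8 * h * M / Real.pi := by
          simp only [c]
          field_simp
          ring
      _ ≤ 432 * Real.pi * K ^ 2 * h * M + 8 * h * M := by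
          gcongr
          exact div_le_self (by positivity) (by linarith [Real.pi_gt_three])
      _ = _ := by ring

/-- A density concentrated on two small electrodes acts on smooth functions like a pair of point
charges, with an error of first order in the radius. -/
theorem exists_pointCharge_bound : ∃ C : ℝ, 0 < C ∧ ∀ {ρ h : ℝ} {a : E3 → ℝ} {pPlus pMinus : E3},
    IsNeumannPotential ρ a → 0 < h → Disjoint (electrode pPlus h) (electrode pMinus h) →
    ∫ x in lowerHalfSpace, gradSq a x ≤ 16 / (Real.pi * h) →
    (∀ᵐ y ∂surfaceMeasure, y ∉ electrode pPlus h ∪ electrode pMinus h → a y = 0) →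
    ∀ α : ℝ, |α| ≤ 1 → ∫ y in electrode pPlus h, a y ∂surfaceMeasure = α →
    ∫ y in electrode pMinus h, a y ∂surfaceMeasure = -α →
    ∀ (k : E3 → ℝ) (M : ℝ), ContDiff ℝ ∞ k → 0 < M →
    (∀ y, ‖y - pPlus‖ ≤ 6 * h → ‖fderiv ℝ k y‖ ≤ M) →
    (∀ y, ‖y - pMinus‖ ≤ 6 * h → ‖fderiv ℝ k y‖ ≤ M) →
    |(∫ y, k y * a y ∂surfaceMeasure) - α * (k pPlus - k pMinus)| ≤ C * h * M := by
  obtain ⟨K, hK, hloc⟩ := exists_localization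
  refine ⟨2 * (432 * Real.pi * K ^ 2 + 8), by positivity, ?_⟩
  intro ρ h a pP pM ha hh hd hE h0 α hα hIP hIM k M hk hM hkP hkM
  have hint := ha.dens.int
  have hloci : ∀ {φ : E3 → ℝ} {p : E3}, Continuous φ →
      IntegrableOn (fun y => φ y * a y) (electrode p h) surfaceMeasure := by
    intro φ p hφ
    have hcpt : IsCompact (Metric.closedBall (0 : E3) (‖p‖ + h)) := isCompact_closedBall _ _
    have := (hint.integrableOn (s := Metric.closedBall (0 : E3) (‖p‖ + h))).continuousOn_mul
      hφ.continuousOn hcpt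
    exact this.mono_set ((electrode_subset_ball p h).trans Metric.ball_subset_closedBall)
  have hsplit : ∀ {φ : E3 → ℝ}, Continuous φ → ∫ y, φ y * a y ∂surfaceMeasure =
      (∫ y in electrode pP h, φ y * a y ∂surfaceMeasure) +
        ∫ y in electrode pM h, φ y * a y ∂surfaceMeasure := fun hφ =>
    (integral_eq_add_of_ae_eq_zero hd (hloci hφ) (hloci hφ) (by
      filter_upwards [h0] with y hy hy'
      rw [hy hy', mul_zero])).2
  have hsub : ∀ {p : E3} (c : ℝ), ∫ y in electrode p h, (k y - c) * a y ∂surfaceMeasure =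
      (∫ y in electrode p h, k y * a y ∂surfaceMeasure) -
        c * ∫ y in electrode p h, a y ∂surfaceMeasure := by
    intro p c
    simp only [sub_mul]
    rw [integral_sub (hloci hk.continuous) (hint.integrableOn.const_mul c), integral_const_mul]
  rw [hsplit hk.continuous]
  -- If the centres are at least `5h/2` apart, the cutoff around one centre, supported within
  -- `3h/2`, vanishes on the other electrode. Otherwise a single cutoff serves both.
  rcases le_or_gt (5 * h) (2 * ‖pM - pP‖) with hfar | hnear
  · obtain ⟨Ψ, t1, t2, t3, t4⟩ := hloc pP h M k hh hk fun y hy => hkP y (by linarith)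
    obtain ⟨Θ, s1, s2, s3, s4⟩ := hloc pM h M k hh hk fun y hy => hkM y (by linarith)
    have bP := ha.abs_integral_test_le hh hE t1 (by linarith) hM t4
    have bM := ha.abs_integral_test_le hh hE s1 (by linarith) hM s4
    have eP : ∫ y, Ψ y * a y ∂surfaceMeasure = (∫ y in electrode pP h, k y * a y ∂surfaceMeasure) -
        k pP * α := by
      have e1 : ∫ y in electrode pP h, Ψ y * a y ∂surfaceMeasure =
          ∫ y in electrode pP h, (k y - k pP) * a y ∂surfaceMeasure :=
        setIntegral_congr_fun (measurableSet_electrode _ _) fun y hy => by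
          simp only [t2 y hy.2.le]
      have e2 : ∫ y in electrode pM h, Ψ y * a y ∂surfaceMeasure = 0 :=
        setIntegral_eq_zero_of_forall_eq_zero fun y hy => by
          rw [t3 y, zero_mul]
          have := norm_sub_le_norm_sub_add_norm_sub pM y pP
          rw [norm_sub_rev pM y] at this
          linarith [hy.2]
      rw [hsplit t1.smooth.continuous, e1, e2, add_zero, hsub, hIP]
    have eM : ∫ y, Θ y * a y ∂surfaceMeasure = (∫ y in electrode pM h, k y * a y ∂surfaceMeasure) +
        k pM * α := by
      have e1 : ∫ y in electrode pM h, Θ y * a y ∂surfaceMeasure =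
          ∫ y in electrode pM h, (k y - k pM) * a y ∂surfaceMeasure :=
        setIntegral_congr_fun (measurableSet_electrode _ _) fun y hy => by
          simp only [s2 y hy.2.le]
      have e2 : ∫ y in electrode pP h, Θ y * a y ∂surfaceMeasure = 0 :=
        setIntegral_eq_zero_of_forall_eq_zero fun y hy => by
          rw [s3 y, zero_mul]
          have := norm_sub_le_norm_sub_add_norm_sub pM y pP
          rw [norm_sub_rev pM y] at this
          linarith [hy.2]
      rw [hsplit s1.smooth.continuous, e1, e2, zero_add, hsub, hIM]
      ring
    rw [eP] at bP
    rw [eM] at bM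
    rw [abs_le] at bP bM ⊢
    constructor <;> nlinarith
  -- Radius `4h` covers both electrodes since `5h/2 + h < 4h`; the support then has radius `6h`, the
  -- largest one allowed.
  · obtain ⟨Ψ, t1, t2, t3, t4⟩ := hloc pP (4 * h) M k (by positivity) hk
      fun y hy => hkP y (by linarith)
    have bP := ha.abs_integral_test_le hh hE t1 (by linarith) hM t4
    have e1 : ∫ y in electrode pP h, Ψ y * a y ∂surfaceMeasure =
        ∫ y in electrode pP h, (k y - k pP) * a y ∂surfaceMeasure :=
      setIntegral_congr_fun (measurableSet_electrode _ _) fun y hy => by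
        simp only [t2 y (by linarith [hy.2])]
    have e2 : ∫ y in electrode pM h, Ψ y * a y ∂surfaceMeasure =
        ∫ y in electrode pM h, (k y - k pP) * a y ∂surfaceMeasure :=
      setIntegral_congr_fun (measurableSet_electrode _ _) fun y hy => by
        have := norm_sub_le_norm_sub_add_norm_sub y pM pP
        simp only [t2 y (by linarith [hy.2])]
    -- The total charge is zero, so the constant `k pP` drops out. It remains to see that `k pP - k
    -- pM` is itself `O(hM)`.
    rw [hsplit t1.smooth.continuous, e1, e2, hsub, hsub, hIP, hIM] at bP
    have hinc : |k pM - k pP| ≤ M * ‖pM - pP‖ :=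
      (convex_closedBall pP (6 * h)).norm_image_sub_le_of_norm_fderiv_le (𝕜 := ℝ)
        (f := k) (C := M) (fun z _ => hk.differentiable (by simp) z)
        (fun z hz => hkP z (by rwa [Metric.mem_closedBall, dist_eq_norm] at hz))
        (Metric.mem_closedBall_self (by positivity))
        (by rw [Metric.mem_closedBall, dist_eq_norm]; linarith)
    have h1 : |α * (k pP - k pM)| ≤ 8 * h * M := by
      rw [abs_mul, abs_sub_comm]
      have h2 : M * ‖pM - pP‖ ≤ M * (8 * h) := by gcongr; linarith
      calc |α| * |k pM - k pP| ≤ 1 * (M * (8 * h)) := by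
            gcongr
            exact hinc.trans h2
        _ = _ := by ring
    have h3 : 0 < 432 * Real.pi * K ^ 2 * h * M := by positivity
    rw [abs_le] at bP h1 ⊢
    constructor <;> nlinarith

end PointCharges

/-! ### Far field estimates for the potential and its gradient. -/

section FarField

variable {pPlus pMinus : E3} {ρ h : ℝ} {g : E3 → ℂ}

/-- A boundary flux of unit current between two disk electrodes whose potential has Dirichlet energy
of order `1/h`. -/
structure IsElectrodeDensity (pPlus pMinus : E3) (h ρ : ℝ) (g : E3 → ℂ) : Prop where
  dens : IsDensity ρ g
  re : IsNeumannPotential ρ fun y => (g y).re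
  im : IsNeumannPotential ρ fun y => (g y).im
  energy_re : ∫ x in lowerHalfSpace, gradSq (fun y => (g y).re) x ≤ 16 / (Real.pi * h)
  energy_im : ∫ x in lowerHalfSpace, gradSq (fun y => (g y).im) x ≤ 16 / (Real.pi * h)
  integral_plus : ∫ y in electrode pPlus h, g y ∂surfaceMeasure = 1
  integral_minus : ∫ y in electrode pMinus h, g y ∂surfaceMeasure = -1
  ae_eq_zero : ∀ᵐ y ∂surfaceMeasure, y ∉ electrode pPlus h ∪ electrode pMinus h → g y = 0

lemma IsCEMSolution.exists_isElectrodeDensity (hpP : pPlus 2 = 0) (hpM : pMinus 2 = 0)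
    (hh : 0 < h) (hd : Disjoint (electrode pPlus h) (electrode pMinus h))
    {zPlus zMinus PPlus PMinus : ℂ} (hzP : 0 ≤ zPlus.re) (hzM : 0 ≤ zMinus.re) {u : E3 → ℂ}
    (hu : IsCEMSolution pPlus pMinus h zPlus zMinus PPlus PMinus u) :
    ∃ ρ g, IsElectrodeDensity pPlus pMinus h ρ g ∧
      ∀ᵐ x ∂volume.restrict lowerHalfSpace, u x = slp g x := by
  obtain ⟨G, f, g, hH, hf, -, hg, hP, hM, hIP, hIM, h0, hlim⟩ := hu
  obtain ⟨ρ, hρ⟩ := exists_isDensity hh hg.locInt h0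
  have hG := ae_eq_gradC_slp hH hf hg hρ hlim
  have hre := isNeumannPotential_comp_clm hH hg hρ hG Complex.reCLM
  have him := isNeumannPotential_comp_clm hH hg hρ hG Complex.imCLM
  have hE := energy_le hpP hpM hh hd hzP hzM hf.memLp (trace_ae_eq_slp hH hf hg hρ hlim) hre him
    hρ.int hP hM hIP hIM h0
  have hA : 0 ≤ ∫ x in lowerHalfSpace, gradSq (fun y => (g y).re) x :=
    integral_nonneg (gradSq_nonneg _)
  have hB : 0 ≤ ∫ x in lowerHalfSpace, gradSq (fun y => (g y).im) x :=
    integral_nonneg (gradSq_nonneg _)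
  exact ⟨ρ, g, ⟨hρ, hre, him, by linarith, by linarith, hIP, hIM, h0⟩,
    ae_eq_slp hH hf hg hρ hlim⟩

lemma exists_decay_bound {V : Type*} [NormedAddCommGroup V] {f : E3 → V} (hf : Continuous f) {C : ℝ}
    (hC : ∀ w, 1 ≤ ‖w‖ → ‖f w‖ ≤ C / ‖w‖ ^ 2) :
    ∃ K : ℝ, 0 < K ∧ ∀ w, ‖f w‖ ≤ K * ((1 + ‖w‖) ^ 2)⁻¹ := by
  obtain ⟨A, hA⟩ := (isCompact_closedBall (0 : E3) 1).exists_bound_of_continuousOn hf.continuousOn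
  refine ⟨4 * (|A| + |C| + 1), by positivity, fun w => ?_⟩
  rw [← div_eq_mul_inv, le_div_iff₀ (by positivity)]
  rcases le_total ‖w‖ 1 with hw | hw
  · have h1 := hA w (by simpa using hw)
    have h2 : (1 + ‖w‖) ^ 2 ≤ 2 ^ 2 := by gcongr; linarith
    calc _ ≤ |A| * 2 ^ 2 := by
          gcongr
          exact h1.trans (le_abs_self A)
      _ ≤ _ := by linarith [abs_nonneg C]
  · have h2 : (1 + ‖w‖) ^ 2 ≤ (2 * ‖w‖) ^ 2 := by gcongr; linarith
    have hw0 : 0 < ‖w‖ := by linarith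
    calc _ ≤ |C| / ‖w‖ ^ 2 * (2 * ‖w‖) ^ 2 := by
          gcongr
          exact (hC w hw).trans (by gcongr; exact le_abs_self C)
      _ = 4 * |C| := by field_simp; ring
      _ ≤ _ := by linarith [abs_nonneg A]

lemma norm_fderiv_comp_const_sub_le {κ : E3 → ℝ} (hκ : ContDiff ℝ ∞ κ) (x y : E3) :
    ‖fderiv ℝ (fun y => κ (x - y)) y‖ ≤ ‖fderiv ℝ κ (x - y)‖ := by
  have h1 := ((hκ.differentiable (by simp) (x - y)).hasFDerivAt).comp y
    ((hasFDerivAt_id y).const_sub x)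
  have h2 : fderiv ℝ (fun y => κ (x - y)) y = _ := h1.fderiv
  rw [h2]
  refine (ContinuousLinearMap.opNorm_comp_le _ _).trans ?_
  rw [norm_neg]
  exact mul_le_of_le_one_right (norm_nonneg _) ContinuousLinearMap.norm_id_le

/-- Translating by a point of a bounded set changes the weight only by a bounded factor; this makes
the decay uniform over the neighbourhoods of the electrodes. -/
lemma inv_one_add_norm_sub_le {x y p : E3} {L s : ℝ} (hL : 1 + ‖p‖ + s ≤ L) (hs : 0 ≤ s)
    (hy : ‖y - p‖ ≤ s) : ((1 + ‖x - y‖) ^ 2)⁻¹ ≤ L ^ 2 * ((1 + ‖x‖) ^ 2)⁻¹ := by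
  have h1 : ‖x‖ ≤ ‖x - y‖ + (‖y - p‖ + ‖p‖) := by
    calc ‖x‖ = ‖(x - y) + ((y - p) + p)‖ := by congr 1; abel
      _ ≤ _ := (norm_add_le _ _).trans (by gcongr; exact norm_add_le _ _)
  have hp := norm_nonneg p
  have h2 : 1 + ‖x‖ ≤ L * (1 + ‖x - y‖) := by
    have := norm_nonneg (x - y)
    nlinarith
  rw [← div_eq_mul_inv, le_div_iff₀ (by positivity), inv_mul_le_iff₀ (by positivity), ← mul_pow,
    mul_comm _ L]
  gcongr

/-- Potentials of electrode densities with a smooth kernel whose gradient decays quadratically are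
close to the potential of a pair of point charges. -/
lemma exists_farField_bound (pPlus pMinus : E3) {R : ℝ} (hR : 0 < R) {κ : E3 → ℝ}
    (hκ : ContDiff ℝ ∞ κ) {B : ℝ} (hB : ∀ x, |κ x| ≤ B) {C : ℝ}
    (hC : ∀ w, 1 ≤ ‖w‖ → ‖fderiv ℝ κ w‖ ≤ C / ‖w‖ ^ 2) :
    ∃ K : ℝ, 0 < K ∧ ∀ {h ρ : ℝ} {g : E3 → ℂ}, 0 < h → 2 * h < R →
      Disjoint (electrode pPlus h) (electrode pMinus h) →
      IsElectrodeDensity pPlus pMinus h ρ g → ∀ x : E3,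
      ‖(∫ y, κ (x - y) • g y ∂surfaceMeasure) - ((κ (x - pPlus) - κ (x - pMinus) : ℝ) : ℂ)‖ ≤
        K * h * ((1 + ‖x‖) ^ 2)⁻¹ := by
  obtain ⟨K, hK, hdec⟩ := exists_decay_bound (hκ.continuous_fderiv (by simp)) hC
  obtain ⟨A, hA, hpt⟩ := exists_pointCharge_bound
  -- Since `2h < R`, the balls of radius `6h` around the centres have radius below `3R`; hence `L`,
  -- and with it the constant, is independent of `h`.
  set L := 1 + ‖pPlus‖ + ‖pMinus‖ + 3 * R
  have hL : 0 < L := by positivity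
  refine ⟨2 * A * (K * L ^ 2), by positivity, fun {h ρ g} hh hhR hd hg x => ?_⟩
  set M := K * L ^ 2 * ((1 + ‖x‖) ^ 2)⁻¹
  have hM : 0 < M := by positivity
  have hk : ContDiff ℝ ∞ fun y => κ (x - y) := hκ.comp (by fun_prop)
  have hgrad : ∀ {p : E3}, 1 + ‖p‖ + 3 * R ≤ L → ∀ y, ‖y - p‖ ≤ 6 * h →
      ‖fderiv ℝ (fun y => κ (x - y)) y‖ ≤ M := fun hp y hy => by
    refine (norm_fderiv_comp_const_sub_le hκ x y).trans ((hdec _).trans ?_)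
    simp only [M]
    rw [mul_assoc]
    gcongr
    exact inv_one_add_norm_sub_le hp (by positivity) (by linarith)
  have hgP := hgrad (p := pPlus) (by simp only [L]; linarith [norm_nonneg pMinus])
  have hgM := hgrad (p := pMinus) (by simp only [L]; linarith [norm_nonneg pPlus])
  have hint := integrable_kernel_smul hg.dens.int hκ.continuous hB x
  have hIre : ∀ p : E3, ∫ y in electrode p h, (g y).re ∂surfaceMeasure =
      (∫ y in electrode p h, g y ∂surfaceMeasure).re := fun p =>
    Complex.reCLM.integral_comp_comm hg.dens.int.integrableOn
  have hIim : ∀ p : E3, ∫ y in electrode p h, (g y).im ∂surfaceMeasure =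
      (∫ y in electrode p h, g y ∂surfaceMeasure).im := fun p =>
    Complex.imCLM.integral_comp_comm hg.dens.int.integrableOn
  have bre := hpt hg.re hh hd hg.energy_re
    (by filter_upwards [hg.ae_eq_zero] with y hy hy'; rw [hy hy', Complex.zero_re]) 1 (by simp)
    (by rw [hIre, hg.integral_plus, Complex.one_re])
    (by rw [hIre, hg.integral_minus, Complex.neg_re, Complex.one_re]) _ M hk hM hgP hgM
  -- The imaginary part carries no net current through either electrode, so its point charges are 0.
  have bim := hpt hg.im hh hd hg.energy_im
    (by filter_upwards [hg.ae_eq_zero] with y hy hy'; rw [hy hy', Complex.zero_im]) 0 (by simp)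
    (by rw [hIim, hg.integral_plus, Complex.one_im])
    (by rw [hIim, hg.integral_minus, Complex.neg_im, Complex.one_im]) _ M hk hM hgP hgM
  have ere : (∫ y, κ (x - y) • g y ∂surfaceMeasure).re =
      ∫ y, κ (x - y) * (g y).re ∂surfaceMeasure := by
    have := (Complex.reCLM.integral_comp_comm hint).symm
    simpa using this
  have eim : (∫ y, κ (x - y) • g y ∂surfaceMeasure).im =
      ∫ y, κ (x - y) * (g y).im ∂surfaceMeasure := by
    have := (Complex.imCLM.integral_comp_comm hint).symm
    simpa using this
  refine (Complex.norm_le_abs_re_add_abs_im _).trans ?_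
  rw [Complex.sub_re, Complex.sub_im, Complex.ofReal_re, Complex.ofReal_im, ere, eim, sub_zero]
  rw [one_mul] at bre
  rw [zero_mul, sub_zero] at bim
  calc _ ≤ A * h * M + A * h * M := add_le_add bre bim
    _ = _ := by simp only [M]; ring

lemma isOpen_farRegion (pPlus pMinus : E3) (R : ℝ) : IsOpen (farRegion pPlus pMinus R) := by
  have h1 : IsOpen {x : E3 | R < ‖x - pPlus‖} := isOpen_lt continuous_const (by fun_prop)
  have h2 : IsOpen {x : E3 | R < ‖x - pMinus‖} := isOpen_lt continuous_const (by fun_prop)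
  exact isOpen_lowerHalfSpace.inter (h1.inter h2)

lemma two_newt_of_le {ε : ℝ} (hε : 0 < ε) {x : E3} (hx : ε ≤ ‖x‖) :
    2 * newt ε x = 1 / (2 * Real.pi * ‖x‖) := by
  rw [newt_of_le hε hx]
  have : 0 < ‖x‖ := hε.trans_le hx
  have := Real.pi_pos
  field_simp
  norm_num

/-- A smooth representative of the difference between the potential of an electrode density and
the point electrode potential. -/
def farDiff (ε : ℝ) (pPlus pMinus : E3) (g : E3 → ℂ) (x : E3) : ℂ :=
  slpReg ε g x - ((2 * newt ε (x - pPlus) - 2 * newt ε (x - pMinus) : ℝ) : ℂ)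

/-- For `x` in the far region and `y` on an electrode, `‖x - y‖ > R - h > R / 2`, so regularization
at scale `R / 2` does not affect the kernel. -/
lemma slp_sub_dipole_eq {R : ℝ} (hhR : 2 * h < R) (hR : 0 < R)
    (h0 : ∀ᵐ y ∂surfaceMeasure, y ∉ electrode pPlus h ∪ electrode pMinus h → g y = 0)
    {x : E3} (hx : x ∈ farRegion pPlus pMinus R) :
    slp g x - (dipole pPlus pMinus x : ℂ) = farDiff (R / 2) pPlus pMinus g x := by
  have hε : 0 < R / 2 := by positivity
  obtain ⟨-, hxP, hxM⟩ := hx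
  have e1 : slp g x = slpReg (R / 2) g x := by
    refine integral_congr_ae ?_
    filter_upwards [h0] with y hy
    by_cases hy' : y ∈ electrode pPlus h ∪ electrode pMinus h
    · rw [two_newt_of_le hε]
      rcases hy' with hy' | hy'
      · linarith [hy'.2, norm_sub_le_norm_sub_add_norm_sub x y pPlus]
      · linarith [hy'.2, norm_sub_le_norm_sub_add_norm_sub x y pMinus]
    · rw [hy hy', smul_zero, smul_zero]
  rw [e1, farDiff, dipole, fundamentalSolution, fundamentalSolution, newt_of_le hε (by linarith),
    newt_of_le hε (by linarith)]
  ring_nf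

lemma IsDensity.farDiff_contDiff (hg : IsDensity ρ g) {ε : ℝ} (hε : 0 < ε) (pPlus pMinus : E3) :
    ContDiff ℝ ∞ (farDiff ε pPlus pMinus g) := by
  refine (hg.slpReg_contDiff hε).sub (Complex.ofRealCLM.contDiff.comp ?_)
  exact ((two_newt_contDiff ε).comp (by fun_prop : ContDiff ℝ ∞ fun x : E3 => x - pPlus)).sub
    ((two_newt_contDiff ε).comp (by fun_prop : ContDiff ℝ ∞ fun x : E3 => x - pMinus))

lemma IsDensity.fderiv_farDiff (hg : IsDensity ρ g) {ε : ℝ} (hε : 0 < ε) (pPlus pMinus x v : E3) :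
    fderiv ℝ (farDiff ε pPlus pMinus g) x v =
      (∫ y, fderiv ℝ (fun x => 2 * newt ε x) (x - y) v • g y ∂surfaceMeasure) -
        ((fderiv ℝ (fun x => 2 * newt ε x) (x - pPlus) v -
          fderiv ℝ (fun x => 2 * newt ε x) (x - pMinus) v : ℝ) : ℂ) := by
  have hκ : Differentiable ℝ fun x => 2 * newt ε x := (two_newt_contDiff ε).differentiable (by simp)
  have h1 : ∀ p : E3, HasFDerivAt (fun x => 2 * newt ε (x - p))
      (fderiv ℝ (fun x => 2 * newt ε x) (x - p)) x := fun p => by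
    have := (hκ (x - p)).hasFDerivAt.comp x ((hasFDerivAt_id x).sub_const p)
    rwa [ContinuousLinearMap.comp_id] at this
  have h2 := (((hg.slpReg_contDiff hε).differentiable (by simp) x).hasFDerivAt).sub
    (Complex.ofRealCLM.hasFDerivAt.comp x ((h1 pPlus).sub (h1 pMinus)))
  have h3 : fderiv ℝ (farDiff ε pPlus pMinus g) x = _ := h2.fderiv
  rw [h3, ← hg.fderiv_slpReg hε]
  rfl

lemma norm_gradC_le (V : E3 → ℂ) (x : E3) :
    ‖gradC V x‖ ≤ ∑ i, ‖fderiv ℝ V x (EuclideanSpace.single i 1)‖ := by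
  rw [EuclideanSpace.norm_eq]
  refine Real.sqrt_le_iff.2 ⟨by positivity, ?_⟩
  simp only [gradC_apply]
  exact Finset.sum_sq_le_sq_sum_of_nonneg fun _ _ => norm_nonneg _

/-- The second derivatives decay cubically; for `‖w‖ ≥ 1` this is weakened to the quadratic decay
that `exists_farField_bound` asks of its kernel. -/
lemma norm_fderiv_partial_newt_le {ε : ℝ} (hε : 0 < ε) (v w : E3) (hw : 1 ≤ ‖w‖) :
    ‖fderiv ℝ (fun x => fderiv ℝ (fun x => 2 * newt ε x) x v) w‖ ≤ 2 * newtC * ‖v‖ / ‖w‖ ^ 2 := by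
  have hw0 : 0 < ‖w‖ := by linarith
  have hC := newtC_pos
  have hd : HasFDerivAt (fderiv ℝ (newt ε)) (fderiv ℝ (fderiv ℝ (newt ε)) w) w :=
    ((fderiv_newt_contDiff ε).differentiable (by simp) w).hasFDerivAt
  have e : (fun x => fderiv ℝ (fun x => 2 * newt ε x) x v) =
      fun x => 2 * fderiv ℝ (newt ε) x v := by
    ext x; rw [fderiv_two_newt]; rfl
  rw [e]
  refine ContinuousLinearMap.opNorm_le_bound _ (by positivity) fun z => ?_
  have h2 : fderiv ℝ (fun x => 2 * fderiv ℝ (newt ε) x v) w z =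
      2 * fderiv ℝ (fderiv ℝ (newt ε)) w z v := by
    have := ((hd.clm_apply (hasFDerivAt_const v w)).const_mul 2).fderiv
    rw [this]
    simp
  rw [h2, norm_mul, Real.norm_of_nonneg zero_le_two]
  have h3 : ‖fderiv ℝ (fderiv ℝ (newt ε)) w z v‖ ≤ newtC / ‖w‖ ^ 2 * ‖z‖ * ‖v‖ := by
    refine (ContinuousLinearMap.le_opNorm₂ _ _ _).trans ?_
    gcongr
    refine (norm_fderiv_fderiv_newt_le hε (norm_pos_iff.1 hw0)).trans ?_
    gcongr
    norm_num
  calc _ ≤ 2 * (newtC / ‖w‖ ^ 2 * ‖z‖ * ‖v‖) := by gcongr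
    _ = _ := by ring

/-- The infimum is at most its value at the classical gradient of the smooth representative, and
`√(c² + d²) ≤ c + d`. -/
lemma h1Norm_le_of_pointwise {O : Set E3} (hO : IsOpen O) {u V : E3 → ℂ} (hV : ContDiff ℝ ∞ V)
    (huV : ∀ᵐ x ∂volume.restrict O, u x = V x) {N : E3 → ℝ} (hN : MemLp N 2 volume) {c d : ℝ}
    (hc : 0 ≤ c) (hd : 0 ≤ d) (h1 : ∀ x, ‖V x‖ ≤ c * N x) (h2 : ∀ x, ‖gradC V x‖ ≤ d * N x) :
    h1Norm O u ≤ ENNReal.ofReal ((c + d) * (eLpNorm N 2 volume).toReal) := by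
  have key : ∀ {F : Type} [NormedAddCommGroup F] {f : E3 → F} {b : ℝ}, 0 ≤ b →
      (∀ᵐ x ∂volume.restrict O, ‖f x‖ ≤ b * N x) →
      eLpNorm f 2 (volume.restrict O) ≤ ENNReal.ofReal (b * (eLpNorm N 2 volume).toReal) := by
    intro F _ f b hb hf
    refine (eLpNorm_mono_ae_real hf).trans ?_
    refine (eLpNorm_restrict_le (fun x => b * N x) 2 volume O).trans (le_of_eq ?_)
    rw [ENNReal.ofReal_mul hb, ENNReal.ofReal_toReal hN.2.ne]
    have := eLpNorm_const_smul b N 2 (volume : Measure E3)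
    rw [Real.enorm_eq_ofReal hb] at this
    exact this
  have hw : HasWeakGradient O u (gradC V) :=
    (HasWeakGradient.of_contDiffOn hO ((hV.of_le (by simp)).contDiffOn)).congr huV
  refine (iInf₂_le (gradC V) hw).trans ?_
  have e1 := key (f := u) hc (by filter_upwards [huV] with x hx; rw [hx]; exact h1 x)
  have e2 := key (f := gradC V) hd (Eventually.of_forall h2)
  set ν := (eLpNorm N 2 volume).toReal
  have hν : 0 ≤ ν := ENNReal.toReal_nonneg
  calc _ ≤ (ENNReal.ofReal (c * ν) ^ 2 + ENNReal.ofReal (d * ν) ^ 2) ^ (1 / 2 : ℝ) := by gcongr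
    _ ≤ (ENNReal.ofReal ((c + d) * ν) ^ 2) ^ (1 / 2 : ℝ) := by
        gcongr
        rw [← ENNReal.ofReal_pow (by positivity), ← ENNReal.ofReal_pow (by positivity),
          ← ENNReal.ofReal_pow (by positivity), ← ENNReal.ofReal_add (by positivity) (by positivity)]
        apply ENNReal.ofReal_le_ofReal
        have : 0 ≤ (c * ν) * (d * ν) := by positivity
        nlinarith
    _ = _ := by
        rw [← ENNReal.rpow_natCast, ← ENNReal.rpow_mul]
        norm_num

end FarField

theorem lemmaA1 (pPlus pMinus : E3)
    (hpPlus : pPlus ∈ frontier lowerHalfSpace) (hpMinus : pMinus ∈ frontier lowerHalfSpace)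
    (zPlus zMinus : ℂ) (hzPlus : 0 ≤ zPlus.re) (hzMinus : 0 ≤ zMinus.re)
    (R : ℝ) (hR : 0 < R) :
    ∃ C : ℝ, ∀ h : ℝ, 0 < h → 2 * h < R →
      Disjoint (electrode pPlus h) (electrode pMinus h) →
      ∀ (PPlus PMinus : ℂ) (u : E3 → ℂ),
        IsCEMSolution pPlus pMinus h zPlus zMinus PPlus PMinus u →
        h1Norm (farRegion pPlus pMinus R) (fun x => u x - (dipole pPlus pMinus x : ℂ))
          ≤ ENNReal.ofReal (C * h) := by
  have hpP := frontier_lowerHalfSpace_subset hpPlus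
  have hpM := frontier_lowerHalfSpace_subset hpMinus
  have hε : 0 < R / 2 := by positivity
  have hκ := two_newt_contDiff (R / 2)
  obtain ⟨K, hK, hval⟩ := exists_farField_bound pPlus pMinus hR hκ (abs_two_newt_le hε)
    (C := 2 * newtC) fun w hw =>
      (norm_fderiv_two_newt_le' hε (norm_pos_iff.1 (by linarith))).trans (le_of_eq (by ring))
  -- The gradient is estimated by the same lemma, with the partial derivatives of the kernel as
  -- kernels.
  have hpart : ∀ i : Fin 3, _ := fun i => exists_farField_bound pPlus pMinus hR
    (κ := fun x => fderiv ℝ (fun x => 2 * newt (R / 2) x) x (EuclideanSpace.single i 1))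
    ((hκ.fderiv_right (by simp)).clm_apply contDiff_const)
    (B := 2 * (newtC / (R / 2) ^ 2))
    (fun x => by
      refine ((fderiv ℝ (fun x => 2 * newt (R / 2) x) x).le_opNorm _).trans ?_
      rw [PiLp.norm_single, norm_one, mul_one]
      exact norm_fderiv_two_newt_le hε x)
    (norm_fderiv_partial_newt_le hε _)
  choose J hJ hgrad using hpart
  set ν := (eLpNorm (fun x : E3 => ((1 + ‖x‖) ^ 2)⁻¹) 2 volume).toReal
  refine ⟨(K + ∑ i, J i) * ν, fun h hh hhR hd PPlus PMinus u hu => ?_⟩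
  obtain ⟨ρ, g, hg, hug⟩ := hu.exists_isElectrodeDensity hpP hpM hh hd hzPlus hzMinus
  have hsub : farRegion pPlus pMinus R ⊆ lowerHalfSpace := fun x hx => hx.1
  have hae : ∀ᵐ x ∂volume.restrict (farRegion pPlus pMinus R),
      u x - (dipole pPlus pMinus x : ℂ) = farDiff (R / 2) pPlus pMinus g x := by
    filter_upwards [ae_mono (Measure.restrict_mono hsub le_rfl) hug,
      ae_restrict_mem (isOpen_farRegion pPlus pMinus R).measurableSet] with x hx hxR
    rw [hx, slp_sub_dipole_eq hhR hR hg.ae_eq_zero hxR]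
  have hsum : 0 ≤ ∑ i, J i := Finset.sum_nonneg fun i _ => (hJ i).le
  refine (h1Norm_le_of_pointwise (isOpen_farRegion pPlus pMinus R)
    (hg.dens.farDiff_contDiff hε pPlus pMinus) hae memLp_one_add_norm (c := K * h)
    (d := (∑ i, J i) * h) (by positivity) (by positivity)
    (fun x => hval hh hhR hd hg x) fun x => ?_).trans (le_of_eq (by congr 1; ring))
  refine (norm_gradC_le _ x).trans ?_
  rw [Finset.sum_mul, Finset.sum_mul]
  refine Finset.sum_le_sum fun i _ => ?_
  rw [hg.dens.fderiv_farDiff hε]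
  exact hgrad i hh hhR hd hg x

end
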